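/- **Notation.** Let $n\ge 1$ and identify $\mathbb H^n$ with $\mathbb R^{4n}$ by $q_l=x_{4l}+\mathbf i x_{4l+1}+\mathbf j x_{4l+2}+\mathbf k x_{4l+3}$, $0\le l\le n-1$. For $\alpha=0,1$ and $0\le j\le 2n-1$ define first-order operators $\nabla_{j\alpha}$ by $$\begin{pmatrix}\nabla_{(2l)0}&\nabla_{(2l)1}\\ \nabla_{(2l+1)0}&\nabla_{(2l+1)1}\end{pmatrix}=\begin{pmatrix}\partial_{x_{4l}}+\mathbf i\partial_{x_{4l+1}}&-\partial_{x_{4l+2}}-\mathbf i\partial_{x_{4l+3}}\\ \partial_{x_{4l+2}}-\mathbf i\partial_{x_{4l+3}}&\partial_{x_{4l}}-\mathbf i\partial_{x_{4l+1}}\end{pmatrix},$$ and $\triangle_{ij}=\frac12(\nabla_{i0}\nabla_{j1}-\nabla_{i1}\nabla_{j0})$. Let $\omega^0,\dots,\omega^{2n-1}$ be a basis of $\mathbb C^{2n}$. For $\wedge^{p}\mathbb C^{2n}$-valued functions put $d_\alpha\big(\sum_I f_I\,\omega^I\big)=\sum_{k,I}\nabla_{k\alpha}f_I\,\omega^k\wedge\omega^I$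 and $\triangle=d_0d_1$. A $p$-current of order zero on an open set $\Omega\subseteq\mathbb H^n$ is a linear functional on the continuous, compactly supported $\wedge^{2n-p}\mathbb C^{2n}$-valued functions on $\Omega$ that is bounded in the supremum norm on the functions supported in any fixed compact subset of $\Omega$. A finite-valued upper semicontinuous function on $\Omega$ is plurisubharmonic (PSH) if it is subharmonic on each right quaternionic line $\{a+vc:c\in\mathbb H\}$, $v\ne0$. It is strictly PSH if moreover each point of $\Omega$ has a neighbourhood on which $u-\varepsilon\|q\|^2$ is PSH for some $\varepsilon>0$. For a continuous PSH function $u$ on $\Omega$ the currents $(\triangle u)^k$, $0\le k\le n$, are defined inductively as the currents of order zero with $(\triangle u)^0=1$, that is $f\,\omega^0\wedge\dots\wedge\omega^{2n-1}\mapsto\int_\Omega f\,dV$, and $(\triangle u)^{k+1}=\triangle\big(u(\triangle u)^k\big)$, that is $(\triangle u)^{k+1}(\eta)=(\triangle u)^k(u\,\triangle\eta)$ for all test forms $\eta$. The Monge–Ampère measure $\triangle_nu$ is the Radon measure on $\Omega$ with $(\triangle u)^n=\triangle_nu\;\omega^0\wedge\dots\wedge\omega^{2n-1}$. For $r\in\mathbb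 R$ and a continuous PSH function $\varphi$ on $\Omega$ let $B_\varphi(r)=\{q\in\Omega:\varphi(q)<r\}$ and $S_\varphi(r)=\{q\in\Omega:\varphi(q)=r\}$. The quaternionic boundary measure of $\varphi$ is the nonnegative Borel measure $$\mu_{\varphi,r}=\triangle_n(\max\{\varphi,r\})-\chi_{\Omega\setminus B_\varphi(r)}\,\triangle_n\varphi .$$ **Proposition.** Let $\Omega\subseteq\mathbb H^n$ be a quaternionic strictly pseudoconvex domain, i.e. a domain that has a strictly PSH exhaustion function. Let $\varphi$ be a continuous PSH function on $\Omega$ and $r\in\mathbb R$, and suppose that $\varphi$ is smooth in a neighbourhood of $S_\varphi(r)$ and that $d\varphi\ne0$ on $S_\varphi(r)$. Then the measure $\mu_{\varphi,r}$ exists and is given by $$\mu_{\varphi,r}=\sum_{i_1,j_1,\dots,i_n,j_n}\delta^{i_1j_1\dots i_nj_n}_{01\dots(2n-1)}\,\nabla_{j_11}\varphi\;\triangle_{i_2j_2}\varphi\cdots\triangle_{i_nj_n}\varphi\cdot n_{i_10}\,dS ,$$ where the density on the right is real and nonnegative on $S_\varphi(r)$. Here $\delta^{i_1j_1\dots i_nj_n}_{01\dots(2n-1)}$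 is the sign of the permutation $(i_1,j_1,\dots,i_n,j_n)$ of $(0,1,\dots,2n-1)$, and is $0$ if this is not a permutation; $dS$ is the surface measure of $S_\varphi(r)$; and $$n_{(2l)0}=n_{4l}+\mathbf i\,n_{4l+1},\qquad n_{(2l+1)0}=n_{4l+2}-\mathbf i\,n_{4l+3},$$ where $\mathbf n=(n_0,\dots,n_{4n-1})=\nabla\varphi/|\nabla\varphi|$ is the unit normal of $S_\varphi(r)$ pointing out of $B_\varphi(r)$. -/

import Mathlib

open MeasureTheory Set
open scoped ContDiff Quaternion

noncomputable section

namespace QuatMA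

/-- `ℍⁿ ≅ ℝ⁴ⁿ` with its Euclidean norm. The coordinate `(l, a)` is `x_{4l+a}`, so that
`q_l = x_{4l} + i x_{4l+1} + j x_{4l+2} + k x_{4l+3}`. -/
abbrev HSpace (n : ℕ) : Type := EuclideanSpace ℝ (Fin n × Fin 4)

/-- The index set `{0, …, 2n-1}`; the pair `(l, b)` is the index `2l + b`. -/
abbrev Idx (n : ℕ) : Type := Fin n × Fin 2

/-- The integer `2l + b` corresponding to `(l, b)`. -/
def pos {n : ℕ} (j : Idx n) : ℕ := 2 * j.1.val + j.2.val

/-! ### The first-order operators -/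

/-- The `(j, α)` entry of the `2n × 2` matrix whose `l`-th block of two rows is
`c_{4l} + i c_{4l+1}, -c_{4l+2} - i c_{4l+3}` and `c_{4l+2} - i c_{4l+3}, c_{4l} - i c_{4l+1}`. -/
def blockEntry {n : ℕ} (j : Idx n) (α : Fin 2) (c : Fin n × Fin 4 → ℂ) : ℂ :=
  match j.2, α with
  | 0, 0 => c (j.1, 0) + Complex.I * c (j.1, 1)
  | 0, 1 => -c (j.1, 2) - Complex.I * c (j.1, 3)
  | 1, 0 => c (j.1, 2) - Complex.I * c (j.1, 3)
  | 1, 1 => c (j.1, 0) - Complex.I * c (j.1, 1)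

/-- The real partial derivative `∂_{x_m}` of a complex-valued function. -/
def partialD {n : ℕ} (m : Fin n × Fin 4) (f : HSpace n → ℂ) (q : HSpace n) : ℂ :=
  fderiv ℝ f q (EuclideanSpace.single m (1 : ℝ))

/-- The operator `∇_{jα}`. -/
def nabla {n : ℕ} (j : Idx n) (α : Fin 2) (f : HSpace n → ℂ) (q : HSpace n) : ℂ :=
  blockEntry j α (fun m => partialD m f q)

/-- `△_{ij} f = (∇_{i0} ∇_{j1} f - ∇_{i1} ∇_{j0} f) / 2`. -/
def triangle {n : ℕ} (i j : Idx n) (f : HSpace n → ℂ) (q : HSpace n) : ℂ :=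
  (1 / 2) * (nabla i 0 (nabla j 1 f) q - nabla i 1 (nabla j 0 f) q)

/-! ### Forms -/

/-- A function with values in the exterior algebra of `ℂ²ⁿ`: `η q I` is the coefficient of
`ω^I = ω^{i_1} ∧ … ∧ ω^{i_p}`, where `i_1 < … < i_p` are the elements of `I`. -/
abbrev Form (n : ℕ) : Type := HSpace n → Finset (Idx n) → ℂ

/-- The sign with `ω^k ∧ ω^{J \ {k}} = wedgeSign k J · ω^J` for `k ∈ J`. -/
def wedgeSign {n : ℕ} (k : Idx n) (J : Finset (Idx n)) : ℂ :=
  (-1) ^ (J.filter (fun l => pos l < pos k)).card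

/-- `d_α (∑_I f_I ω^I) = ∑_{k, I} ∇_{kα} f_I ω^k ∧ ω^I`. -/
def dOp {n : ℕ} (α : Fin 2) (η : Form n) : Form n := fun q J =>
  ∑ k ∈ J, wedgeSign k J * nabla k α (fun p => η p (J.erase k)) q

/-- The Baston operator `△ = d_0 d_1`. -/
def baston {n : ℕ} (η : Form n) : Form n := dOp 0 (dOp 1 η)

/-- A function viewed as a `0`-form. -/
def zeroForm {n : ℕ} (f : HSpace n → ℂ) : Form n := fun q I => if I = ∅ then f q else 0

/-- The product of a real function with a form. -/
def funMul {n : ℕ} (u : HSpace n → ℝ) (η : Form n) : Form n := fun q I => (u q : ℂ) * η q I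

/-- Continuous forms with compact support in `Ω`. -/
def ContForm {n : ℕ} (Ω : Set (HSpace n)) (η : Form n) : Prop :=
  Continuous η ∧ HasCompactSupport η ∧ tsupport η ⊆ Ω

/-- Test forms: smooth forms with compact support in `Ω`. -/
def TestForm {n : ℕ} (Ω : Set (HSpace n)) (η : Form n) : Prop :=
  ContDiff ℝ ∞ η ∧ HasCompactSupport η ∧ tsupport η ⊆ Ω

/-! ### Currents -/

/-- `T` is a current of order zero on `Ω`: a linear functional on the continuous forms with
compact support in `Ω` that is bounded for the supremum norm on the forms supported in any fixed
compact set. (A `p`-current is one that vanishes on forms of degree other than `2n - p`; values of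
`T` outside `ContForm Ω` carry no meaning.) -/
structure IsCurrent {n : ℕ} (Ω : Set (HSpace n)) (T : Form n → ℂ) : Prop where
  map_add : ∀ η ζ, ContForm Ω η → ContForm Ω ζ → T (η + ζ) = T η + T ζ
  map_smul : ∀ (c : ℂ) (η), ContForm Ω η → T (c • η) = c * T η
  bounded : ∀ K : Set (HSpace n), IsCompact K → K ⊆ Ω → ∃ C : ℝ, ∀ η, ContForm Ω η →
    tsupport η ⊆ K → ∀ M : ℝ, (∀ q, ‖η q‖ ≤ M) → ‖T η‖ ≤ C * M

/-- For a continuous function `u` and a current `S` of order zero, `T` is the current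
`△u ∧ S := △(uS)`, that is `T(η) = S(u △η)` for all test forms `η`; it is required to have order
zero, that is to have measure coefficients, and is then determined by its values on test forms. -/
def IsBastonWedge {n : ℕ} (Ω : Set (HSpace n)) (u : HSpace n → ℝ) (S T : Form n → ℂ) : Prop :=
  IsCurrent Ω T ∧ ∀ η, TestForm Ω η → T η = S (funMul u (baston η))

/-- `T` is the current `(△u)^k = △u ∧ … ∧ △u` on `Ω`, defined inductively by
`(△u)^{k+1} = △(u (△u)^k)`; the starting point `(△u)^0` is the `0`-current `1`, which maps
`f ω^0 ∧ ω^1 ∧ … ∧ ω^{2n-1}` to `∫ f dV` and forms of lower degree to `0`. -/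
def IsBastonPower {n : ℕ} (Ω : Set (HSpace n)) (u : HSpace n → ℝ) : ℕ → (Form n → ℂ) → Prop
  | 0, T => ∀ η, ContForm Ω η → T η = ∫ q, η q Finset.univ
  | k + 1, T => ∃ S, IsBastonPower Ω u k S ∧ IsBastonWedge Ω u S T

/-- `μ` is the quaternionic Monge-Ampère measure `△_n u` on `Ω`: a Radon measure on `Ω` (viewed
as a measure on `ℍⁿ` that vanishes outside `Ω`) with `(△u)^n = μ ω^0 ∧ ω^1 ∧ … ∧ ω^{2n-1}`. -/
def IsMongeAmpere {n : ℕ} (Ω : Set (HSpace n)) (u : HSpace n → ℝ) (μ : Measure (HSpace n)) :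
    Prop :=
  μ Ωᶜ = 0 ∧ (∀ K : Set (HSpace n), IsCompact K → K ⊆ Ω → μ K < ⊤) ∧
  ∃ T : Form n → ℂ, IsBastonPower Ω u n T ∧
    ∀ f : HSpace n → ℂ, Continuous f → HasCompactSupport f → tsupport f ⊆ Ω →
      T (zeroForm f) = ∫ q, f q ∂μ

/-! ### Plurisubharmonic functions -/

/-- Subharmonic functions on an open subset `D` of `ℝ⁴ ≅ ℍ`: upper semicontinuous functions
satisfying the sub-mean value inequality on all closed balls in `D`. (A finite-valued function of
this kind is automatically locally integrable.) -/
def Subharmonic (D : Set (EuclideanSpace ℝ (Fin 4))) (f : EuclideanSpace ℝ (Fin 4) → ℝ) : Prop :=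
  UpperSemicontinuousOn f D ∧
  ∀ (c : EuclideanSpace ℝ (Fin 4)) (R : ℝ), 0 < R → Metric.closedBall c R ⊆ D →
    IntegrableOn f (Metric.closedBall c R) ∧ f c ≤ ⨍ x in Metric.closedBall c R, f x

/-- The `l`-th quaternionic coordinate `q_l` of a point of `ℍⁿ`. -/
def quatCoord {n : ℕ} (q : HSpace n) (l : Fin n) : ℍ[ℝ] :=
  ⟨q (l, 0), q (l, 1), q (l, 2), q (l, 3)⟩

/-- Right multiplication `(v_0, …, v_{n-1}) ↦ (v_0 c, …, v_{n-1} c)` by the quaternion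
`c = c_0 + i c_1 + j c_2 + k c_3`. -/
def rightMul {n : ℕ} (v : HSpace n) (c : EuclideanSpace ℝ (Fin 4)) : HSpace n :=
  WithLp.toLp 2 fun m =>
    let z : ℍ[ℝ] := quatCoord v m.1 * ⟨c 0, c 1, c 2, c 3⟩
    ![z.re, z.imI, z.imJ, z.imK] m.2

/-- Plurisubharmonic (finite-valued) functions on an open set `Ω ⊆ ℍⁿ`: upper semicontinuous
functions that are subharmonic on each right quaternionic line `{a + v c : c ∈ ℍ}`, `v ≠ 0`. -/
def PSH {n : ℕ} (Ω : Set (HSpace n)) (u : HSpace n → ℝ) : Prop :=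
  UpperSemicontinuousOn u Ω ∧
  ∀ a v : HSpace n, v ≠ 0 →
    Subharmonic {c | a + rightMul v c ∈ Ω} (fun c => u (a + rightMul v c))

/-- Strictly plurisubharmonic: locally `u - ε ‖q‖²` is plurisubharmonic for some `ε > 0`. -/
def StrictPSH {n : ℕ} (Ω : Set (HSpace n)) (u : HSpace n → ℝ) : Prop :=
  PSH Ω u ∧ ∀ a ∈ Ω, ∃ W : Set (HSpace n), IsOpen W ∧ a ∈ W ∧ W ⊆ Ω ∧
    ∃ ε : ℝ, 0 < ε ∧ PSH W (fun q => u q - ε * ‖q‖ ^ 2)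

/-- A quaternionic strictly pseudoconvex domain: a domain with a strictly plurisubharmonic
exhaustion function, that is, one whose sublevel sets are relatively compact in the domain. -/
def StrictlyPseudoconvex {n : ℕ} (Ω : Set (HSpace n)) : Prop :=
  IsOpen Ω ∧ IsConnected Ω ∧
  ∃ ρ : HSpace n → ℝ, StrictPSH Ω ρ ∧
    ∀ c : ℝ, ∃ K : Set (HSpace n), IsCompact K ∧ K ⊆ Ω ∧ {q ∈ Ω | ρ q < c} ⊆ K

/-! ### The boundary measure -/

/-- `B_φ(r) = {q ∈ Ω : φ(q) < r}`. -/
def sublevel {n : ℕ} (Ω : Set (HSpace n)) (φ : HSpace n → ℝ) (r : ℝ) : Set (HSpace n) :=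
  {q ∈ Ω | φ q < r}

/-- `S_φ(r) = {q ∈ Ω : φ(q) = r}`. -/
def level {n : ℕ} (Ω : Set (HSpace n)) (φ : HSpace n → ℝ) (r : ℝ) : Set (HSpace n) :=
  {q ∈ Ω | φ q = r}

/-- `m` is the quaternionic boundary measure
`△_n (max{φ, r}) - χ_{Ω \ B_φ(r)} △_n φ`. The difference of the two (possibly infinite) measures
is expressed additively; this determines `m`, since both measures are finite on compact sets. -/
def IsBoundaryMeasure {n : ℕ} (Ω : Set (HSpace n)) (φ : HSpace n → ℝ) (r : ℝ)
    (m : Measure (HSpace n)) : Prop :=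
  ∃ μ μr : Measure (HSpace n), IsMongeAmpere Ω φ μ ∧
    IsMongeAmpere Ω (fun q => max (φ q) r) μr ∧
    m + μ.restrict (Ω \ sublevel Ω φ r) = μr

/-- The sign `δ^{i_1 j_1 … i_n j_n}_{0 1 … (2n-1)}` of the permutation
`(i_1, j_1, …, i_n, j_n)` of `(0, 1, …, 2n-1)`; it is zero if this is not a permutation. -/
def deltaSign {n : ℕ} (i j : Fin n → Idx n) : ℂ :=
  open Classical in
  if h : Function.Bijective (fun p : Idx n => if p.2 = 0 then i p.1 else j p.1) then
    ((Equiv.Perm.sign (Equiv.ofBijective _ h) : ℤ) : ℂ)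
  else 0

/-- The unit normal to the level set of `φ` through `q` that points out of the sublevel set. -/
def outerNormal {n : ℕ} (φ : HSpace n → ℝ) (q : HSpace n) : HSpace n :=
  ‖gradient φ q‖⁻¹ • gradient φ q

/-- `n_{jα}`, formed from the outer unit normal as `∇_{jα}` is from the partial derivatives. -/
def normalEntry {n : ℕ} (φ : HSpace n → ℝ) (j : Idx n) (α : Fin 2) (q : HSpace n) : ℂ :=
  blockEntry j α (fun m => ((outerNormal φ q m : ℝ) : ℂ))

/-- `∑ δ^{i_1 j_1 … i_n j_n}_{0 1 … (2n-1)} ∇_{j_1 1}φ △_{i_2 j_2}φ ⋯ △_{i_n j_n}φ · n_{i_1 0}`. -/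
def boundaryDensity {n : ℕ} [NeZero n] (φ : HSpace n → ℝ) (q : HSpace n) : ℂ :=
  ∑ i : Fin n → Idx n, ∑ j : Fin n → Idx n,
    deltaSign i j * nabla (j 0) 1 (fun p => (φ p : ℂ)) q *
      (∏ s ∈ Finset.univ.erase (0 : Fin n), triangle (i s) (j s) (fun p => (φ p : ℂ)) q) *
      normalEntry φ (i 0) 0 q

/-- The surface measure `dS` of `S_φ(r)`: `(4n-1)`-dimensional Hausdorff measure, normalized to
agree with Lebesgue measure on `ℝ^{4n-1}`, restricted to `S_φ(r)`. -/
def surfaceMeasure {n : ℕ} (Ω : Set (HSpace n)) (φ : HSpace n → ℝ) (r : ℝ) :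
    Measure (HSpace n) :=
  (Measure.euclideanHausdorffMeasure (4 * n - 1) : Measure (HSpace n)).restrict (level Ω φ r)

end QuatMA

end

/-! Near a point of the level set `φ` is smooth, and `max φ r` is the uniform limit of `χ ∘ φ` for
convex increasing functions `χ` whose derivative climbs from 0 to 1 just to the left of `r`. The
chain rule gives △(χ∘φ) = χ'(φ) △φ + χ''(φ) d₀φ∧d₁φ. The two-form d₀φ∧d₁φ commutes with △φ and
squares to zero, so (△(χ∘φ))ⁿ = χ'(φ)ⁿ (△φ)ⁿ + n χ'(φ)ⁿ⁻¹ χ''(φ) d₀φ∧d₁φ∧(△φ)ⁿ⁻¹. In the limit the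
first term becomes the Monge–Ampère measure of `φ` restricted to {φ ≥ r}. The scalar factor of the
second term is the derivative of (χ')ⁿ, a unit mass concentrating at `r`, evaluated at `φ`. By the
coarea principle the second term converges to a surface measure on {φ = r} whose density is the
coefficient of d₀φ∧d₁φ∧(△φ)ⁿ⁻¹ divided by |∇φ|. Expanded in the ω^i∧ω^j, this is the density of the
proposition. Away from the level set nothing happens: `max φ r` is either constant or equal to `φ`
there.

Three bodies of facts support this. Positivity: a product of n forms d₀ℓ∧d₁ℓ is the determinant of a
quaternionic matrix, hence nonnegative (`IsQuatMatrix.det_nonneg`, `topCoeff_pow_mul_nonneg`), and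
△u of a smooth plurisubharmonic `u` is a sum of such forms (`hessForm_mem_posCone`). Existence,
uniqueness and locality of the powers: integration by parts and positivity give
Chern–Levine–Nirenberg bounds (`massBound_succ`), so the powers of any smooth plurisubharmonic
approximation converge to the powers of the limit (`isBastonPower_limitPower`,
`IsBastonPower.unique`), and the Riesz theorem produces the measure (`exists_isMongeAmpere`).

The surface limit (`IsMongeAmpere.tendsto_flux`, `exists_nhds_coarea`): a map close to an isometry
flattens the level set to a hyperplane, where Fubini applies. This loses a factor arbitrarily close
to 1, which is harmless because two measures locally comparable with every constant c > 1 coincide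
(`eq_of_locally_comparable`). The pieces meet in `densityMeasure_add_restrict`. -/

noncomputable section

namespace QuatMA

variable {n : ℕ}

/-! ### The exterior algebra acting on coefficient vectors -/

/-- Coefficient vectors of elements of the exterior algebra of `ℂ²ⁿ`. -/
abbrev FormVec (n : ℕ) : Type := Finset (Idx n) → ℂ

/-- The algebra of operators on coefficient vectors. -/
abbrev FormOp (n : ℕ) : Type := Module.End ℂ (FormVec n)

theorem pos_injective : Function.Injective (pos : Idx n → ℕ) := by
  rintro ⟨a, b⟩ ⟨c, d⟩ h
  simp only [pos] at h
  have := b.2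
  have := d.2
  ext <;> simp <;> omega

/-- Left exterior multiplication by `ω^k`. -/
def wedgeLeft (k : Idx n) : FormOp n where
  toFun a J := if k ∈ J then wedgeSign k J * a (J.erase k) else 0
  map_add' a b := by
    ext J
    by_cases h : k ∈ J <;> simp [h, mul_add]
  map_smul' c a := by
    ext J
    by_cases h : k ∈ J <;> simp [h, mul_left_comm]

theorem wedgeLeft_apply (k : Idx n) (a : FormVec n) (J : Finset (Idx n)) :
    wedgeLeft k a J = if k ∈ J then wedgeSign k J * a (J.erase k) else 0 := rfl

/-- Erasing the smaller index `k` removes one element counted by the sign of `l`, while erasing `l`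
leaves the sign of `k` unchanged. -/
theorem wedgeSign_mul_erase {k l : Idx n} {J : Finset (Idx n)} (hk : k ∈ J)
    (h : pos k < pos l) :
    wedgeSign l J * wedgeSign k (J.erase l) = -(wedgeSign k J * wedgeSign l (J.erase k)) := by
  have h1 : (J.erase l).filter (fun x => pos x < pos k) = J.filter (fun x => pos x < pos k) := by
    ext x
    simp only [Finset.mem_filter, Finset.mem_erase]
    constructor
    · rintro ⟨⟨_, h1⟩, h2⟩
      exact ⟨h1, h2⟩
    · rintro ⟨h1, h2⟩
      exact ⟨⟨by rintro rfl; omega, h1⟩, h2⟩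
  have h2 : (J.erase k).filter (fun x => pos x < pos l)
      = (J.filter (fun x => pos x < pos l)).erase k := by
    rw [Finset.filter_erase]
  have h3 : k ∈ J.filter (fun x => pos x < pos l) := Finset.mem_filter.2 ⟨hk, h⟩
  have h4 := Finset.card_erase_add_one h3
  unfold wedgeSign
  rw [h1, h2, ← h4, pow_succ]
  ring

theorem wedgeLeft_anticomm (k l : Idx n) :
    wedgeLeft k * wedgeLeft l = -(wedgeLeft l * wedgeLeft k) := by
  refine LinearMap.ext fun a => funext fun J => ?_
  simp only [Module.End.mul_apply, LinearMap.neg_apply, Pi.neg_apply,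
    wedgeLeft_apply, Finset.mem_erase]
  by_cases hk : k ∈ J
  · by_cases hl : l ∈ J
    · by_cases hkl : k = l
      · simp [hkl]
      · rw [Finset.erase_right_comm (a := l)]
        simp only [hk, hl, if_true, ne_eq, hkl, Ne.symm hkl, not_false_eq_true, and_self]
        rcases lt_or_gt_of_ne (fun h => hkl (pos_injective h)) with h | h
        · have := wedgeSign_mul_erase hk h
          rw [← mul_assoc, ← mul_assoc, this]
          ring
        · have := wedgeSign_mul_erase hl h
          rw [← mul_assoc, ← mul_assoc, this]
          ring
    · simp [hl]
  · simp [hk]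

/-- Left exterior multiplication by a vector of `ℂ²ⁿ`. -/
def wedgeVec : (Idx n → ℂ) →ₗ[ℂ] FormOp n := Fintype.linearCombination ℂ wedgeLeft

theorem wedgeVec_apply (v : Idx n → ℂ) : wedgeVec v = ∑ k, v k • wedgeLeft k := rfl

theorem wedgeVec_single (k : Idx n) : wedgeVec (Pi.single k 1) = wedgeLeft k := by
  simp [wedgeVec]

theorem wedgeVec_anticomm (v w : Idx n → ℂ) :
    wedgeVec v * wedgeVec w = -(wedgeVec w * wedgeVec v) := by
  simp only [wedgeVec_apply, Finset.sum_mul, Finset.mul_sum, Algebra.smul_mul_assoc,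
    Algebra.mul_smul_comm, Finset.smul_sum]
  rw [Finset.sum_comm, ← Finset.sum_neg_distrib]
  refine Finset.sum_congr rfl fun k _ => ?_
  rw [← Finset.sum_neg_distrib]
  refine Finset.sum_congr rfl fun l _ => ?_
  rw [wedgeLeft_anticomm l k, smul_neg, smul_neg, smul_comm, neg_neg]

theorem wedgeVec_sq (v : Idx n → ℂ) : wedgeVec v * wedgeVec v = 0 := by
  have h : (2 : ℂ) • (wedgeVec v * wedgeVec v) = 0 := by
    rw [two_smul]
    nth_rewrite 1 [wedgeVec_anticomm]
    exact neg_add_cancel _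
  exact (smul_eq_zero.1 h).resolve_left two_ne_zero

/-- The coefficient of the top form. -/
def topCoeff : FormVec n →ₗ[ℂ] ℂ := LinearMap.proj Finset.univ

/-- The unit of the exterior algebra. -/
def vac : FormVec n := Pi.single ∅ 1

/-- Each factor added on the left has the smallest index so far, so no sign ever appears. -/
theorem wedgeLeft_list_prod_vac (L : List (Idx n)) (hL : L.Pairwise (fun a b => pos a < pos b)) :
    (L.map wedgeLeft).prod vac = Pi.single L.toFinset 1 := by
  induction L with
  | nil => simp [vac]
  | cons k L ih =>
    rw [List.pairwise_cons] at hL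
    rw [List.map_cons, List.prod_cons, Module.End.mul_apply, ih hL.2]
    have hk : k ∉ L.toFinset := by
      intro h
      exact lt_irrefl _ (hL.1 k (List.mem_toFinset.1 h))
    ext J
    rw [wedgeLeft_apply, List.toFinset_cons]
    by_cases hJ : J = insert k L.toFinset
    · subst hJ
      have h0 : (insert k L.toFinset).filter (fun l => pos l < pos k) = ∅ := by
        rw [Finset.filter_eq_empty_iff]
        intro x hx
        rcases Finset.mem_insert.1 hx with rfl | hx
        · simp
        · exact not_lt.2 (hL.1 x (List.mem_toFinset.1 hx)).le
      simp [wedgeSign, h0, Finset.erase_insert hk]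
    · rw [Pi.single_eq_of_ne hJ]
      split_ifs with hkJ
      · rw [Pi.single_eq_of_ne, mul_zero]
        intro h
        exact hJ (by rw [← h, Finset.insert_erase hkJ])
      · rfl

/-- The top coefficient of a product of `2n` vectors, as an alternating map. -/
def topAlt : (Idx n → ℂ) [⋀^Idx n]→ₗ[ℂ] ℂ :=
  -- Since `wedgeVec v` squares to zero, the operators extend to the exterior algebra, and
  -- alternation is inherited from `ιMulti`. The equivalence `finProdFinEquiv` sends `(l, b)` to `2
  -- * l + b`, the order given by `pos`.
  ((topCoeff ∘ₗ LinearMap.applyₗ (R := ℂ) (M₂ := FormVec n) vac ∘ₗ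
    (ExteriorAlgebra.lift ℂ ⟨wedgeVec, wedgeVec_sq⟩).toLinearMap).compAlternatingMap
      (ExteriorAlgebra.ιMulti ℂ (n * 2))).domDomCongr finProdFinEquiv.symm

theorem list_ofFn_prod_pairs {R : Type*} [Monoid R] (f : Idx n → R) :
    (List.ofFn fun s : Fin n => f (s, 0) * f (s, 1)).prod
      = (List.ofFn fun t : Fin (n * 2) => f (finProdFinEquiv.symm t)).prod := by
  rw [List.ofFn_mul, List.prod_flatten, List.map_ofFn]
  congr 2
  ext s
  simp only [Function.comp, List.ofFn_succ, List.ofFn_zero, List.prod_cons, List.prod_nil, mul_one]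
  congr 2 <;> rw [eq_comm, Equiv.symm_apply_eq] <;> ext <;> simp [finProdFinEquiv] <;> ring

theorem topAlt_apply (w : Idx n → Idx n → ℂ) :
    topAlt w = topCoeff
      ((List.ofFn fun s : Fin n => wedgeVec (w (s, 0)) * wedgeVec (w (s, 1))).prod vac) := by
  rw [list_ofFn_prod_pairs (fun p => wedgeVec (w p))]
  simp only [topAlt, AlternatingMap.domDomCongr_apply, LinearMap.compAlternatingMap_apply,
    ExteriorAlgebra.ιMulti_apply, LinearMap.comp_apply, AlgHom.toLinearMap_apply, map_list_prod,
    List.map_ofFn, Function.comp_def, ExteriorAlgebra.lift_ι_apply]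
  rfl

theorem topAlt_basis : topAlt (fun k : Idx n => Pi.single k 1) = 1 := by
  rw [topAlt_apply, list_ofFn_prod_pairs (fun p => wedgeVec (Pi.single p 1))]
  simp only [wedgeVec_single]
  have h := wedgeLeft_list_prod_vac (n := n) (List.ofFn fun t : Fin (n * 2) => finProdFinEquiv.symm t)
    (by
      rw [List.pairwise_ofFn]
      intro i j hij
      have h : ∀ t : Fin (n * 2), pos (finProdFinEquiv.symm t) = t := by
        intro t
        simp [pos]
        omega
      rw [h, h]
      exact hij)
  rw [List.map_ofFn] at h
  have h2 : (List.ofFn fun t : Fin (n * 2) => finProdFinEquiv.symm t).toFinset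
      = (Finset.univ : Finset (Idx n)) := by
    ext x
    simp only [List.mem_toFinset, List.mem_ofFn, Finset.mem_univ, iff_true]
    exact ⟨finProdFinEquiv x, by simp⟩
  rw [h2] at h
  change topCoeff ((List.ofFn (wedgeLeft ∘ fun t : Fin (n * 2) => finProdFinEquiv.symm t)).prod vac) = 1
  rw [h]
  simp [topCoeff]

/-- Alternating forms of full degree are multiples of the determinant, and `topAlt_basis` fixes the
multiple. The vectors are the columns of the matrix. -/
theorem topAlt_eq_det (w : Idx n → Idx n → ℂ) : topAlt w = (Matrix.of fun i j => w j i).det := by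
  have h := AlternatingMap.eq_smul_basis_det (Pi.basisFun ℂ (Idx n)) (topAlt (n := n))
  have h1 : (topAlt (n := n)) (Pi.basisFun ℂ (Idx n)) = 1 := by
    rw [← topAlt_basis (n := n)]
    congr 1
    ext k
    simp
  rw [h1, one_smul] at h
  rw [h, Module.Basis.det_apply]
  congr 1

/-- Permuting the arguments of an alternating form produces the sign, and a repeated index makes it
vanish. -/
theorem topAlt_eq_deltaSign (i j : Fin n → Idx n) :
    topCoeff ((List.ofFn fun s : Fin n => wedgeLeft (i s) * wedgeLeft (j s)).prod vac)
      = deltaSign i j := by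
  classical
  have h := topAlt_apply (n := n)
    (fun p => Pi.single (if p.2 = 0 then i p.1 else j p.1) (1 : ℂ))
  simp only [wedgeVec_single, if_true, one_ne_zero, if_false] at h
  rw [← h]
  unfold deltaSign
  split_ifs with hb
  · have := (topAlt (n := n)).map_perm (fun k : Idx n => (Pi.single k 1 : Idx n → ℂ))
      (Equiv.ofBijective _ hb)
    rw [topAlt_basis] at this
    refine Eq.trans ?_ (this.trans ?_)
    · rfl
    · rw [Units.smul_def, zsmul_eq_mul, mul_one]
  · rw [← Finite.injective_iff_bijective] at hb
    simp only [Function.Injective, not_forall] at hb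
    obtain ⟨p, q, h1, h2⟩ := hb
    exact (topAlt (n := n)).map_eq_zero_of_eq _ (by simp only [h1]) h2

/-! ### Determinants of quaternionic matrices -/

/-- Complex matrices that consist of `2 × 2` blocks representing quaternions. -/
def IsQuatMatrix {α β : Type*} (M : Matrix (α × Fin 2) (β × Fin 2) ℂ) : Prop :=
  ∀ i j, M (i, 1) (j, 1) = star (M (i, 0) (j, 0)) ∧ M (i, 1) (j, 0) = -star (M (i, 0) (j, 1))

theorem IsQuatMatrix.mul {α β γ : Type*} [Fintype β] {M : Matrix (α × Fin 2) (β × Fin 2) ℂ}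
    {N : Matrix (β × Fin 2) (γ × Fin 2) ℂ} (hM : IsQuatMatrix M) (hN : IsQuatMatrix N) :
    IsQuatMatrix (M * N) := by
  intro i j
  simp only [Matrix.mul_apply, Fintype.sum_prod_type, Fin.sum_univ_two, star_sum, star_add,
    star_mul', ← Finset.sum_neg_distrib]
  refine ⟨Finset.sum_congr rfl fun k _ => ?_, Finset.sum_congr rfl fun k _ => ?_⟩
  · rw [(hM i k).1, (hM i k).2, (hN k j).1, (hN k j).2]
    simp
    ring
  · rw [(hM i k).1, (hM i k).2, (hN k j).1, (hN k j).2]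
    simp only [star_star]
    ring

theorem IsQuatMatrix.sub {α β : Type*} {M N : Matrix (α × Fin 2) (β × Fin 2) ℂ}
    (hM : IsQuatMatrix M) (hN : IsQuatMatrix N) : IsQuatMatrix (M - N) := by
  intro i j
  simp only [Matrix.sub_apply, (hM i j).1, (hM i j).2, (hN i j).1, (hN i j).2, star_sub]
  exact ⟨trivial, by ring⟩

/-- For one quaternion, the adjugate is the conjugate quaternion and the determinant is the squared
norm. -/
theorem IsQuatMatrix.adjugate_unit {M : Matrix (Unit × Fin 2) (Unit × Fin 2) ℂ}
    (hM : IsQuatMatrix M) :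
    ∃ N : Matrix (Unit × Fin 2) (Unit × Fin 2) ℂ, IsQuatMatrix N ∧ M * N = M.det • 1 ∧
      N * M = M.det • 1 ∧
      M.det = (Complex.normSq (M ((), 0) ((), 0)) + Complex.normSq (M ((), 0) ((), 1)) : ℝ) := by
  have hdet : M.det = M ((), 0) ((), 0) * M ((), 1) ((), 1)
      - M ((), 0) ((), 1) * M ((), 1) ((), 0) := by
    rw [← Matrix.det_submatrix_equiv_self (Equiv.uniqueProd (Fin 2) Unit).symm, Matrix.det_fin_two]
    rfl
  refine ⟨M.adjugate, ?_, Matrix.mul_adjugate M, Matrix.adjugate_mul M, ?_⟩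
  · have h : ∀ a b, M.adjugate ((), a) ((), b)
        = (M.submatrix (Equiv.uniqueProd (Fin 2) Unit).symm
            (Equiv.uniqueProd (Fin 2) Unit).symm).adjugate a b := by
      intro a b
      rw [Matrix.adjugate_submatrix_equiv_self]
      rfl
    rintro ⟨⟩ ⟨⟩
    simp only [h, Matrix.adjugate_fin_two]
    simp [(hM () ()).1, (hM () ()).2]
  · rw [hdet, (hM () ()).1, (hM () ()).2]
    push_cast
    rw [Complex.normSq_eq_conj_mul_self, Complex.normSq_eq_conj_mul_self]
    simp only [Complex.star_def]
    ring

-- Induction by Schur complements: the pivot is a single quaternion, its determinant is a squared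
-- norm, and the complement is again quaternionic. When the pivot may vanish, a small real multiple
-- of the identity is added and removed in the limit.
open ComplexOrder in
theorem IsQuatMatrix.det_nonneg (n : ℕ) (M : Matrix (Fin n × Fin 2) (Fin n × Fin 2) ℂ)
    (hM : IsQuatMatrix M) : 0 ≤ M.det := by
  induction n with
  | zero => simp
  | succ n ih =>
    let e : (Unit × Fin 2) ⊕ (Fin n × Fin 2) ≃ Fin (n + 1) × Fin 2 :=
      (Equiv.sumProdDistrib Unit (Fin n) (Fin 2)).symm.trans
        (Equiv.prodCongr ((Equiv.sumComm _ _).trans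
          ((Equiv.optionEquivSumPUnit.{0} (Fin n)).symm.trans (finSuccEquiv n).symm)) (Equiv.refl _))
    have e1 : ∀ b, e (Sum.inl ((), b)) = (0, b) := fun b => by simp [e]
    have e2 : ∀ i b, e (Sum.inr (i, b)) = (i.succ, b) := fun i b => by simp [e]
    -- A nonzero entry at `(0, 0)` already makes the whole pivot quaternion invertible.
    have key : ∀ N : Matrix (Fin (n + 1) × Fin 2) (Fin (n + 1) × Fin 2) ℂ, IsQuatMatrix N →
        N (0, 0) (0, 0) ≠ 0 → 0 ≤ N.det := by
      intro N hN h0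
      rw [← Matrix.det_submatrix_equiv_self e]
      set N' := N.submatrix e e with hN'
      rw [← Matrix.fromBlocks_toBlocks N']
      have q11 : IsQuatMatrix N'.toBlocks₁₁ := fun i j => by
        simpa [Matrix.toBlocks₁₁, hN', e1] using hN 0 0
      have q12 : IsQuatMatrix N'.toBlocks₁₂ := fun i j => by
        simpa [Matrix.toBlocks₁₂, hN', e1, e2] using hN 0 j.succ
      have q21 : IsQuatMatrix N'.toBlocks₂₁ := fun i j => by
        simpa [Matrix.toBlocks₂₁, hN', e1, e2] using hN i.succ 0
      have q22 : IsQuatMatrix N'.toBlocks₂₂ := fun i j => by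
        simpa [Matrix.toBlocks₂₂, hN', e1, e2] using hN i.succ j.succ
      obtain ⟨P, hP, hP1, hP2, hdet⟩ := q11.adjugate_unit
      have h00 : N'.toBlocks₁₁ ((), 0) ((), 0) = N (0, 0) (0, 0) := by
        simp [Matrix.toBlocks₁₁, hN', e1]
      have hpos : 0 < (Complex.normSq (N'.toBlocks₁₁ ((), 0) ((), 0))
          + Complex.normSq (N'.toBlocks₁₁ ((), 0) ((), 1)) : ℝ) := by
        have : 0 < Complex.normSq (N'.toBlocks₁₁ ((), 0) ((), 0)) := by
          rw [h00]
          exact Complex.normSq_pos.2 h0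
        have := Complex.normSq_nonneg (N'.toBlocks₁₁ ((), 0) ((), 1))
        positivity
      set d : ℝ := (Complex.normSq (N'.toBlocks₁₁ ((), 0) ((), 0))
          + Complex.normSq (N'.toBlocks₁₁ ((), 0) ((), 1)) : ℝ) with hd
      have hd0 : (d : ℂ) ≠ 0 := by exact_mod_cast hpos.ne'
      let _ : Invertible N'.toBlocks₁₁ :=
        ⟨(d : ℂ)⁻¹ • P, by rw [Matrix.smul_mul, hP2, hdet, smul_smul, inv_mul_cancel₀ hd0, one_smul],
          by rw [Matrix.mul_smul, hP1, hdet, smul_smul, inv_mul_cancel₀ hd0, one_smul]⟩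
      rw [Matrix.det_fromBlocks₁₁, hdet]
      refine mul_nonneg (by exact_mod_cast hpos.le) (ih _ ?_)
      refine q22.sub ((q21.mul ?_).mul q12)
      intro i j
      change (((d : ℂ)⁻¹ • P) _ _ = star (((d : ℂ)⁻¹ • P) _ _)) ∧
        (((d : ℂ)⁻¹ • P) _ _ = -star (((d : ℂ)⁻¹ • P) _ _))
      simp only [Matrix.smul_apply, (hP i j).1, (hP i j).2, smul_eq_mul, star_mul', Complex.star_def,
        map_inv₀, Complex.conj_ofReal]
      exact ⟨trivial, by ring⟩
    have hcont : Continuous fun t : ℝ => (M + (t : ℂ) • 1).det := by fun_prop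
    have hlim : Filter.Tendsto (fun t : ℝ => (M + (t : ℂ) • 1).det) (nhdsWithin 0 {0}ᶜ)
        (nhds M.det) := by
      have := (hcont.tendsto 0).mono_left (nhdsWithin_le_nhds (s := {0}ᶜ))
      simpa using this
    refine ge_of_tendsto hlim ?_
    have hev : ∀ᶠ t : ℝ in nhdsWithin 0 {0}ᶜ, M (0, 0) (0, 0) + (t : ℂ) ≠ 0 := by
      by_cases h0 : M (0, 0) (0, 0) = 0
      · filter_upwards [self_mem_nhdsWithin] with t ht
        rw [h0, zero_add]
        exact_mod_cast ht
      · have hc : Continuous fun t : ℝ => M (0, 0) (0, 0) + (t : ℂ) := by fun_prop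
        exact (hc.continuousAt.eventually_ne (by simpa using h0)).filter_mono nhdsWithin_le_nhds
    filter_upwards [hev] with t ht
    refine key _ ?_ (by simpa using ht)
    intro i j
    by_cases hij : i = j
    · subst hij
      simp [(hM i i).1, (hM i i).2]
    · simp [(hM i j).1, (hM i j).2, hij]

/-! ### Simple two-forms -/

theorem blockEntry_eq_sum (j : Idx n) (α : Fin 2) (c : Fin n × Fin 4 → ℂ) :
    blockEntry j α c = ∑ m, c m * blockEntry j α (Pi.single m 1) := by
  obtain ⟨l, b⟩ := j
  have h : ∀ (p : Fin n × Fin 4), ∑ m, c m * (Pi.single m (1 : ℂ) : Fin n × Fin 4 → ℂ) p = c p := by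
    intro p
    simp [Pi.single_apply]
  fin_cases b <;> fin_cases α <;>
    simp only [blockEntry, mul_add, mul_sub, Finset.sum_add_distrib, Finset.sum_sub_distrib,
      mul_neg, Finset.sum_neg_distrib, mul_left_comm _ Complex.I, ← Finset.mul_sum, h]

/-- The `α`-th column of the `2n × 2` matrix associated with a real vector. -/
def symb (α : Fin 2) : (Fin n × Fin 4 → ℂ) →ₗ[ℂ] (Idx n → ℂ) where
  toFun c j := blockEntry j α c
  map_add' c d := by
    ext ⟨l, b⟩
    fin_cases b <;> fin_cases α <;> simp [blockEntry] <;> ring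
  map_smul' r c := by
    ext ⟨l, b⟩
    fin_cases b <;> fin_cases α <;> simp [blockEntry] <;> ring

theorem symb_apply (α : Fin 2) (c : Fin n × Fin 4 → ℂ) (j : Idx n) :
    symb α c j = blockEntry j α c := rfl

/-- Exterior multiplication by the symbol of `d_α`. -/
def symbOp (α : Fin 2) : (Fin n × Fin 4 → ℂ) →ₗ[ℂ] FormOp n := wedgeVec ∘ₗ symb α

/-- Exterior multiplication by the symbol of `d_α` in the direction of a coordinate vector. -/
def coordOp (α : Fin 2) (m : Fin n × Fin 4) : FormOp n := symbOp α (Pi.single m 1)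

theorem symbOp_anticomm (α β : Fin 2) (c d : Fin n × Fin 4 → ℂ) :
    symbOp α c * symbOp β d = -(symbOp β d * symbOp α c) := wedgeVec_anticomm _ _

theorem coordOp_anticomm (α β : Fin 2) (l m : Fin n × Fin 4) :
    coordOp α l * coordOp β m = -(coordOp β m * coordOp α l) := wedgeVec_anticomm _ _

theorem symbOp_eq_sum (α : Fin 2) (c : Fin n × Fin 4 → ℂ) :
    symbOp α c = ∑ m, c m • coordOp α m := by
  conv_lhs => rw [pi_eq_sum_univ' c]
  rw [map_sum]
  refine Finset.sum_congr rfl fun m _ => ?_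
  rw [map_smul]
  congr 2

/-- The simple two-form `d_0 ℓ ∧ d_1 ℓ` of a linear function `ℓ`. -/
def simpleTwo (x : Fin n × Fin 4 → ℝ) : FormOp n :=
  symbOp 0 (fun m => (x m : ℂ)) * symbOp 1 (fun m => (x m : ℂ))

theorem commute_mul_of_anticomm {R : Type*} [Ring R] {a b c d : R} (hac : a * c = -(c * a))
    (had : a * d = -(d * a)) (hbc : b * c = -(c * b)) (hbd : b * d = -(d * b)) :
    Commute (a * b) (c * d) := by
  unfold Commute SemiconjBy
  rw [mul_assoc, ← mul_assoc b, hbc, neg_mul, mul_assoc c, hbd, mul_neg, mul_neg, mul_neg, neg_neg,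
    ← mul_assoc, hac, neg_mul, mul_assoc, ← mul_assoc a, had]
  simp only [neg_mul, mul_neg, neg_neg, mul_assoc]

theorem symbOp_comm_mul (α β γ δ : Fin 2) (c d c' d' : Fin n × Fin 4 → ℂ) :
    Commute (symbOp α c * symbOp β d) (symbOp γ c' * symbOp δ d') :=
  commute_mul_of_anticomm (symbOp_anticomm _ _ _ _) (symbOp_anticomm _ _ _ _)
    (symbOp_anticomm _ _ _ _) (symbOp_anticomm _ _ _ _)

-- The columns are `symb 0` and `symb 1` of the real vectors `x s`. For real vectors these two
-- columns form `2 × 2` quaternion blocks, so the top coefficient is the determinant of a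
-- quaternionic matrix.
open ComplexOrder in
theorem topCoeff_ofFn_simpleTwo_nonneg (x : Fin n → Fin n × Fin 4 → ℝ) :
    0 ≤ topCoeff ((List.ofFn fun s => simpleTwo (x s)).prod vac) := by
  have h := topAlt_apply (n := n) (fun p => symb p.2 (fun m => (x p.1 m : ℂ)))
  have h2 : (List.ofFn fun s => simpleTwo (x s)) = List.ofFn fun s : Fin n =>
      wedgeVec (symb 0 (fun m => (x s m : ℂ))) * wedgeVec (symb 1 (fun m => (x s m : ℂ))) := rfl
  rw [h2, ← h, topAlt_eq_det]
  apply IsQuatMatrix.det_nonneg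
  intro i j
  simp [symb_apply, blockEntry]
  constructor <;> ring

/-- The cone of positive two-forms. -/
def posCone (n : ℕ) : AddSubmonoid (FormOp n) :=
  AddSubmonoid.closure (Set.range (simpleTwo : (Fin n × Fin 4 → ℝ) → FormOp n))

theorem simpleTwo_mem (x : Fin n × Fin 4 → ℝ) : simpleTwo x ∈ posCone n :=
  AddSubmonoid.subset_closure ⟨x, rfl⟩

theorem simpleTwo_smul (c : ℝ) (x : Fin n × Fin 4 → ℝ) :
    simpleTwo (c • x) = ((c ^ 2 : ℝ) : ℂ) • simpleTwo x := by
  have : (fun m => ((c • x) m : ℂ)) = (c : ℂ) • (fun m => (x m : ℂ)) := by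
    ext m
    simp
  simp only [simpleTwo, this, map_smul, smul_mul_smul_comm]
  push_cast
  rw [sq]

theorem posCone_smul {c : ℝ} (hc : 0 ≤ c) {N : FormOp n} (hN : N ∈ posCone n) :
    (c : ℂ) • N ∈ posCone n := by
  induction hN using AddSubmonoid.closure_induction with
  | mem N h =>
    obtain ⟨x, rfl⟩ := h
    rw [← Real.sq_sqrt hc, ← simpleTwo_smul]
    exact simpleTwo_mem _
  | zero => simp
  | add a b _ _ ha hb =>
    rw [smul_add]
    exact add_mem ha hb

open ComplexOrder in
/-- Products of positive two-forms are nonnegative multiples of the volume form. -/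
theorem topCoeff_pow_mul_nonneg {N : FormOp n} (hN : N ∈ posCone n) (k : ℕ)
    (L : List (Fin n × Fin 4 → ℝ)) (hL : k + L.length = n) :
    0 ≤ topCoeff ((N ^ k * (L.map simpleTwo).prod) vac) := by
  induction k generalizing L with
  | zero =>
    rw [zero_add] at hL
    rw [pow_zero, one_mul]
    convert topCoeff_ofFn_simpleTwo_nonneg (fun s : Fin n => L.get (s.cast hL.symm)) using 4
    refine List.ext_getElem (by simpa using hL) fun i h1 h2 => ?_
    simp
  | succ k ih =>
    rw [pow_succ]
    -- The expression is additive in a single factor, so one factor `N` at a time may be taken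
    -- simple and moved into the list `L`.
    have key : ∀ N' ∈ posCone n,
        0 ≤ topCoeff ((N ^ k * N' * (L.map simpleTwo).prod) vac) := by
      intro N' hN'
      induction hN' using AddSubmonoid.closure_induction with
      | mem N' h =>
        obtain ⟨x, rfl⟩ := h
        have := ih (x :: L) (by simp; omega)
        rwa [List.map_cons, List.prod_cons, ← mul_assoc] at this
      | zero => simp
      | add a b _ _ ha hb =>
        rw [mul_add, add_mul, LinearMap.add_apply, map_add]
        exact add_nonneg ha hb
    exact key N hN

/-! ### Degree and span -/

/-- Coefficient vectors of homogeneous elements of degree `p`. -/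
def degreePart (n p : ℕ) : Submodule ℂ (FormVec n) where
  carrier := {a | ∀ J, J.card ≠ p → a J = 0}
  add_mem' ha hb J hJ := by simp [ha J hJ, hb J hJ]
  zero_mem' J _ := rfl
  smul_mem' c a ha J hJ := by simp [ha J hJ]

theorem vac_mem_degreePart : (vac : FormVec n) ∈ degreePart n 0 := by
  intro J hJ
  rw [vac, Pi.single_eq_of_ne]
  rintro rfl
  simp at hJ

theorem wedgeLeft_mem_degreePart (k : Idx n) {p : ℕ} {a : FormVec n} (ha : a ∈ degreePart n p) :
    wedgeLeft k a ∈ degreePart n (p + 1) := by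
  intro J hJ
  rw [wedgeLeft_apply]
  split_ifs with h
  · rw [ha, mul_zero]
    intro h2
    have := Finset.card_erase_add_one h
    omega
  · rfl

theorem symbOp_mem_degreePart (α : Fin 2) (c : Fin n × Fin 4 → ℂ) {p : ℕ} {a : FormVec n}
    (ha : a ∈ degreePart n p) : symbOp α c a ∈ degreePart n (p + 1) := by
  simp only [symbOp, LinearMap.comp_apply, wedgeVec_apply, LinearMap.sum_apply,
    LinearMap.smul_apply]
  exact Submodule.sum_mem _ fun k _ => Submodule.smul_mem _ _ (wedgeLeft_mem_degreePart k ha)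

theorem posCone_mem_degreePart {N : FormOp n} (hN : N ∈ posCone n) {p : ℕ} {a : FormVec n}
    (ha : a ∈ degreePart n p) : N a ∈ degreePart n (p + 2) := by
  induction hN using AddSubmonoid.closure_induction with
  | mem N h =>
    obtain ⟨x, rfl⟩ := h
    exact symbOp_mem_degreePart _ _ (symbOp_mem_degreePart _ _ ha)
  | zero => exact Submodule.zero_mem _
  | add a b _ _ ha hb => exact Submodule.add_mem _ ha hb

theorem posCone_pow_mem_degreePart {N : FormOp n} (hN : N ∈ posCone n) (k : ℕ) {p : ℕ}
    {a : FormVec n} (ha : a ∈ degreePart n p) : (N ^ k) a ∈ degreePart n (p + 2 * k) := by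
  induction k with
  | zero => simpa using ha
  | succ k ih =>
    rw [pow_succ', Module.End.mul_apply]
    have := posCone_mem_degreePart hN ih
    rwa [add_assoc] at this

theorem topCoeff_eq_zero {p : ℕ} {a : FormVec n} (ha : a ∈ degreePart n p) (hp : p ≠ 2 * n) :
    topCoeff a = 0 := by
  apply ha
  rw [Finset.card_univ, Fintype.card_prod, Fintype.card_fin, Fintype.card_fin]
  omega

/-- With complex coefficients allowed, the pair of symbols `(symb 0, symb 1)` maps `ℂ⁴ⁿ` onto `ℂ²ⁿ ×
ℂ²ⁿ`, so the two symbols can be prescribed independently. -/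
theorem exists_symbOp_eq (k : Idx n) :
    (∃ c : Fin n × Fin 4 → ℂ, symbOp 0 c = wedgeLeft k ∧ symbOp 1 c = 0) ∧
    ∃ c : Fin n × Fin 4 → ℂ, symbOp 1 c = wedgeLeft k ∧ symbOp 0 c = 0 := by
  have key : ∀ (α : Fin 2) (c : Fin n × Fin 4 → ℂ), symb α c = Pi.single k 1 →
      symbOp α c = wedgeLeft k := by
    intro α c h
    rw [symbOp, LinearMap.comp_apply, h, wedgeVec_single]
  have key0 : ∀ (α : Fin 2) (c : Fin n × Fin 4 → ℂ), symb α c = 0 → symbOp α c = 0 := by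
    intro α c h
    rw [symbOp, LinearMap.comp_apply, h, map_zero]
  obtain ⟨l, b⟩ := k
  have hI : Complex.I * (Complex.I * 2⁻¹) = - 2⁻¹ := by
    rw [← mul_assoc, Complex.I_mul_I]
    ring
  have hI2 : (2⁻¹ + 2⁻¹ : ℂ) = 1 := by norm_num
  fin_cases b
  · refine ⟨⟨Pi.single (l, 0) (1 / 2) - Pi.single (l, 1) (Complex.I * (1 / 2)), key _ _ ?_, key0 _ _ ?_⟩,
      ⟨-Pi.single (l, 2) (1 / 2) + Pi.single (l, 3) (Complex.I * (1 / 2)), key _ _ ?_, key0 _ _ ?_⟩⟩ <;>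
    · ext ⟨l', b⟩
      by_cases h : l' = l <;> fin_cases b <;>
        simp [symb_apply, blockEntry, h, hI, hI2]
  · refine ⟨⟨Pi.single (l, 2) (1 / 2) + Pi.single (l, 3) (Complex.I * (1 / 2)), key _ _ ?_, key0 _ _ ?_⟩,
      ⟨Pi.single (l, 0) (1 / 2) + Pi.single (l, 1) (Complex.I * (1 / 2)), key _ _ ?_, key0 _ _ ?_⟩⟩ <;>
    · ext ⟨l', b⟩
      by_cases h : l' = l <;> fin_cases b <;>
        simp [symb_apply, blockEntry, h, hI, hI2]

/-- Choose `c` with symbols `(ω^k, 0)` and `d` with symbols `(0, ω^l)`. The product is then the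
symmetrization in `c` and `d` of the bilinear form behind `simpleTwo`, and polarization writes
symmetric combinations through its values on the diagonal. -/
theorem wedgeLeft_mul_mem_span (k l : Idx n) :
    wedgeLeft k * wedgeLeft l
      ∈ Submodule.span ℂ (Set.range (simpleTwo : (Fin n × Fin 4 → ℝ) → FormOp n)) := by
  obtain ⟨c, hc0, hc1⟩ := (exists_symbOp_eq k).1
  obtain ⟨d, hd1, hd0⟩ := (exists_symbOp_eq l).2
  have h : wedgeLeft k * wedgeLeft l
      = symbOp 0 c * symbOp 1 d + symbOp 0 d * symbOp 1 c := by
    rw [hc0, hd1, hd0, zero_mul, add_zero]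
  rw [h]
  have h2 : ∀ c d : Fin n × Fin 4 → ℂ, symbOp 0 c * symbOp 1 d
      = ∑ i, ∑ j, (c i * d j) • (coordOp 0 i * coordOp 1 j) := by
    intro c d
    rw [symbOp_eq_sum 0 c, symbOp_eq_sum 1 d]
    simp only [Finset.sum_mul, Finset.mul_sum, smul_mul_smul_comm]
    rw [Finset.sum_comm]
  have h3 : symbOp 0 c * symbOp 1 d + symbOp 0 d * symbOp 1 c
      = ∑ i, ∑ j, (c i * d j) • (coordOp 0 i * coordOp 1 j + coordOp 0 j * coordOp 1 i) := by
    rw [h2, h2, Finset.sum_comm (f := fun i j => (d i * c j) • (coordOp 0 i * coordOp 1 j)),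
      ← Finset.sum_add_distrib]
    refine Finset.sum_congr rfl fun i _ => ?_
    rw [← Finset.sum_add_distrib]
    refine Finset.sum_congr rfl fun j _ => ?_
    rw [smul_add, mul_comm (d j)]
  rw [h3]
  refine Submodule.sum_mem _ fun i _ => Submodule.sum_mem _ fun j _ => Submodule.smul_mem _ _ ?_
  have h4 : ∀ i : Fin n × Fin 4, (fun m => ((Pi.single i (1 : ℝ) : Fin n × Fin 4 → ℝ) m : ℂ))
      = Pi.single i 1 := by
    intro i
    ext m
    by_cases h : m = i <;> simp [h]
  -- Polarization with real vectors, as `simpleTwo` accepts only those.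
  have h5 : coordOp 0 i * coordOp 1 j + coordOp 0 j * coordOp 1 i
      = simpleTwo (Pi.single i 1 + Pi.single j 1) - simpleTwo (Pi.single i 1)
        - simpleTwo (Pi.single j 1) := by
    have : (fun m => ((Pi.single i (1 : ℝ) + Pi.single j 1 : Fin n × Fin 4 → ℝ) m : ℂ))
        = Pi.single i 1 + Pi.single j 1 := by
      rw [← h4 i, ← h4 j]
      ext m
      simp
    simp only [simpleTwo, this, h4, map_add, mul_add, add_mul]
    simp only [coordOp]
    abel
  rw [h5]
  exact Submodule.sub_mem _ (Submodule.sub_mem _ (Submodule.subset_span ⟨_, rfl⟩)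
    (Submodule.subset_span ⟨_, rfl⟩)) (Submodule.subset_span ⟨_, rfl⟩)

/-- Products of simple two-forms, applied to the unit. -/
def simpleProducts (n : ℕ) : Set (FormVec n) :=
  {a | ∃ L : List (Fin n × Fin 4 → ℝ), a = (L.map simpleTwo).prod vac}

theorem wedge_pair_mem_span (k l : Idx n) {a : FormVec n}
    (ha : a ∈ Submodule.span ℂ (simpleProducts n)) :
    wedgeLeft k (wedgeLeft l a) ∈ Submodule.span ℂ (simpleProducts n) := by
  rw [← Module.End.mul_apply]
  have key : ∀ N ∈ Submodule.span ℂ (Set.range (simpleTwo : (Fin n × Fin 4 → ℝ) → FormOp n)),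
      N a ∈ Submodule.span ℂ (simpleProducts n) := by
    intro N hN
    induction hN using Submodule.span_induction with
    | mem N h =>
      obtain ⟨x, rfl⟩ := h
      induction ha using Submodule.span_induction with
      | mem a h =>
        obtain ⟨L, rfl⟩ := h
        exact Submodule.subset_span ⟨x :: L, by simp⟩
      | zero => simp
      | add a b _ _ ha hb =>
        rw [map_add]
        exact Submodule.add_mem _ ha hb
      | smul c a _ ha =>
        rw [map_smul]
        exact Submodule.smul_mem _ _ ha
    | zero => simp
    | add a b _ _ ha hb => exact Submodule.add_mem _ ha hb
    | smul c a _ ha => exact Submodule.smul_mem _ _ ha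
  exact key _ (wedgeLeft_mul_mem_span k l)

/-- Every coefficient vector of even degree is a combination of products of simple two-forms. -/
theorem single_mem_span (I : Finset (Idx n)) (hI : Even I.card) :
    (Pi.single I 1 : FormVec n) ∈ Submodule.span ℂ (simpleProducts n) := by
  have key : ∀ (L : List (Idx n)), Even L.length →
      (L.map wedgeLeft).prod vac ∈ Submodule.span ℂ (simpleProducts n) := by
    intro L hL
    obtain ⟨r, hr⟩ := hL
    induction r generalizing L with
    | zero =>
      have : L = [] := by simpa using hr
      subst this
      exact Submodule.subset_span ⟨[], by simp⟩
    | succ r ih =>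
      match L, hr with
      | [], hr => simp at hr
      | [_], hr => simp at hr; omega
      | k :: l :: L, hr =>
        have := wedge_pair_mem_span k l (ih L (by simp at hr; omega))
        simpa using this
  -- Listing `I` in increasing order makes the product of the `wedgeLeft` exactly the basis vector,
  -- with sign +1.
  let L : List (Idx n) := I.toList.mergeSort (fun a b => decide (pos a ≤ pos b))
  have hperm : L.Perm I.toList := List.mergeSort_perm _ _
  have hnd : L.Nodup := hperm.nodup_iff.2 I.nodup_toList
  have hsort : L.Pairwise (fun a b => pos a ≤ pos b) := by
    have := List.pairwise_mergeSort (le := fun a b : Idx n => decide (pos a ≤ pos b))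
      (by intro a b c; simpa using le_trans) (by intro a b; simpa using le_total _ _) I.toList
    simpa using this
  have hlt : L.Pairwise (fun a b => pos a < pos b) := by
    refine (hsort.and hnd).imp ?_
    rintro a b ⟨h1, h2⟩
    exact lt_of_le_of_ne h1 fun h => h2 (pos_injective h)
  have := wedgeLeft_list_prod_vac L hlt
  have hL : L.toFinset = I := by
    rw [List.toFinset_eq_of_perm _ _ hperm, Finset.toList_toFinset]
  rw [hL] at this
  rw [← this]
  apply key
  rw [hperm.length_eq, Finset.length_toList]
  exact hI

/-! ### Partial derivatives of vector-valued functions -/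

section PartialDerivatives

variable {V : Type*} [NormedAddCommGroup V] [NormedSpace ℝ V]

/-- The partial derivative `∂_{x_m}` of a vector-valued function. -/
def pd (m : Fin n × Fin 4) (f : HSpace n → V) (q : HSpace n) : V :=
  fderiv ℝ f q (EuclideanSpace.single m (1 : ℝ))

theorem ContDiff.pd {f : HSpace n → V} (hf : ContDiff ℝ ∞ f) (m : Fin n × Fin 4) :
    ContDiff ℝ ∞ (pd m f) :=
  (hf.fderiv_right (m := ∞) (by simp)).clm_apply contDiff_const

theorem pd_clm {V' : Type*} [NormedAddCommGroup V'] [NormedSpace ℝ V'] (L : V →L[ℝ] V')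
    {f : HSpace n → V} {q : HSpace n} (hf : DifferentiableAt ℝ f q) (m : Fin n × Fin 4) :
    pd m (fun p => L (f p)) q = L (pd m f q) := by
  unfold pd
  have := (L.hasFDerivAt.comp q hf.hasFDerivAt).fderiv
  rw [show (fun p => L (f p)) = L ∘ f from rfl, this]
  rfl

theorem pd_sum {ι : Type*} (s : Finset ι) {f : ι → HSpace n → V} {q : HSpace n}
    (hf : ∀ i ∈ s, DifferentiableAt ℝ (f i) q) (m : Fin n × Fin 4) :
    pd m (fun p => ∑ i ∈ s, f i p) q = ∑ i ∈ s, pd m (f i) q := by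
  unfold pd
  rw [fderiv_fun_sum hf, sum_apply]

theorem pd_comm {f : HSpace n → V} (hf : ContDiff ℝ ∞ f) (l m : Fin n × Fin 4) (q : HSpace n) :
    pd l (pd m f) q = pd m (pd l f) q := by
  have h : ∀ l m : Fin n × Fin 4, pd l (pd m f) q
      = fderiv ℝ (fderiv ℝ f) q (EuclideanSpace.single l 1) (EuclideanSpace.single m 1) := by
    intro l m
    have hd : DifferentiableAt ℝ (fderiv ℝ f) q :=
      ((hf.fderiv_right (m := ∞) (by simp)).differentiable (by simp)).differentiableAt
    unfold pd
    rw [fderiv_clm_apply hd (differentiableAt_const _)]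
    simp
  rw [h, h]
  exact (hf.contDiffAt.isSymmSndFDerivAt (by simp; exact WithTop.coe_le_coe.2 (le_top : (2 : ℕ∞) ≤ ⊤))).eq _ _

theorem pd_ofReal {f : HSpace n → ℝ} {q : HSpace n} (hf : DifferentiableAt ℝ f q)
    (m : Fin n × Fin 4) : pd m (fun p => (f p : ℂ)) q = ((pd m f q : ℝ) : ℂ) :=
  pd_clm Complex.ofRealCLM hf m

theorem pd_ofReal_smul {f : HSpace n → ℝ}
    {g : Form n} {q : HSpace n} (hf : DifferentiableAt ℝ f q) (hg : DifferentiableAt ℝ g q)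
    (m : Fin n × Fin 4) :
    pd m (fun p => (f p : ℂ) • g p) q = ((pd m f q : ℝ) : ℂ) • g q + (f q : ℂ) • pd m g q := by
  simp only [Complex.coe_smul]
  unfold pd
  rw [fderiv_fun_smul hf hg, add_comm]
  rfl

theorem HasCompactSupport.pd {f : HSpace n → V} (hf : HasCompactSupport f) (m : Fin n × Fin 4) :
    HasCompactSupport (pd m f) :=
  (hf.fderiv (𝕜 := ℝ)).comp_left (g := fun L : HSpace n →L[ℝ] V => L (EuclideanSpace.single m 1)) rfl

theorem integral_pd_eq_zero {f : HSpace n → ℂ} (hf : ContDiff ℝ ∞ f) (hc : HasCompactSupport f)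
    (m : Fin n × Fin 4) : ∫ q, pd m f q = 0 := by
  have h1 : Integrable (pd m f) :=
    (ContDiff.pd hf m).continuous.integrable_of_hasCompactSupport (HasCompactSupport.pd hc m)
  have h2 : Integrable f := hf.continuous.integrable_of_hasCompactSupport hc
  unfold pd at h1 ⊢
  -- Integration by parts against the constant function 1.
  have := integral_mul_fderiv_eq_neg_fderiv_mul_of_integrable (μ := (volume : Measure (HSpace n)))
    (f := fun _ => (1 : ℂ)) (g := f) (v := EuclideanSpace.single m 1) (by simp)
    (by simpa using h1) (by simpa using h2) (fun _ _ => differentiableAt_const _)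
    (fun _ _ => (hf.differentiable (by simp)).differentiableAt)
  simpa using this

end PartialDerivatives

/-! ### The operators `d_α` in coordinates -/

/-- A complex-linear operator on coefficient vectors as a real continuous linear map. -/
def FormOp.toCLM (N : FormOp n) : FormVec n →L[ℝ] FormVec n :=
  LinearMap.toContinuousLinearMap (N.restrictScalars ℝ)

theorem FormOp.contDiff (N : FormOp n) {η : Form n} (hη : ContDiff ℝ ∞ η) :
    ContDiff ℝ ∞ (fun q => N (η q)) :=
  (FormOp.toCLM N).contDiff.comp hη

theorem FormOp.continuous (N : FormOp n) {η : Form n} (hη : Continuous η) :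
    Continuous (fun q => N (η q)) :=
  (FormOp.toCLM N).continuous.comp hη

theorem FormOp.pd_apply (N : FormOp n) {η : Form n} {q : HSpace n} (hη : DifferentiableAt ℝ η q)
    (m : Fin n × Fin 4) : pd m (fun p => N (η p)) q = N (pd m η q) :=
  pd_clm (FormOp.toCLM N) hη m

theorem nabla_eq_sum (j : Idx n) (α : Fin 2) (f : HSpace n → ℂ) (q : HSpace n) :
    nabla j α f q = ∑ m, pd m f q * blockEntry j α (Pi.single m 1) :=
  blockEntry_eq_sum _ _ _

theorem coordOp_eq_sum (α : Fin 2) (m : Fin n × Fin 4) :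
    coordOp α m = ∑ k : Idx n, blockEntry k α (Pi.single m 1) • wedgeLeft k := rfl

/-- This turns the coefficientwise definition into a first-order operator with constant coefficients
in the anticommuting `coordOp`, so that identities between forms become algebra. -/
theorem dOp_eq_sum (α : Fin 2) {η : Form n} {q : HSpace n} (hη : DifferentiableAt ℝ η q) :
    dOp α η q = ∑ m, coordOp α m (pd m η q) := by
  ext J
  have h : ∀ I m, pd m (fun p => η p I) q = pd m η q I := fun I m =>
    pd_clm (ContinuousLinearMap.proj (R := ℝ) (φ := fun _ : Finset (Idx n) => ℂ) I) hη m
  simp only [dOp, nabla_eq_sum, h, coordOp_eq_sum, LinearMap.sum_apply, LinearMap.smul_apply,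
    Finset.sum_apply, Pi.smul_apply, wedgeLeft_apply, smul_eq_mul, mul_ite, mul_zero]
  rw [Finset.sum_comm]
  simp only [Finset.sum_ite_irrel, Finset.sum_const_zero]
  rw [← Finset.sum_filter, Finset.filter_mem_eq_inter, Finset.univ_inter]
  refine Finset.sum_congr rfl fun k _ => ?_
  rw [Finset.mul_sum]
  refine Finset.sum_congr rfl fun m _ => ?_
  ring

theorem dOp_fun_eq (α : Fin 2) {η : Form n} (hη : Differentiable ℝ η) :
    dOp α η = fun q => ∑ m, coordOp α m (pd m η q) :=
  funext fun q => dOp_eq_sum α (hη q)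

theorem contDiff_dOp (α : Fin 2) {η : Form n} (hη : ContDiff ℝ ∞ η) : ContDiff ℝ ∞ (dOp α η) := by
  rw [dOp_fun_eq α (hη.differentiable (by simp))]
  exact ContDiff.sum fun m _ => FormOp.contDiff _ (ContDiff.pd hη m)

theorem tsupport_dOp_subset (α : Fin 2) (η : Form n) : tsupport (dOp α η) ⊆ tsupport η := by
  refine closure_minimal ?_ (isClosed_tsupport η)
  intro q hq
  by_contra h
  apply hq
  have h0 : η =ᶠ[nhds q] 0 := notMem_tsupport_iff_eventuallyEq.1 h
  rw [dOp_eq_sum α ((differentiableAt_const (0 : FormVec n)).congr_of_eventuallyEq h0)]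
  have : ∀ m, pd m η q = 0 := by
    intro m
    unfold pd
    rw [h0.fderiv_eq]
    simp
  simp [this]

theorem HasCompactSupport.dOp {η : Form n} (hη : HasCompactSupport η) (α : Fin 2) :
    HasCompactSupport (dOp α η) :=
  hη.of_isClosed_subset (isClosed_tsupport _) (tsupport_dOp_subset α η)

/-- Stokes' theorem: the integrand is a sum of partial derivatives of compactly supported functions.
-/
theorem integral_topCoeff_dOp (α : Fin 2) {η : Form n} (hη : ContDiff ℝ ∞ η)
    (hc : HasCompactSupport η) : ∫ q, topCoeff (dOp α η q) = 0 := by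
  simp only [dOp_eq_sum α ((hη.differentiable (by simp)) _), map_sum]
  let L : Fin n × Fin 4 → FormVec n →L[ℝ] ℂ := fun m =>
    LinearMap.toContinuousLinearMap ((topCoeff ∘ₗ coordOp α m).restrictScalars ℝ)
  have h1 : ∀ m q, topCoeff (coordOp α m (pd m η q)) = pd m (fun p => L m (η p)) q := fun m q =>
    (pd_clm (L m) (hη.differentiable (by simp)).differentiableAt m).symm
  have h2 : ∀ m, ContDiff ℝ ∞ (fun p => L m (η p)) := fun m => (L m).contDiff.comp hη
  have h3 : ∀ m, HasCompactSupport (fun p => L m (η p)) := fun m => hc.comp_left (map_zero _)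
  simp only [h1]
  rw [integral_finsetSum]
  · exact Finset.sum_eq_zero fun m _ => integral_pd_eq_zero (h2 m) (h3 m) m
  · intro m _
    exact (ContDiff.pd (h2 m) m).continuous.integrable_of_hasCompactSupport
      (HasCompactSupport.pd (h3 m) m)

theorem topCoeff_continuous {η : Form n} (hη : Continuous η) :
    Continuous (fun q => topCoeff (η q)) :=
  (LinearMap.toContinuousLinearMap (topCoeff (n := n))).continuous.comp hη

theorem dOp_ofReal_smul (α : Fin 2) {f : HSpace n → ℝ} {η : Form n} (hf : Differentiable ℝ f)
    (hη : Differentiable ℝ η) (q : HSpace n) :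
    dOp α (fun p => (f p : ℂ) • η p) q
      = ∑ m, ((pd m f q : ℝ) : ℂ) • coordOp α m (η q) + (f q : ℂ) • dOp α η q := by
  rw [dOp_eq_sum α, dOp_eq_sum α (hη q), Finset.smul_sum, ← Finset.sum_add_distrib]
  · refine Finset.sum_congr rfl fun m _ => ?_
    rw [pd_ofReal_smul (hf q) (hη q), map_add, map_smul, map_smul]
  · simp only [Complex.coe_smul]
    exact (hf q).smul (hη q)

/-! ### The Hessian two-form -/

/-- The two-form associated with a real bilinear form. -/
def hessForm (Q : Matrix (Fin n × Fin 4) (Fin n × Fin 4) ℝ) : FormOp n :=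
  ∑ m, ∑ m', (Q m m' : ℂ) • (coordOp 0 m * coordOp 1 m')

/-- The matrix of second partial derivatives. -/
def hessian (u : HSpace n → ℝ) (q : HSpace n) : Matrix (Fin n × Fin 4) (Fin n × Fin 4) ℝ :=
  Matrix.of fun m m' => pd m (pd m' u) q

/-- Exterior multiplication by `△u`. -/
def hessOp (u : HSpace n → ℝ) (q : HSpace n) : FormOp n := hessForm (hessian u q)

theorem hessOp_apply (u : HSpace n → ℝ) (q : HSpace n) (a : FormVec n) :
    hessOp u q a
      = ∑ m, ∑ m', ((pd m (pd m' u) q : ℝ) : ℂ) • (coordOp 0 m * coordOp 1 m') a := by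
  simp [hessOp, hessForm, hessian, LinearMap.sum_apply]

theorem contDiff_hessOp {u : HSpace n → ℝ} (hu : ContDiff ℝ ∞ u) {η : Form n}
    (hη : ContDiff ℝ ∞ η) : ContDiff ℝ ∞ (fun q => hessOp u q (η q)) := by
  simp only [hessOp_apply, Complex.coe_smul]
  exact ContDiff.sum fun m _ => ContDiff.sum fun m' _ =>
    (ContDiff.pd (ContDiff.pd hu m') m).smul (FormOp.contDiff _ hη)

theorem continuous_hessOp {u : HSpace n → ℝ} (hu : ContDiff ℝ ∞ u) {η : Form n}
    (hη : Continuous η) : Continuous (fun q => hessOp u q (η q)) := by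
  simp only [hessOp_apply, Complex.coe_smul]
  exact continuous_finsetSum _ fun m _ => continuous_finsetSum _ fun m' _ =>
    (ContDiff.pd (ContDiff.pd hu m') m).continuous.smul (FormOp.continuous _ hη)

theorem contDiff_hessOp_pow {u : HSpace n → ℝ} (hu : ContDiff ℝ ∞ u) (k : ℕ) {η : Form n}
    (hη : ContDiff ℝ ∞ η) : ContDiff ℝ ∞ (fun q => (hessOp u q ^ k) (η q)) := by
  induction k with
  | zero => simpa using hη
  | succ k ih =>
    simp only [pow_succ', Module.End.mul_apply]
    exact contDiff_hessOp hu ih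

theorem continuous_hessOp_pow {u : HSpace n → ℝ} (hu : ContDiff ℝ ∞ u) (k : ℕ) {η : Form n}
    (hη : Continuous η) : Continuous (fun q => (hessOp u q ^ k) (η q)) := by
  induction k with
  | zero => simpa using hη
  | succ k ih =>
    simp only [pow_succ', Module.End.mul_apply]
    exact continuous_hessOp hu ih

/-- Symmetric coefficients cancel against anticommuting operators; this is the algebra behind `d_α
d_α = 0`. -/
theorem sum_smul_coordOp_eq_zero (α β : Fin 2) (c : Fin n × Fin 4 → Fin n × Fin 4 → ℂ)
    (hc : ∀ l m, c l m = c m l) (hαβ : α = β) (a : FormVec n) :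
    ∑ l, ∑ m, c l m • (coordOp α l * coordOp β m) a = 0 := by
  subst hαβ
  have h : ∑ l, ∑ m, c l m • (coordOp α l * coordOp α m) a
      = -∑ l, ∑ m, c l m • (coordOp α l * coordOp α m) a := by
    conv_lhs => rw [Finset.sum_comm]
    rw [← Finset.sum_neg_distrib]
    refine Finset.sum_congr rfl fun l _ => ?_
    rw [← Finset.sum_neg_distrib]
    refine Finset.sum_congr rfl fun m _ => ?_
    rw [coordOp_anticomm α α m l, LinearMap.neg_apply, smul_neg, hc]
  exact self_eq_neg.1 h

theorem coordOp_mul_comm (α : Fin 2) (l m m' : Fin n × Fin 4) :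
    coordOp α l * (coordOp 0 m * coordOp 1 m') = (coordOp 0 m * coordOp 1 m') * coordOp α l := by
  have key : ∀ {R : Type} [Ring R] (a b c : R), a * b = -(b * a) → a * c = -(c * a) →
      a * (b * c) = (b * c) * a := by
    intro R _ a b c h1 h2
    rw [← mul_assoc, h1, neg_mul, mul_assoc, h2, mul_neg, neg_neg, mul_assoc]
  exact key _ _ _ (coordOp_anticomm _ _ _ _) (coordOp_anticomm _ _ _ _)

/-- The form △u is `d_α`-closed because its derivatives are third partials, symmetric in the
indices, and multiplication by a two-form commutes with the odd operators `coordOp`. No sign arises.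
-/
theorem dOp_hessOp (α : Fin 2) {u : HSpace n → ℝ} (hu : ContDiff ℝ ∞ u) {η : Form n}
    (hη : ContDiff ℝ ∞ η) (q : HSpace n) :
    dOp α (fun p => hessOp u p (η p)) q = hessOp u q (dOp α η q) := by
  have hd : DifferentiableAt ℝ η q := (hη.differentiable (by simp)).differentiableAt
  rw [dOp_eq_sum α ((contDiff_hessOp hu hη).differentiable (by simp)).differentiableAt,
    dOp_eq_sum α hd]
  have hpd : ∀ l, pd l (fun p => hessOp u p (η p)) q
      = ∑ m, ∑ m', ((pd l (pd m (pd m' u)) q : ℝ) : ℂ) • (coordOp 0 m * coordOp 1 m') (η q)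
        + hessOp u q (pd l η q) := by
    intro l
    simp only [hessOp_apply]
    have h1 : ∀ m m', ContDiff ℝ ∞
        (fun p => ((pd m (pd m' u) p : ℝ) : ℂ) • (coordOp 0 m * coordOp 1 m') (η p)) := by
      intro m m'
      simp only [Complex.coe_smul]
      exact (ContDiff.pd (ContDiff.pd hu m') m).smul (FormOp.contDiff _ hη)
    rw [pd_sum, ← Finset.sum_add_distrib]
    · refine Finset.sum_congr rfl fun m _ => ?_
      rw [pd_sum, ← Finset.sum_add_distrib]
      · refine Finset.sum_congr rfl fun m' _ => ?_
        rw [pd_ofReal_smul, FormOp.pd_apply _ hd]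
        · exact ((ContDiff.pd (ContDiff.pd hu m') m).differentiable (by simp)).differentiableAt
        · exact ((FormOp.contDiff _ hη).differentiable (by simp)).differentiableAt
      · intro m' _
        exact ((h1 m m').differentiable (by simp)).differentiableAt
    · intro m _
      exact ((ContDiff.sum fun m' _ => h1 m m').differentiable (by simp)).differentiableAt
  simp only [hpd, map_add, Finset.sum_add_distrib]
  -- This is `d_α △u = 0`. The new index `l` is symmetrized with the index carrying the same `α`:
  -- with `m` for `α = 0`, and with `m'` for `α = 1` after `coordOp 1 l` has been moved past
  -- `coordOp 0 m`.
  have hz : ∑ l, coordOp α l (∑ m, ∑ m', ((pd l (pd m (pd m' u)) q : ℝ) : ℂ) •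
      (coordOp 0 m * coordOp 1 m') (η q)) = 0 := by
    have hα : α = 0 ∨ α = 1 := by
      fin_cases α <;> simp
    rcases hα with rfl | rfl
    · have : ∀ l, coordOp 0 l (∑ m, ∑ m', ((pd l (pd m (pd m' u)) q : ℝ) : ℂ) •
          (coordOp 0 m * coordOp 1 m') (η q)) = ∑ m', ∑ m, ((pd l (pd m (pd m' u)) q : ℝ) : ℂ) •
          (coordOp 0 l * coordOp 0 m) (coordOp 1 m' (η q)) := by
        intro l
        rw [Finset.sum_comm]
        simp only [map_sum, map_smul, Module.End.mul_apply]
      simp only [this]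
      rw [Finset.sum_comm]
      refine Finset.sum_eq_zero fun m' _ => ?_
      refine sum_smul_coordOp_eq_zero 0 0 _ ?_ rfl _
      intro l m
      rw [pd_comm (ContDiff.pd hu m') l m]
    · have : ∀ l, coordOp 1 l (∑ m, ∑ m', ((pd l (pd m (pd m' u)) q : ℝ) : ℂ) •
          (coordOp 0 m * coordOp 1 m') (η q)) = ∑ m, ∑ m', (-((pd l (pd m (pd m' u)) q : ℝ) : ℂ)) •
          coordOp 0 m ((coordOp 1 l * coordOp 1 m') (η q)) := by
        intro l
        simp only [map_sum, map_smul]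
        refine Finset.sum_congr rfl fun m _ => Finset.sum_congr rfl fun m' _ => ?_
        rw [← Module.End.mul_apply, ← mul_assoc, coordOp_anticomm 1 0 l m, neg_smul,
          ← smul_neg]
        rfl
      simp only [this]
      rw [Finset.sum_comm]
      refine Finset.sum_eq_zero fun m _ => ?_
      have hm : ∑ l, ∑ m', (-((pd l (pd m (pd m' u)) q : ℝ) : ℂ)) •
          coordOp 0 m ((coordOp 1 l * coordOp 1 m') (η q)) = coordOp 0 m
          (∑ l, ∑ m', (-((pd l (pd m (pd m' u)) q : ℝ) : ℂ)) •
            (coordOp 1 l * coordOp 1 m') (η q)) := by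
        simp only [map_sum, map_smul]
      rw [hm, sum_smul_coordOp_eq_zero 1 1 _ ?_ rfl, map_zero]
      intro l m'
      have h1 : pd l (pd m (pd m' u)) q = pd m' (pd m (pd l u)) q := by
        rw [pd_comm (ContDiff.pd hu m') l m]
        have h2 : pd l (pd m' u) = pd m' (pd l u) := funext fun p => pd_comm hu l m' p
        rw [h2, pd_comm (ContDiff.pd hu l) m m']
      rw [h1]
  rw [hz, zero_add, map_sum]
  refine Finset.sum_congr rfl fun l _ => ?_
  rw [← Module.End.mul_apply, ← Module.End.mul_apply]
  congr 1
  unfold hessOp hessForm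
  simp only [Finset.mul_sum, Finset.sum_mul, mul_smul_comm, smul_mul_assoc, coordOp_mul_comm]

theorem dOp_hessOp_pow (α : Fin 2) {u : HSpace n → ℝ} (hu : ContDiff ℝ ∞ u) (k : ℕ) {η : Form n}
    (hη : ContDiff ℝ ∞ η) :
    dOp α (fun p => (hessOp u p ^ k) (η p)) = fun q => (hessOp u q ^ k) (dOp α η q) := by
  induction k with
  | zero => simp
  | succ k ih =>
    ext1 q
    simp only [pow_succ', Module.End.mul_apply]
    rw [dOp_hessOp α hu (contDiff_hessOp_pow hu k hη), ih]

/-- Integration by parts: `∫ △u ∧ ξ = ∫ u △ξ`. -/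
theorem integral_hessOp {u : HSpace n → ℝ} (hu : ContDiff ℝ ∞ u) {ξ : Form n}
    (hξ : ContDiff ℝ ∞ ξ) (hc : HasCompactSupport ξ) :
    ∫ q, topCoeff (hessOp u q (ξ q)) = ∫ q, topCoeff ((u q : ℂ) • baston ξ q) := by
  have hd : Differentiable ℝ ξ := hξ.differentiable (by simp)
  have hud : Differentiable ℝ u := hu.differentiable (by simp)
  set ζ : Form n := fun q => (u q : ℂ) • dOp 1 ξ q with hζ
  set θ : Form n := fun q => ∑ m, ((pd m u q : ℝ) : ℂ) • coordOp 0 m (ξ q) with hθ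
  have hζs : ContDiff ℝ ∞ ζ := by
    simp only [hζ, Complex.coe_smul]
    exact hu.smul (contDiff_dOp 1 hξ)
  have hθm : ∀ m, ContDiff ℝ ∞ (fun q => ((pd m u q : ℝ) : ℂ) • coordOp 0 m (ξ q)) := by
    intro m
    simp only [Complex.coe_smul]
    exact (ContDiff.pd hu m).smul (FormOp.contDiff _ hξ)
  have hθs : ContDiff ℝ ∞ θ := ContDiff.sum fun m _ => hθm m
  have hζc : HasCompactSupport ζ := (HasCompactSupport.dOp hc 1).mono
    (by intro q; contrapose!; intro h; simp only [Function.mem_support, not_not] at h; simp [hζ, h])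
  have hθc : HasCompactSupport θ := hc.mono
    (by intro q; contrapose!; intro h; simp only [Function.mem_support, not_not] at h; simp [hθ, h])
  -- The difference of the two integrands is exact: u △ξ − △u∧ξ = d₀(u d₁ξ) + d₁(d₀u∧ξ), where the
  -- terms d₀u∧d₁ξ cancel.
  have key : ∀ q, topCoeff ((u q : ℂ) • baston ξ q)
      = topCoeff (hessOp u q (ξ q)) + topCoeff (dOp 0 ζ q) + topCoeff (dOp 1 θ q) := by
    intro q
    rw [← map_add, ← map_add]
    congr 1
    have h0 : dOp 0 ζ q = ∑ m, ((pd m u q : ℝ) : ℂ) • coordOp 0 m (dOp 1 ξ q) + (u q : ℂ) • baston ξ q :=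
      dOp_ofReal_smul 0 hud ((contDiff_dOp 1 hξ).differentiable (by simp)) q
    have h1 : dOp 1 θ q = -hessOp u q (ξ q) - ∑ m, ((pd m u q : ℝ) : ℂ) • coordOp 0 m (dOp 1 ξ q) := by
      rw [dOp_eq_sum 1 (hθs.differentiable (by simp)).differentiableAt, hessOp_apply]
      have : ∀ l, pd l θ q = ∑ m, (((pd l (pd m u) q : ℝ) : ℂ) • coordOp 0 m (ξ q)
          + ((pd m u q : ℝ) : ℂ) • coordOp 0 m (pd l ξ q)) := by
        intro l
        rw [hθ, pd_sum]
        · refine Finset.sum_congr rfl fun m _ => ?_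
          rw [pd_ofReal_smul, FormOp.pd_apply _ (hd q)]
          · exact ((ContDiff.pd hu m).differentiable (by simp)).differentiableAt
          · exact ((FormOp.contDiff _ hξ).differentiable (by simp)).differentiableAt
        · intro m _
          exact ((hθm m).differentiable (by simp)).differentiableAt
      simp only [this, map_sum, map_add, map_smul]
      rw [Finset.sum_comm, ← Finset.sum_neg_distrib, ← Finset.sum_sub_distrib]
      refine Finset.sum_congr rfl fun m _ => ?_
      rw [Finset.sum_add_distrib, sub_eq_add_neg]
      congr 1
      · rw [← Finset.sum_neg_distrib]
        refine Finset.sum_congr rfl fun l _ => ?_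
        rw [pd_comm hu l m, ← Module.End.mul_apply, coordOp_anticomm 1 0 l m, LinearMap.neg_apply,
          smul_neg]
      · rw [dOp_eq_sum 1 (hd q), map_sum, Finset.smul_sum, ← Finset.sum_neg_distrib]
        refine Finset.sum_congr rfl fun l _ => ?_
        rw [← Module.End.mul_apply, coordOp_anticomm 1 0 l m, LinearMap.neg_apply,
          smul_neg, Module.End.mul_apply]
    rw [h0, h1]
    abel
  simp only [key]
  have i1 : Integrable fun q => topCoeff (hessOp u q (ξ q)) :=
    (topCoeff_continuous (contDiff_hessOp hu hξ).continuous).integrable_of_hasCompactSupport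
      (hc.mono (by
        intro q; contrapose!; intro h; simp only [Function.mem_support, not_not] at h; simp [h]))
  have i2 : Integrable fun q => topCoeff (dOp 0 ζ q) :=
    (topCoeff_continuous (contDiff_dOp 0 hζs).continuous).integrable_of_hasCompactSupport
      ((HasCompactSupport.dOp hζc 0).comp_left (map_zero _))
  have i3 : Integrable fun q => topCoeff (dOp 1 θ q) :=
    (topCoeff_continuous (contDiff_dOp 1 hθs).continuous).integrable_of_hasCompactSupport
      ((HasCompactSupport.dOp hθc 1).comp_left (map_zero _))
  rw [integral_add (f := fun q => topCoeff (hessOp u q (ξ q)) + topCoeff (dOp 0 ζ q)) (i1.add i2) i3,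
    integral_add i1 i2, integral_topCoeff_dOp 0 hζs hζc,
    integral_topCoeff_dOp 1 hθs hθc, add_zero, add_zero]

/-- The current `(△u)^k` of a smooth function. -/
def smoothPower (u : HSpace n → ℝ) (k : ℕ) (η : Form n) : ℂ :=
  ∫ q, topCoeff ((hessOp u q ^ k) (η q))

theorem baston_hessOp_pow {u : HSpace n → ℝ} (hu : ContDiff ℝ ∞ u) (k : ℕ) {η : Form n}
    (hη : ContDiff ℝ ∞ η) (q : HSpace n) :
    baston (fun p => (hessOp u p ^ k) (η p)) q = (hessOp u q ^ k) (baston η q) := by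
  unfold baston
  rw [dOp_hessOp_pow 1 hu k hη, dOp_hessOp_pow 0 hu k (contDiff_dOp 1 hη)]

/-- For smooth functions the pointwise powers obey the inductive rule defining the currents: one
factor △u is integrated by parts, and △ passes through the closed form `(△u)^k`. -/
theorem smoothPower_succ {u : HSpace n → ℝ} (hu : ContDiff ℝ ∞ u) (k : ℕ) {η : Form n}
    (hη : ContDiff ℝ ∞ η) (hc : HasCompactSupport η) :
    smoothPower u (k + 1) η = smoothPower u k (funMul u (baston η)) := by
  unfold smoothPower
  simp only [pow_succ', Module.End.mul_apply]
  rw [integral_hessOp hu (contDiff_hessOp_pow hu k hη)]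
  · congr 1
    ext q
    rw [baston_hessOp_pow hu k hη, ← map_smul]
    rfl
  · exact hc.mono (by
      intro q; contrapose!; intro h; simp only [Function.mem_support, not_not] at h; simp [h])

theorem euclidean_eq_sum_single {ι : Type*} [Fintype ι] [DecidableEq ι] (x : EuclideanSpace ℝ ι) :
    x = ∑ i, x i • EuclideanSpace.single i (1 : ℝ) := by
  simpa using ((EuclideanSpace.basisFun ι ℝ).sum_repr x).symm

/-! ### Sub-mean value inequality and the Laplacian -/

section Laplacian

local notation "R4" => EuclideanSpace ℝ (Fin 4)

theorem setIntegral_closedBall_comp_isometry (T : R4 ≃ₗᵢ[ℝ] R4) (f : R4 → ℝ) (R : ℝ) :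
    ∫ x in Metric.closedBall 0 R, f (T x) = ∫ x in Metric.closedBall 0 R, f x := by
  have h := T.measurePreserving.setIntegral_preimage_emb
    T.toHomeomorph.measurableEmbedding f (Metric.closedBall 0 R)
  have h2 : T ⁻¹' Metric.closedBall 0 R = Metric.closedBall 0 R := by
    ext x
    simp
  rw [← h, h2]

theorem setIntegral_coord_mul {i j : Fin 4} (hij : i ≠ j) (R : ℝ) :
    ∫ x in Metric.closedBall (0 : R4) R, x i * x j = 0 := by
  let T : R4 ≃ₗᵢ[ℝ] R4 := LinearIsometryEquiv.piLpCongrRight 2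
    (fun k => if k = i then LinearIsometryEquiv.neg ℝ else LinearIsometryEquiv.refl ℝ ℝ)
  have h := setIntegral_closedBall_comp_isometry T (fun x => x i * x j) R
  have h2 : ∀ x : R4, T x i * T x j = -(x i * x j) := by
    intro x
    simp [T, LinearIsometryEquiv.piLpCongrRight_apply, hij.symm]
  simp only [h2, integral_neg] at h
  linarith

theorem setIntegral_coord_sq (i j : Fin 4) (R : ℝ) :
    ∫ x in Metric.closedBall (0 : R4) R, x i * x i
      = ∫ x in Metric.closedBall (0 : R4) R, x j * x j := by
  let T : R4 ≃ₗᵢ[ℝ] R4 := LinearIsometryEquiv.piLpCongrLeft 2 ℝ ℝ (Equiv.swap i j)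
  have h := setIntegral_closedBall_comp_isometry T (fun x => x i * x i) R
  have h2 : ∀ x : R4, T x i = x j := by
    intro x
    simp [T, LinearIsometryEquiv.piLpCongrLeft_apply, Equiv.piCongrLeft'_apply]
  simp only [h2] at h
  exact h.symm

theorem setIntegral_coord (i : Fin 4) (R : ℝ) :
    ∫ x in Metric.closedBall (0 : R4) R, x i = 0 := by
  have h := setIntegral_closedBall_comp_isometry (LinearIsometryEquiv.neg ℝ) (fun x => x i) R
  simp only [LinearIsometryEquiv.coe_neg, PiLp.neg_apply, integral_neg] at h
  linarith

/-- The derivative of the remainder is the first-order error of `fderiv g`, hence o(‖x‖); the mean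
value inequality on the ball of radius ‖x‖ supplies the second factor. -/
theorem isLittleO_taylor_two {E : Type*} [NormedAddCommGroup E] [NormedSpace ℝ E] {g : E → ℝ}
    (hg : ContDiff ℝ 2 g) :
    (fun x => g x - g 0 - fderiv ℝ g 0 x - (1 / 2) * fderiv ℝ (fderiv ℝ g) 0 x x)
      =o[nhds 0] fun x => ‖x‖ ^ 2 := by
  have hg1 : Differentiable ℝ g := hg.differentiable (by norm_num)
  have hg2 : Differentiable ℝ (fderiv ℝ g) :=
    (hg.fderiv_right (m := 1) (by norm_num)).differentiable (by norm_num)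
  have hsymm : ∀ x y, fderiv ℝ (fderiv ℝ g) 0 x y = fderiv ℝ (fderiv ℝ g) 0 y x := fun x y =>
    (hg.contDiffAt.isSymmSndFDerivAt (by simp)).eq x y
  have hd := (hg2 0).hasFDerivAt.isLittleO
  simp only [sub_zero] at hd
  rw [Asymptotics.isLittleO_iff] at hd ⊢
  intro c hc
  obtain ⟨ε, hε, hball⟩ := Metric.eventually_nhds_iff_ball.1 (hd hc)
  filter_upwards [Metric.ball_mem_nhds 0 hε] with x hx
  set F : E → ℝ := fun x => g x - g 0 - fderiv ℝ g 0 x - (1 / 2) * fderiv ℝ (fderiv ℝ g) 0 x x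
  have hF : ∀ y, HasFDerivAt F
      (fderiv ℝ g y - fderiv ℝ g 0 - fderiv ℝ (fderiv ℝ g) 0 y) y := by
    intro y
    have h1 := (((hg1 y).hasFDerivAt.sub_const (g 0)).sub
      ((fderiv ℝ g 0).hasFDerivAt (x := y))).sub
      (((fderiv ℝ (fderiv ℝ g) 0).hasFDerivAt (x := y)).clm_apply (hasFDerivAt_id y)
        |>.const_mul (1 / 2))
    refine h1.congr_fderiv ?_
    ext v
    simp [hsymm v y]
    ring
  have hb : ∀ y ∈ Metric.closedBall (0 : E) ‖x‖,
      ‖fderiv ℝ g y - fderiv ℝ g 0 - fderiv ℝ (fderiv ℝ g) 0 y‖ ≤ c * ‖x‖ := by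
    intro y hy
    rw [mem_closedBall_zero_iff] at hy
    refine (hball y (by rw [mem_ball_zero_iff] at hx ⊢; linarith)).trans ?_
    gcongr
  have := (convex_closedBall (0 : E) ‖x‖).norm_image_sub_le_of_norm_hasFDerivWithin_le
    (fun y _ => (hF y).hasFDerivWithinAt) hb (Metric.mem_closedBall_self (norm_nonneg x))
    (by simp : x ∈ Metric.closedBall (0 : E) ‖x‖)
  have hF0 : F 0 = 0 := by simp [F]
  rw [hF0, sub_zero, sub_zero, mul_assoc, ← sq] at this
  rw [norm_pow, norm_norm]
  exact this

/-- Integrate the second-order Taylor expansion over a small ball. By symmetry the linear and mixed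
quadratic terms vanish and the pure squares all have the same integral `J`, which leaves half the
Laplacian times `J` up to a small error. -/
theorem laplacian_nonneg_of_submean {g : R4 → ℝ} (hg : ContDiff ℝ 2 g) {R₀ : ℝ} (hR₀ : 0 < R₀)
    (h : ∀ R, 0 < R → R < R₀ → g 0 ≤ ⨍ x in Metric.closedBall 0 R, g x) :
    0 ≤ ∑ a, fderiv ℝ (fderiv ℝ g) 0 (EuclideanSpace.single a 1) (EuclideanSpace.single a 1) := by
  set b := fderiv ℝ (fderiv ℝ g) 0 with hb
  set tr := ∑ a, b (EuclideanSpace.single a 1) (EuclideanSpace.single a 1) with htr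
  by_contra hneg
  push Not at hneg
  have ho := isLittleO_taylor_two hg
  rw [Asymptotics.isLittleO_iff] at ho
  -- As `‖x‖ ^ 2` integrates to `4 * J`, this constant bounds the error by `-tr * J / 4`, half the
  -- size of the quadratic term `tr * J / 2`.
  obtain ⟨ε, hε, hball⟩ := Metric.eventually_nhds_iff_ball.1 (ho (c := -tr / 16) (by linarith))
  set R := min (R₀ / 2) (ε / 2) with hR
  have hRpos : 0 < R := by positivity
  have hRR₀ : R < R₀ := (min_le_left _ _).trans_lt (by linarith)
  have hRε : R < ε := (min_le_right _ _).trans_lt (by linarith)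
  set B : Set R4 := Metric.closedBall 0 R with hB
  have hBc : IsCompact B := isCompact_closedBall _ _
  have int : ∀ f : R4 → ℝ, Continuous f → IntegrableOn f B := fun f hf =>
    hf.continuousOn.integrableOn_compact hBc
  have hcg : Continuous g := hg.continuous
  have hvol : 0 < volume.real B := by
    rw [Measure.real, ENNReal.toReal_pos_iff]
    exact ⟨Metric.measure_closedBall_pos _ _ hRpos, hBc.measure_lt_top⟩
  have h1 : 0 ≤ ∫ x in B, (g x - g 0) := by
    rw [integral_sub (int g hcg) (int _ continuous_const), setIntegral_const, smul_eq_mul]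
    have := h R hRpos hRR₀
    rw [setAverage_eq, smul_eq_mul, inv_mul_eq_div, le_div_iff₀ hvol] at this
    linarith
  set J := ∫ x in B, (x 0 * x 0 : ℝ) with hJ
  have hlin : ∫ x in B, fderiv ℝ g 0 x = 0 := by
    have : ∀ x : R4, fderiv ℝ g 0 x = ∑ i, x i * fderiv ℝ g 0 (EuclideanSpace.single i 1) := by
      intro x
      conv_lhs => rw [euclidean_eq_sum_single x]
      simp only [map_sum, map_smul, smul_eq_mul]
    rw [integral_congr_ae (Filter.Eventually.of_forall this),
      integral_finsetSum _ fun i _ => int _ (by fun_prop)]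
    refine Finset.sum_eq_zero fun i _ => ?_
    rw [integral_mul_const, setIntegral_coord, zero_mul]
  have hquad : ∫ x in B, b x x = J * tr := by
    have : ∀ x : R4, b x x = ∑ i, ∑ j, x i * x j *
        b (EuclideanSpace.single i 1) (EuclideanSpace.single j 1) := by
      intro x
      conv_lhs => rw [euclidean_eq_sum_single x]
      simp only [map_sum, map_smul, smul_eq_mul, sum_apply, _root_.smul_apply, Finset.mul_sum]
      rw [Finset.sum_comm]
      refine Finset.sum_congr rfl fun i _ => Finset.sum_congr rfl fun j _ => by ring
    simp only [this]
    rw [integral_finsetSum _ fun i _ => int _ (by fun_prop), htr, Finset.mul_sum]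
    refine Finset.sum_congr rfl fun i _ => ?_
    rw [integral_finsetSum _ fun i _ => int _ (by fun_prop), Finset.sum_eq_single i]
    · rw [integral_mul_const, hJ, setIntegral_coord_sq 0 i]
    · intro j _ hj
      rw [integral_mul_const, setIntegral_coord_mul hj.symm, zero_mul]
    · simp
  have hnorm : ∫ x in B, ‖x‖ ^ 2 = 4 * J := by
    have : ∀ x : R4, ‖x‖ ^ 2 = ∑ i, x i * x i := by
      intro x
      rw [EuclideanSpace.real_norm_sq_eq]
      simp only [sq]
    simp only [this]
    rw [integral_finsetSum _ fun i _ => int _ (by fun_prop)]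
    simp only [setIntegral_coord_sq _ 0 R, hB]
    simp [hJ, hB]
  have hJpos : 0 < J := by
    have : 0 < ∫ x in B, ‖x‖ ^ 2 := by
      rw [setIntegral_pos_iff_support_of_nonneg_ae]
      · have hs : Function.support (fun x : R4 => ‖x‖ ^ 2) = {0}ᶜ := by
          ext x
          simp
        rw [hs, inter_comm, ← Set.sdiff_eq, measure_sdiff_null (by simp)]
        exact Metric.measure_closedBall_pos _ _ hRpos
      · exact Filter.Eventually.of_forall fun x => by positivity
      · exact int _ (by fun_prop)
    linarith
  have hbc : Continuous fun x : R4 => b x x := by fun_prop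
  have herr : ∫ x in B, (g x - g 0 - fderiv ℝ g 0 x - (1 / 2) * b x x) ≤ (-tr / 16) * (4 * J) := by
    rw [← hnorm, ← integral_const_mul]
    refine setIntegral_mono_on (int _ (by fun_prop)) (int _ (by fun_prop)) measurableSet_closedBall ?_
    intro x hx
    have := hball x (lt_of_le_of_lt hx hRε)
    rw [norm_pow, norm_norm] at this
    exact (le_abs_self _).trans this
  have hsplit : ∫ x in B, (g x - g 0 - fderiv ℝ g 0 x - (1 / 2) * b x x)
      = (∫ x in B, (g x - g 0)) - (∫ x in B, fderiv ℝ g 0 x) - (1 / 2) * ∫ x in B, b x x := by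
    rw [integral_sub (int _ (by fun_prop)) (int _ (by fun_prop)),
      integral_sub (int _ (by fun_prop)) (int _ (by fun_prop)), integral_const_mul]
  rw [hsplit, hlin, hquad] at herr
  nlinarith

end Laplacian

/-! ### Positivity of the Hessian two-form -/

/-- The matrix of right multiplication by the `a`-th unit quaternion on a quaternionic coordinate. -/
def unitMul (a : Fin 4) : Matrix (Fin 4) (Fin 4) ℝ :=
  match a with
  | 0 => !![1, 0, 0, 0; 0, 1, 0, 0; 0, 0, 1, 0; 0, 0, 0, 1]
  | 1 => !![0, -1, 0, 0; 1, 0, 0, 0; 0, 0, 0, 1; 0, 0, -1, 0]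
  | 2 => !![0, 0, -1, 0; 0, 0, 0, -1; 1, 0, 0, 0; 0, 1, 0, 0]
  | 3 => !![0, 0, 0, -1; 0, 0, 1, 0; 0, -1, 0, 0; 1, 0, 0, 0]

/-- The matrix of right multiplication by the `a`-th unit quaternion on `ℍⁿ`. -/
def unitMulMatrix (n : ℕ) (a : Fin 4) : Matrix (Fin n × Fin 4) (Fin n × Fin 4) ℝ :=
  Matrix.of fun p m => if p.1 = m.1 then unitMul a p.2 m.2 else 0

theorem quaternion_mk_mul_mk (a b c d a' b' c' d' : ℝ) :
    (⟨a, b, c, d⟩ * ⟨a', b', c', d'⟩ : ℍ[ℝ]) = ⟨a * a' - b * b' - c * c' - d * d',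
      a * b' + b * a' + c * d' - d * c', a * c' - b * d' + c * a' + d * b',
      a * d' + b * c' - c * b' + d * a'⟩ := by
  refine (QuaternionAlgebra.mk_mul_mk (c₁ := (-1 : ℝ)) (c₂ := 0) (c₃ := -1) ..).trans ?_
  ext <;> simp <;> ring

theorem FormOp.neg_mul (a b : FormOp n) : -a * b = -(a * b) := _root_.neg_mul a b

theorem rightMul_single (v : HSpace n) (a : Fin 4) (p : Fin n × Fin 4) :
    rightMul v (EuclideanSpace.single a 1) p = ∑ m, unitMulMatrix n a p m * v m := by
  obtain ⟨l, c⟩ := p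
  simp only [unitMulMatrix, Matrix.of_apply, Fintype.sum_prod_type, ite_mul, zero_mul,
    Finset.sum_ite_irrel, Finset.sum_const_zero, Finset.sum_ite_eq, Finset.mem_univ, if_true]
  fin_cases a <;> fin_cases c <;>
    simp [rightMul, quatCoord, unitMul, Fin.sum_univ_four, quaternion_mk_mul_mk]

/-- Right multiplication by a unit quaternion acts on the pair of columns `(symb 0, symb 1)` by a
complex `2 × 2` matrix of determinant 1. -/
theorem symb_unitMulMatrix (a : Fin 4) (p : Fin n × Fin 4) :
    (symb 0 (fun m => (unitMulMatrix n a p m : ℂ)), symb 1 (fun m => (unitMulMatrix n a p m : ℂ)))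
      = (![(symb 0 (Pi.single p 1), symb 1 (Pi.single p 1)),
          (-Complex.I • symb 0 (Pi.single p 1), Complex.I • symb 1 (Pi.single p 1)),
          (-symb 1 (Pi.single p 1), symb 0 (Pi.single p 1)),
          (Complex.I • symb 1 (Pi.single p 1), Complex.I • symb 0 (Pi.single p 1))] a) := by
  obtain ⟨l, c⟩ := p
  refine Prod.ext (funext fun ⟨l', b⟩ => ?_) (funext fun ⟨l', b⟩ => ?_)
  · rcases eq_or_ne l' l with rfl | h
    · fin_cases a <;> fin_cases c <;> fin_cases b <;>
        simp [symb_apply, blockEntry, unitMulMatrix, unitMul]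
    · fin_cases a <;> fin_cases c <;> fin_cases b <;>
        simp [symb_apply, blockEntry, unitMulMatrix, h, h.symm]
  · rcases eq_or_ne l' l with rfl | h
    · fin_cases a <;> fin_cases c <;> fin_cases b <;>
        simp [symb_apply, blockEntry, unitMulMatrix, unitMul]
    · fin_cases a <;> fin_cases c <;> fin_cases b <;>
        simp [symb_apply, blockEntry, unitMulMatrix, h, h.symm]

/-- Invariance of △ under right multiplication by the unit quaternions. For `j` and `k` the two
columns are interchanged, and the symmetry of `Q` is what restores their order. -/
theorem hessForm_congr_unitMul (a : Fin 4) (Q : Matrix (Fin n × Fin 4) (Fin n × Fin 4) ℝ)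
    (hQ : ∀ i j, Q i j = Q j i) :
    hessForm ((unitMulMatrix n a).transpose * Q * unitMulMatrix n a) = hessForm Q := by
  have h1 : hessForm ((unitMulMatrix n a).transpose * Q * unitMulMatrix n a)
      = ∑ p, ∑ p', (Q p p' : ℂ) • (symbOp 0 (fun m => (unitMulMatrix n a p m : ℂ))
          * symbOp 1 (fun m => (unitMulMatrix n a p' m : ℂ))) := by
    have : ∀ p p', (Q p p' : ℂ) • (symbOp 0 (fun m => (unitMulMatrix n a p m : ℂ))
          * symbOp 1 (fun m => (unitMulMatrix n a p' m : ℂ)))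
        = ∑ m, ∑ m', ((unitMulMatrix n a p m * Q p p' * unitMulMatrix n a p' m' : ℝ) : ℂ) •
          (coordOp 0 m * coordOp 1 m') := by
      intro p p'
      rw [symbOp_eq_sum 0, symbOp_eq_sum 1]
      simp only [Finset.sum_mul, Finset.mul_sum, smul_mul_smul_comm, Finset.smul_sum, smul_smul]
      rw [Finset.sum_comm]
      refine Finset.sum_congr rfl fun m _ => Finset.sum_congr rfl fun m' _ => ?_
      congr 1
      push_cast
      ring
    simp only [this, hessForm, Matrix.mul_apply, Matrix.transpose_apply, Finset.sum_mul,
      Complex.ofReal_sum, Finset.sum_smul]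
    calc _ = ∑ m, ∑ p', ∑ m', ∑ p, ((unitMulMatrix n a p m * Q p p' * unitMulMatrix n a p' m' : ℝ) : ℂ) •
          (coordOp 0 m * coordOp 1 m') := Finset.sum_congr rfl fun m _ => Finset.sum_comm
      _ = ∑ p', ∑ m, ∑ m', ∑ p, ((unitMulMatrix n a p m * Q p p' * unitMulMatrix n a p' m' : ℝ) : ℂ) •
          (coordOp 0 m * coordOp 1 m') := Finset.sum_comm
      _ = ∑ p', ∑ m, ∑ p, ∑ m', ((unitMulMatrix n a p m * Q p p' * unitMulMatrix n a p' m' : ℝ) : ℂ) •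
          (coordOp 0 m * coordOp 1 m') :=
        Finset.sum_congr rfl fun p' _ => Finset.sum_congr rfl fun m _ => Finset.sum_comm
      _ = ∑ p', ∑ p, ∑ m, ∑ m', ((unitMulMatrix n a p m * Q p p' * unitMulMatrix n a p' m' : ℝ) : ℂ) •
          (coordOp 0 m * coordOp 1 m') := Finset.sum_congr rfl fun p' _ => Finset.sum_comm
      _ = _ := Finset.sum_comm
  have hI : Complex.I * Complex.I = -1 := Complex.I_mul_I
  have hswap : hessForm Q = ∑ p, ∑ p', (Q p p' : ℂ) • (-(coordOp 1 p * coordOp 0 p')) := by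
    rw [hessForm, Finset.sum_comm]
    refine Finset.sum_congr rfl fun m _ => Finset.sum_congr rfl fun m' _ => ?_
    rw [hQ, coordOp_anticomm 0 1]
  have hs := fun p => symb_unitMulMatrix (n := n) a p
  simp only [Prod.ext_iff] at hs
  rw [h1]
  simp only [symbOp, LinearMap.comp_apply, hs]
  have ha : a = 0 ∨ a = 1 ∨ a = 2 ∨ a = 3 := by
    fin_cases a <;> simp
  rcases ha with rfl | rfl | rfl | rfl
  · rfl
  · unfold hessForm
    refine Finset.sum_congr rfl fun p _ => Finset.sum_congr rfl fun p' _ => ?_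
    congr 1
    simp [coordOp, symbOp, FormOp.neg_mul, smul_smul, hI]
  · rw [hswap]
    refine Finset.sum_congr rfl fun p _ => Finset.sum_congr rfl fun p' _ => ?_
    congr 1
    simp [coordOp, symbOp, FormOp.neg_mul]
  · rw [hswap]
    refine Finset.sum_congr rfl fun p _ => Finset.sum_congr rfl fun p' _ => ?_
    congr 1
    simp [coordOp, symbOp, smul_smul, hI]

theorem hessForm_add (P Q : Matrix (Fin n × Fin 4) (Fin n × Fin 4) ℝ) :
    hessForm (P + Q) = hessForm P + hessForm Q := by
  simp only [hessForm, Matrix.add_apply, Complex.ofReal_add, add_smul, Finset.sum_add_distrib]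

theorem hessForm_sum {ι : Type*} (s : Finset ι)
    (Q : ι → Matrix (Fin n × Fin 4) (Fin n × Fin 4) ℝ) :
    hessForm (∑ i ∈ s, Q i) = ∑ i ∈ s, hessForm (Q i) := by
  classical
  induction s using Finset.induction_on with
  | empty => simp [hessForm]
  | insert i s hi ih => rw [Finset.sum_insert hi, hessForm_add, ih, Finset.sum_insert hi]

/-- A positive semidefinite matrix is a sum of rank-one matrices, and each of them gives a simple
two-form. -/
theorem hessForm_mem_of_posSemidef {Q : Matrix (Fin n × Fin 4) (Fin n × Fin 4) ℝ}
    (hQ : Q.PosSemidef) : hessForm Q ∈ posCone n := by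
  obtain ⟨N, L, rfl⟩ := Matrix.posSemidef_iff_eq_sum_vecMulVec.1 hQ
  have : hessForm (∑ k, Matrix.vecMulVec (L k) (star (L k))) = ∑ k, simpleTwo (L k) := by
    simp only [hessForm, simpleTwo, symbOp_eq_sum 0, symbOp_eq_sum 1, Finset.sum_mul,
      Finset.mul_sum, Matrix.sum_apply, Matrix.vecMulVec_apply, star_trivial,
      Complex.ofReal_sum, Finset.sum_smul, smul_mul_smul_comm, Complex.ofReal_mul]
    calc _ = ∑ m, ∑ k, ∑ m', ((L k m : ℂ) * (L k m' : ℂ)) • (coordOp 0 m * coordOp 1 m') :=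
          Finset.sum_congr rfl fun m _ => Finset.sum_comm
      _ = ∑ k, ∑ m, ∑ m', ((L k m : ℂ) * (L k m' : ℂ)) • (coordOp 0 m * coordOp 1 m') :=
          Finset.sum_comm
      _ = _ := Finset.sum_congr rfl fun k _ => Finset.sum_comm
  rw [this]
  exact sum_mem fun k _ => simpleTwo_mem _

/-- The Hessian two-form is positive when the real Hessian has nonnegative trace on all
quaternionic lines. -/
theorem hessForm_mem_posCone {Q : Matrix (Fin n × Fin 4) (Fin n × Fin 4) ℝ}
    (hQ : ∀ i j, Q i j = Q j i)
    (h : ∀ v : Fin n × Fin 4 → ℝ,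
      0 ≤ ∑ a, dotProduct ((unitMulMatrix n a).mulVec v) (Q.mulVec ((unitMulMatrix n a).mulVec v))) :
    hessForm Q ∈ posCone n := by
  -- Summing over the units 1, i, j, k turns the trace on quaternionic lines into an honest
  -- quadratic form, so `P` is positive semidefinite although `Q` need not be. By invariance its
  -- two-form is four times that of `Q`.
  set P := ∑ a, (unitMulMatrix n a).transpose * Q * unitMulMatrix n a with hP
  have hPs : P.PosSemidef := by
    refine Matrix.PosSemidef.of_dotProduct_mulVec_nonneg ?_ ?_
    · rw [hP]
      ext i j
      have hQt : Q.transpose = Q := by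
        ext i j
        exact hQ j i
      simp only [Matrix.conjTranspose_apply, star_trivial, Matrix.sum_apply]
      refine Finset.sum_congr rfl fun a _ => ?_
      rw [← Matrix.transpose_apply ((unitMulMatrix n a).transpose * Q * unitMulMatrix n a)]
      rw [Matrix.transpose_mul, Matrix.transpose_mul, Matrix.transpose_transpose, hQt,
        Matrix.mul_assoc]
    · intro v
      have := h v
      rw [hP, Matrix.sum_mulVec, dotProduct_sum]
      refine this.trans (le_of_eq (Finset.sum_congr rfl fun a _ => ?_))
      rw [star_trivial, Matrix.mul_assoc, ← Matrix.mulVec_mulVec, ← Matrix.mulVec_mulVec,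
        Matrix.dotProduct_mulVec v, Matrix.vecMul_transpose]
  have h4 : hessForm P = (4 : ℂ) • hessForm Q := by
    rw [hP, hessForm_sum]
    simp only [hessForm_congr_unitMul _ Q hQ]
    rw [Finset.sum_const, Finset.card_univ, Fintype.card_fin, ← Nat.cast_smul_eq_nsmul ℂ]
    norm_num
  have h5 : hessForm Q = (((1 / 4 : ℝ)) : ℂ) • hessForm P := by
    rw [h4, smul_smul]
    norm_num
  rw [h5]
  exact posCone_smul (by norm_num) (hessForm_mem_of_posSemidef hPs)

/-- Right multiplication as a continuous linear map in the second variable. -/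
def rightMulCLM (v : HSpace n) : EuclideanSpace ℝ (Fin 4) →L[ℝ] HSpace n :=
  LinearMap.toContinuousLinearMap
    { toFun := fun c => rightMul v c
      map_add' := fun c d => by
        ext ⟨l, b⟩
        fin_cases b <;> simp [rightMul, quatCoord, quaternion_mk_mul_mk] <;> ring
      map_smul' := fun r c => by
        ext ⟨l, b⟩
        fin_cases b <;> simp [rightMul, quatCoord, quaternion_mk_mul_mk] <;> ring }

theorem fderiv_fderiv_eq_hessian {u : HSpace n → ℝ} (hu : ContDiff ℝ ∞ u) (q x y : HSpace n) :
    fderiv ℝ (fderiv ℝ u) q x y = dotProduct x ((hessian u q).mulVec y) := by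
  have hd : DifferentiableAt ℝ (fderiv ℝ u) q :=
    ((hu.fderiv_right (m := ∞) (by simp)).differentiable (by simp)).differentiableAt
  have hess : ∀ i j, hessian u q i j
      = fderiv ℝ (fderiv ℝ u) q (EuclideanSpace.single i 1) (EuclideanSpace.single j 1) := by
    intro i j
    simp only [hessian, Matrix.of_apply]
    unfold pd
    rw [fderiv_clm_apply hd (differentiableAt_const _)]
    simp
  conv_lhs => rw [euclidean_eq_sum_single x, euclidean_eq_sum_single y]
  simp only [map_sum, map_smul, smul_eq_mul, sum_apply, _root_.smul_apply, dotProduct,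
    Matrix.mulVec, hess, Finset.mul_sum]
  rw [Finset.sum_comm]
  refine Finset.sum_congr rfl fun i _ => Finset.sum_congr rfl fun j _ => by ring

/-- The Laplacian at 0 of `c ↦ u (q + v c)` is the trace of the Hessian along the four directions
`v`, `v i`, `v j`, `v k`. -/
theorem hessOp_mem_posCone {u : HSpace n → ℝ} (hu : ContDiff ℝ ∞ u) {q : HSpace n}
    (h : ∀ v : HSpace n, ∃ R₀ > 0, ∀ R, 0 < R → R < R₀ →
      u q ≤ ⨍ c in Metric.closedBall (0 : EuclideanSpace ℝ (Fin 4)) R, u (q + rightMul v c)) :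
    hessOp u q ∈ posCone n := by
  apply hessForm_mem_posCone
  · intro i j
    simp only [hessian, Matrix.of_apply]
    exact pd_comm hu i j q
  · intro v'
    set v : HSpace n := WithLp.toLp 2 v' with hv
    obtain ⟨R₀, hR₀, hR⟩ := h v
    set L := rightMulCLM v
    set g : EuclideanSpace ℝ (Fin 4) → ℝ := fun c => u (q + L c) with hg
    have hgs : ContDiff ℝ ∞ g := hu.comp (contDiff_const.add L.contDiff)
    have h0 : g 0 = u q := by simp [hg]
    have hlap := laplacian_nonneg_of_submean (hgs.of_le (WithTop.coe_le_coe.2 le_top)) hR₀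
      (fun R h1 h2 => by rw [h0]; exact hR R h1 h2)
    have hinner : ∀ c, HasFDerivAt (fun c => q + L c) L c := fun c =>
      L.hasFDerivAt.const_add q
    have hg1 : ∀ c, fderiv ℝ g c = (fderiv ℝ u (q + L c)).comp L := fun c =>
      (((hu.differentiable (by simp)) (q + L c)).hasFDerivAt.comp c (hinner c)).fderiv
    have hg2 : ∀ x y, fderiv ℝ (fderiv ℝ g) 0 x y = fderiv ℝ (fderiv ℝ u) q (L x) (L y) := by
      intro x y
      have hd : DifferentiableAt ℝ (fderiv ℝ u) (q + L 0) :=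
        ((hu.fderiv_right (m := ∞) (by simp)).differentiable (by simp)).differentiableAt
      have h3 := (hd.hasFDerivAt.comp (0 : EuclideanSpace ℝ (Fin 4)) (hinner 0)).clm_comp
        (hasFDerivAt_const L (0 : EuclideanSpace ℝ (Fin 4)))
      have h4 : fderiv ℝ g = fun c => ((fderiv ℝ u ∘ fun c => q + L c) c).comp L := funext hg1
      rw [h4, h3.fderiv]
      simp
    simp only [hg2, fderiv_fderiv_eq_hessian hu] at hlap
    have hL : ∀ a, (L (EuclideanSpace.single a 1) : Fin n × Fin 4 → ℝ)
        = (unitMulMatrix n a).mulVec v' := by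
      intro a
      ext p
      exact rightMul_single v a p
    simpa only [hL] using hlap

end QuatMA

namespace QuatMA

open Filter Topology

variable {n : ℕ}

/-! ### Cutoff functions and density of test forms -/

theorem exists_cutoff {E : Type*} [NormedAddCommGroup E] [NormedSpace ℝ E] [FiniteDimensional ℝ E]
    {K W : Set E} (hK : IsCompact K) (hW : IsOpen W) (hKW : K ⊆ W) :
    ∃ χ : E → ℝ, ContDiff ℝ ∞ χ ∧ HasCompactSupport χ ∧ tsupport χ ⊆ W ∧
      (∀ q ∈ K, χ q = 1) ∧ ∀ q, 0 ≤ χ q ∧ χ q ≤ 1 := by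
  obtain ⟨δ, hδ, hδW⟩ := hK.exists_cthickening_subset_open hW hKW
  obtain ⟨χ, h0, h1, h01⟩ := exists_contMDiffMap_zero_one_of_isClosed (n := ⊤)
    (modelWithCornersSelf ℝ E) (s := (Metric.thickening δ K)ᶜ) (t := K)
    Metric.isOpen_thickening.isClosed_compl hK.isClosed
    (disjoint_compl_left_iff_subset.2 (Metric.self_subset_thickening hδ K))
  have hsub : tsupport χ ⊆ Metric.cthickening δ K := by
    refine closure_minimal ?_ Metric.isClosed_cthickening
    intro q hq
    by_contra h
    exact hq (h0 fun h' => h (Metric.thickening_subset_cthickening _ _ h'))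
  exact ⟨χ, χ.contMDiff.contDiff, (hK.cthickening).of_isClosed_subset (isClosed_tsupport _) hsub,
    hsub.trans hδW, fun q hq => h1 hq, h01⟩

/-- Mollification. The compact set `K` does not depend on `ε`, so a single bound for order-zero
currents on `K` controls all the approximations. -/
theorem exists_testForm_approx {W : Set (HSpace n)} (hW : IsOpen W) {η : Form n}
    (hη : ContForm W η) :
    ∃ K : Set (HSpace n), IsCompact K ∧ K ⊆ W ∧ tsupport η ⊆ K ∧
      ∀ ε > 0, ∃ ζ, TestForm W ζ ∧ tsupport ζ ⊆ K ∧ ∀ q, ‖η q - ζ q‖ ≤ ε := by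
  obtain ⟨hc, hs, hsub⟩ := hη
  obtain ⟨δ, hδ, hδW⟩ := hs.isCompact.exists_cthickening_subset_open hW hsub
  refine ⟨Metric.cthickening δ (tsupport η), hs.isCompact.cthickening, hδW,
    Metric.self_subset_cthickening _, fun ε hε => ?_⟩
  obtain ⟨δ', hδ', hunif⟩ := Metric.uniformContinuous_iff.1
    (hs.uniformContinuous_of_continuous hc) ε hε
  let b : ContDiffBump (0 : HSpace n) := ⟨min δ δ' / 2, min δ δ', by positivity, by
    have : 0 < min δ δ' := by positivity
    linarith⟩
  set ζ : Form n := convolution (b.normed volume) η (ContinuousLinearMap.lsmul ℝ ℝ) volume with hζ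
  have hζs : ContDiff ℝ ∞ ζ := b.hasCompactSupport_normed.contDiff_convolution_left _
    b.contDiff_normed hc.locallyIntegrable
  have hζK : tsupport ζ ⊆ Metric.cthickening δ (tsupport η) := by
    refine closure_minimal ?_ Metric.isClosed_cthickening
    refine (support_convolution_subset _).trans ?_
    rw [b.support_normed_eq]
    rintro _ ⟨y, hy, x, hx, rfl⟩
    rw [mem_ball_zero_iff] at hy
    refine Metric.mem_cthickening_of_dist_le _ x _ _ (subset_tsupport _ hx) ?_
    simp only [dist_eq_norm, add_sub_cancel_right]
    exact (hy.trans_le (min_le_left _ _)).le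
  refine ⟨ζ, ⟨hζs, hs.isCompact.cthickening.of_isClosed_subset (isClosed_tsupport _) hζK,
    hζK.trans hδW⟩, hζK, fun q => ?_⟩
  rw [← dist_eq_norm, dist_comm]
  refine b.dist_normed_convolution_le hc.aestronglyMeasurable fun x hx => ?_
  exact (hunif ((Metric.mem_ball.1 hx).trans_le (min_le_right _ _))).le

theorem TestForm.contForm {W : Set (HSpace n)} {η : Form n} (hη : TestForm W η) : ContForm W η :=
  ⟨hη.1.continuous, hη.2⟩

theorem TestForm.baston {W : Set (HSpace n)} {η : Form n} (hη : TestForm W η) :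
    TestForm W (baston η) :=
  ⟨contDiff_dOp 0 (contDiff_dOp 1 hη.1), HasCompactSupport.dOp (HasCompactSupport.dOp hη.2.1 1) 0,
    ((tsupport_dOp_subset 0 _).trans (tsupport_dOp_subset 1 _)).trans hη.2.2⟩

theorem tsupport_baston_subset (η : Form n) : tsupport (QuatMA.baston η) ⊆ tsupport η :=
  (tsupport_dOp_subset 0 _).trans (tsupport_dOp_subset 1 _)

theorem tsupport_funMul_subset (u : HSpace n → ℝ) (η : Form n) :
    tsupport (funMul u η) ⊆ tsupport η := by
  refine closure_mono ?_
  intro q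
  contrapose!
  intro h
  simp only [Function.mem_support, not_not] at h ⊢
  ext I
  simp [funMul, h]

theorem ContForm.funMul {W : Set (HSpace n)} (hW : IsOpen W) {u : HSpace n → ℝ}
    (hu : ContinuousOn u W) {η : Form n} (hη : ContForm W η) : ContForm W (funMul u η) := by
  refine ⟨?_, hη.2.1.of_isClosed_subset (isClosed_tsupport _) (tsupport_funMul_subset u η),
    (tsupport_funMul_subset u η).trans hη.2.2⟩
  rw [continuous_iff_continuousAt]
  intro q
  by_cases hq : q ∈ W
  · have hcu : ContinuousAt u q := hu.continuousAt (hW.mem_nhds hq)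
    have : QuatMA.funMul u η = fun q => (u q : ℂ) • η q := rfl
    rw [this]
    exact (Complex.continuous_ofReal.continuousAt.comp hcu).smul hη.1.continuousAt
  · have h1 : q ∉ tsupport (QuatMA.funMul u η) := fun h =>
      hq (hη.2.2 (tsupport_funMul_subset u η h))
    exact continuousAt_const.congr (notMem_tsupport_iff_eventuallyEq.1 h1).symm

theorem ContForm.add {W : Set (HSpace n)} {η ζ : Form n} (hη : ContForm W η) (hζ : ContForm W ζ) :
    ContForm W (η + ζ) :=
  ⟨hη.1.add hζ.1, hη.2.1.add hζ.2.1, (tsupport_add _ _).trans (union_subset hη.2.2 hζ.2.2)⟩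

theorem ContForm.smul {W : Set (HSpace n)} {η : Form n} (hη : ContForm W η) (c : ℂ) :
    ContForm W (c • η) :=
  ⟨hη.1.const_smul c, hη.2.1.smul_left (f := fun _ => c),
    (tsupport_smul_subset_right (fun _ => c) η).trans hη.2.2⟩

theorem ContForm.sub {W : Set (HSpace n)} {η ζ : Form n} (hη : ContForm W η) (hζ : ContForm W ζ) :
    ContForm W (η - ζ) := by
  have := hη.add (hζ.smul (-1))
  rwa [neg_one_smul, ← sub_eq_add_neg] at this

/-! ### Smooth approximation -/

/-- `v` is a sequence of smooth functions that converge to `u` locally uniformly on `W` and that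
are eventually plurisubharmonic near each compact subset of `W`. -/
structure IsPSHApprox (W : Set (HSpace n)) (u : HSpace n → ℝ) (v : ℕ → HSpace n → ℝ) : Prop where
  smooth : ∀ j, ContDiff ℝ ∞ (v j)
  pos : ∀ K : Set (HSpace n), IsCompact K → K ⊆ W → ∀ᶠ j in atTop, ∀ q ∈ K,
    hessOp (v j) q ∈ posCone n
  unif : ∀ K : Set (HSpace n), IsCompact K → K ⊆ W → TendstoUniformlyOn v u atTop K

theorem integrable_topCoeff_hessOp_pow {u : HSpace n → ℝ} (hu : ContDiff ℝ ∞ u) (k : ℕ)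
    {η : Form n} (hη : Continuous η) (hc : HasCompactSupport η) :
    Integrable fun q => topCoeff ((hessOp u q ^ k) (η q)) :=
  (topCoeff_continuous (continuous_hessOp_pow hu k hη)).integrable_of_hasCompactSupport
    (hc.mono (by
      intro q; contrapose!; intro h; simp only [Function.mem_support, not_not] at h; simp [h]))

theorem smoothPower_add {u : HSpace n → ℝ} (hu : ContDiff ℝ ∞ u) (k : ℕ) {W : Set (HSpace n)}
    {η ζ : Form n} (hη : ContForm W η) (hζ : ContForm W ζ) :
    smoothPower u k (η + ζ) = smoothPower u k η + smoothPower u k ζ := by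
  unfold smoothPower
  rw [← integral_add (integrable_topCoeff_hessOp_pow hu k hη.1 hη.2.1)
    (integrable_topCoeff_hessOp_pow hu k hζ.1 hζ.2.1)]
  simp

theorem smoothPower_smul (u : HSpace n → ℝ) (k : ℕ) (c : ℂ) (η : Form n) :
    smoothPower u k (c • η) = c * smoothPower u k η := by
  unfold smoothPower
  rw [← integral_const_mul]
  simp

theorem smoothPower_sub {u : HSpace n → ℝ} (hu : ContDiff ℝ ∞ u) (k : ℕ) {W : Set (HSpace n)}
    {η ζ : Form n} (hη : ContForm W η) (hζ : ContForm W ζ) :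
    smoothPower u k (η - ζ) = smoothPower u k η - smoothPower u k ζ := by
  rw [sub_eq_add_neg, ← neg_one_smul ℂ ζ, smoothPower_add hu k hη (hζ.smul _), smoothPower_smul]
  ring

/-- Locally uniform bounds for the `L¹` norms of the coefficients of `(△v_j)^k`. -/
def MassBound (W : Set (HSpace n)) (v : ℕ → HSpace n → ℝ) (k : ℕ) (c : FormVec n) : Prop :=
  ∀ K : Set (HSpace n), IsCompact K → K ⊆ W → ∃ C : ℝ, ∀ᶠ j in atTop,
    ∫ q in K, ‖topCoeff ((hessOp (v j) q ^ k) c)‖ ≤ C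

/-- Locally uniform bounds for the order zero currents `(△v_j)^k`. -/
def PairingBound (W : Set (HSpace n)) (v : ℕ → HSpace n → ℝ) (k : ℕ) : Prop :=
  ∀ K : Set (HSpace n), IsCompact K → K ⊆ W → ∃ C : ℝ, 0 ≤ C ∧ ∀ᶠ j in atTop, ∀ η : Form n,
    Continuous η → tsupport η ⊆ K → ∀ M : ℝ, (∀ q, ‖η q‖ ≤ M) →
      ‖smoothPower (v j) k η‖ ≤ C * M

/-! ### Chern–Levine–Nirenberg bounds and convergence of the powers. -/

section Bounds

variable {W : Set (HSpace n)} {u : HSpace n → ℝ} {v : ℕ → HSpace n → ℝ}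

theorem formVec_eq_sum (a : FormVec n) : a = ∑ I, a I • (Pi.single I 1 : FormVec n) := by
  ext J
  simp [Finset.sum_apply, Pi.single_apply]

theorem pairingBound_of_massBound (hv : ∀ j, ContDiff ℝ ∞ (v j)) {k : ℕ}
    (h : ∀ c, MassBound W v k c) : PairingBound W v k := by
  intro K hK hKW
  choose C hC using fun I : Finset (Idx n) => h (Pi.single I 1) K hK hKW
  refine ⟨∑ I, |C I|, Finset.sum_nonneg fun _ _ => abs_nonneg _, ?_⟩
  filter_upwards [eventually_all.2 hC] with j hj
  intro η hη hηK M hM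
  have hM0 : 0 ≤ M := (norm_nonneg _).trans (hM 0)
  have hz : ∀ q, q ∉ K → topCoeff ((hessOp (v j) q ^ k) (η q)) = 0 := by
    intro q hq
    have : η q = 0 := image_eq_zero_of_notMem_tsupport fun h => hq (hηK h)
    simp [this]
  have hcI : ∀ I : Finset (Idx n),
      Continuous fun q => topCoeff ((hessOp (v j) q ^ k) (Pi.single I 1)) := fun I =>
    topCoeff_continuous (continuous_hessOp_pow (hv j) k continuous_const)
  have hint : ∀ I : Finset (Idx n),
      IntegrableOn (fun q => M * ‖topCoeff ((hessOp (v j) q ^ k) (Pi.single I 1))‖) K := fun I =>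
    ((hcI I).norm.const_mul M).continuousOn.integrableOn_compact hK
  unfold smoothPower
  rw [← setIntegral_eq_integral_of_forall_compl_eq_zero hz]
  calc _ ≤ ∫ q in K, ∑ I, M * ‖topCoeff ((hessOp (v j) q ^ k) (Pi.single I 1))‖ := by
        refine norm_integral_le_of_norm_le (integrable_finsetSum _ fun I _ => hint I)
          (Eventually.of_forall fun q => ?_)
        conv_lhs => rw [formVec_eq_sum (η q)]
        simp only [map_sum, map_smul, smul_eq_mul]
        refine (norm_sum_le _ _).trans (Finset.sum_le_sum fun I _ => ?_)
        rw [norm_mul]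
        gcongr
        exact (norm_le_pi_norm (η q) I).trans (hM q)
    _ = ∑ I, M * ∫ q in K, ‖topCoeff ((hessOp (v j) q ^ k) (Pi.single I 1))‖ := by
        rw [integral_finsetSum _ fun I _ => hint I]
        simp only [integral_const_mul]
    _ ≤ ∑ I, M * |C I| := by
        gcongr with I
        exact (hj I).trans (le_abs_self _)
    _ = _ := by rw [Finset.sum_mul]; simp only [mul_comm]

theorem MassBound.add (hv : ∀ j, ContDiff ℝ ∞ (v j)) {k : ℕ} {c d : FormVec n}
    (hc : MassBound W v k c) (hd : MassBound W v k d) : MassBound W v k (c + d) := by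
  intro K hK hKW
  obtain ⟨C, hC⟩ := hc K hK hKW
  obtain ⟨D, hD⟩ := hd K hK hKW
  refine ⟨C + D, ?_⟩
  filter_upwards [hC, hD] with j h1 h2
  have hint : ∀ c : FormVec n, IntegrableOn (fun q => ‖topCoeff ((hessOp (v j) q ^ k) c)‖) K :=
    fun c => (topCoeff_continuous (continuous_hessOp_pow (hv j) k
      (continuous_const (y := c)))).norm.continuousOn.integrableOn_compact hK
  calc _ ≤ ∫ q in K, (‖topCoeff ((hessOp (v j) q ^ k) c)‖
        + ‖topCoeff ((hessOp (v j) q ^ k) d)‖) := by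
        refine integral_mono (hint _) ((hint c).add (hint d)) fun q => ?_
        simp only [map_add]
        exact norm_add_le _ _
    _ ≤ C + D := by
        rw [integral_add (hint c) (hint d)]
        exact add_le_add h1 h2

theorem MassBound.smul {k : ℕ} {c : FormVec n} (hc : MassBound W v k c) (a : ℂ) :
    MassBound W v k (a • c) := by
  intro K hK hKW
  obtain ⟨C, hC⟩ := hc K hK hKW
  refine ⟨‖a‖ * C, ?_⟩
  filter_upwards [hC] with j h1
  simp only [map_smul, norm_smul, integral_const_mul]
  gcongr

/-- Only forms of complementary degree have a top coefficient after multiplication by `(△v_j)^k`. -/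
theorem MassBound.of_degree (hpos : ∀ K : Set (HSpace n), IsCompact K → K ⊆ W →
    ∀ᶠ j in atTop, ∀ q ∈ K, hessOp (v j) q ∈ posCone n) {k p : ℕ} {c : FormVec n}
    (hc : c ∈ degreePart n p) (hp : p + 2 * k ≠ 2 * n) : MassBound W v k c := by
  intro K hK hKW
  refine ⟨0, ?_⟩
  filter_upwards [hpos K hK hKW] with j hj
  rw [setIntegral_congr_fun (g := fun _ => (0 : ℝ)) hK.measurableSet]
  · simp
  · intro q hq
    simp only [topCoeff_eq_zero (posCone_pow_mem_degreePart (hj q hq) k hc) hp, norm_zero]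

theorem simpleProduct_mem_degreePart (L : List (Fin n × Fin 4 → ℝ)) :
    (L.map simpleTwo).prod vac ∈ degreePart n (2 * L.length) := by
  induction L with
  | nil => simpa using vac_mem_degreePart
  | cons x L ih =>
    have := posCone_mem_degreePart (simpleTwo_mem x) ih
    rw [List.map_cons, List.prod_cons, Module.End.mul_apply]
    simpa [mul_add] using this

theorem massBound_of_forall_single (hv : ∀ j, ContDiff ℝ ∞ (v j)) {k : ℕ}
    (h : ∀ I, MassBound W v k (Pi.single I 1)) (c : FormVec n) : MassBound W v k c := by
  rw [formVec_eq_sum c]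
  have key : ∀ s : Finset (Finset (Idx n)),
      MassBound W v k (∑ I ∈ s, c I • (Pi.single I 1 : FormVec n)) := by
    classical
    intro s
    induction s using Finset.induction_on with
    | empty =>
      intro K _ _
      exact ⟨0, Eventually.of_forall fun j => by simp⟩
    | insert I s hI ih =>
      rw [Finset.sum_insert hI]
      exact ((h I).smul _).add hv ih
  exact key _

theorem massBound_zero (c : FormVec n) : MassBound W v 0 c := fun _ _ _ =>
  ⟨_, Eventually.of_forall fun _ => le_of_eq (by simp only [pow_zero]; rfl)⟩

/-- The Chern–Levine–Nirenberg estimate. -/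
theorem massBound_succ (hW : IsOpen W) (hu : ContinuousOn u W) (h : IsPSHApprox W u v) {k : ℕ}
    (hk : PairingBound W v k) (c : FormVec n) : MassBound W v (k + 1) c := by
  -- For a product of simple forms the density is nonnegative, so its L¹ norm over `K` is at most
  -- its pairing with a cutoff. Other coefficient vectors of even degree are combinations of these.
  have hsimple : ∀ c ∈ simpleProducts n, MassBound W v (k + 1) c := by
    rintro _ ⟨L, rfl⟩
    set c := (L.map simpleTwo).prod vac with hc
    by_cases hL : k + 1 + L.length = n
    swap
    · exact MassBound.of_degree h.pos (simpleProduct_mem_degreePart L) (by omega)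
    intro K hK hKW
    obtain ⟨χ, hχs, hχc, hχW, hχ1, hχ01⟩ := exists_cutoff hK hW hKW
    obtain ⟨C, hC0, hC⟩ := hk (tsupport χ) hχc.isCompact hχW
    set ξ : Form n := fun q => (χ q : ℂ) • c with hξ
    have hξs : ContDiff ℝ ∞ ξ := by
      simp only [hξ, Complex.coe_smul]
      exact hχs.smul contDiff_const
    have hξχ : tsupport ξ ⊆ tsupport χ := by
      refine closure_mono ?_
      intro q
      contrapose!
      intro h
      simp only [Function.mem_support, not_not] at h ⊢
      simp [hξ, h]
    have hξc : HasCompactSupport ξ := hχc.of_isClosed_subset (isClosed_tsupport _) hξχ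
    have hbχ : tsupport (baston ξ) ⊆ tsupport χ := (tsupport_baston_subset ξ).trans hξχ
    have hbs : ContDiff ℝ ∞ (baston ξ) := contDiff_dOp 0 (contDiff_dOp 1 hξs)
    obtain ⟨A, hA⟩ := hbs.continuous.bounded_above_of_compact_support
      (hχc.of_isClosed_subset (isClosed_tsupport _) hbχ)
    obtain ⟨B, hB⟩ := (hχc.isCompact.exists_bound_of_continuousOn (hu.mono hχW))
    have hA0 : 0 ≤ A := (norm_nonneg _).trans (hA 0)
    -- Here `A` bounds `baston ξ`, and `|B| + 1` bounds `v j` on the support of the cutoff as soon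
    -- as `v j` is within 1 of `u`. Only the sup norm of `u` enters.
    refine ⟨C * ((|B| + 1) * A), ?_⟩
    filter_upwards [hC, h.pos _ hχc.isCompact hχW,
      Metric.tendstoUniformlyOn_iff.1 (h.unif _ hχc.isCompact hχW) 1 one_pos] with j hj hjp hju
    have hsupp : ∀ q, χ q ≠ 0 → q ∈ tsupport χ := fun q hq => subset_tsupport _ hq
    have hKχ : ∀ q ∈ K, q ∈ tsupport χ := fun q hq => hsupp q (by simp [hχ1 q hq])
    have hnn : ∀ q ∈ tsupport χ, 0 ≤ (topCoeff ((hessOp (v j) q ^ (k + 1)) c)).re ∧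
        (topCoeff ((hessOp (v j) q ^ (k + 1)) c)).im = 0 := by
      intro q hq
      have := topCoeff_pow_mul_nonneg (hjp q hq) (k + 1) L hL
      rw [Complex.le_def] at this
      exact ⟨this.1, this.2.symm⟩
    have hcont : Continuous fun q => topCoeff ((hessOp (v j) q ^ (k + 1)) c) :=
      topCoeff_continuous (continuous_hessOp_pow (h.smooth j) (k + 1) continuous_const)
    have hsm : ∀ q, topCoeff ((hessOp (v j) q ^ (k + 1)) (ξ q))
        = ((χ q * (topCoeff ((hessOp (v j) q ^ (k + 1)) c)).re : ℝ) : ℂ) := by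
      intro q
      by_cases hq : χ q = 0
      · simp [hξ, hq]
      · simp only [hξ, map_smul, smul_eq_mul]
        push_cast
        congr 1
        apply Complex.ext
        · simp
        · simp [(hnn q (hsupp q hq)).2]
    calc ∫ q in K, ‖topCoeff ((hessOp (v j) q ^ (k + 1)) c)‖
        = ∫ q in K, χ q * (topCoeff ((hessOp (v j) q ^ (k + 1)) c)).re := by
          refine setIntegral_congr_fun hK.measurableSet fun q hq => ?_
          simp only [hχ1 q hq, one_mul]
          obtain ⟨h1, h2⟩ := hnn q (hKχ q hq)
          rw [← Complex.re_eq_norm.2 (Complex.le_def.2 ⟨h1, h2.symm⟩)]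
      _ ≤ ∫ q, χ q * (topCoeff ((hessOp (v j) q ^ (k + 1)) c)).re := by
          refine setIntegral_le_integral ?_ (Eventually.of_forall fun q => ?_)
          · exact (hχs.continuous.mul (Complex.continuous_re.comp hcont)).integrable_of_hasCompactSupport
              hχc.mul_right
          · by_cases hq : χ q = 0
            · simp [hq]
            · exact mul_nonneg (hχ01 q).1 (hnn q (hsupp q hq)).1
      _ = (smoothPower (v j) (k + 1) ξ).re := by
          unfold smoothPower
          simp only [hsm]
          rw [integral_complex_ofReal, Complex.ofReal_re]
      _ ≤ ‖smoothPower (v j) (k + 1) ξ‖ := Complex.re_le_norm _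
      _ ≤ C * ((|B| + 1) * A) := by
          -- One △ is moved from `v j` onto the cutoff form, which lowers the power to `k`, where
          -- the bound is known.
          rw [smoothPower_succ (h.smooth j) k hξs hξc]
          refine hj _ ?_ ((tsupport_funMul_subset _ _).trans hbχ) _ fun q => ?_
          · have : funMul (v j) (baston ξ) = fun q => (v j q) • baston ξ q := by
              ext q I
              simp [funMul]
            rw [this]
            exact (h.smooth j).continuous.smul hbs.continuous
          · have hfm : funMul (v j) (baston ξ) q = (v j q) • baston ξ q := by
              ext I
              simp [funMul]
            rw [hfm, norm_smul]
            by_cases hq : q ∈ tsupport χ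
            · have h1 := hju q hq
              have h2 := hB q hq
              rw [dist_comm, dist_eq_norm] at h1
              have h3 : ‖v j q‖ ≤ |B| + 1 := by
                calc ‖v j q‖ = ‖(v j q - u q) + u q‖ := by ring_nf
                  _ ≤ ‖v j q - u q‖ + ‖u q‖ := norm_add_le _ _
                  _ ≤ _ := by linarith [le_abs_self B]
              exact mul_le_mul h3 (hA q) (norm_nonneg _) (by positivity)
            · have : baston ξ q = 0 := image_eq_zero_of_notMem_tsupport fun h => hq (hbχ h)
              rw [this, norm_zero, mul_zero]
              positivity
  refine massBound_of_forall_single h.smooth (fun I => ?_) c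
  by_cases hI : Even I.card
  · have := single_mem_span I hI
    generalize (Pi.single I 1 : FormVec n) = a at this
    induction this using Submodule.span_induction with
    | mem c hc => exact hsimple c hc
    | zero => exact fun K _ _ => ⟨0, Eventually.of_forall fun j => by simp⟩
    | add a b _ _ ha hb => exact ha.add h.smooth hb
    | smul c a _ ha => exact ha.smul c
  -- Forms of odd degree never have complementary degree, since both `2 * (k + 1)` and `2 * n` are
  -- even.
  · refine MassBound.of_degree h.pos (p := I.card) ?_ ?_
    · intro J hJ
      exact Pi.single_eq_of_ne (by rintro rfl; exact hJ rfl) _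
    · intro h2
      exact hI ⟨n - (k + 1), by omega⟩

theorem pairingBound (hW : IsOpen W) (hu : ContinuousOn u W) (h : IsPSHApprox W u v) (k : ℕ) :
    PairingBound W v k := by
  induction k with
  | zero => exact pairingBound_of_massBound h.smooth massBound_zero
  | succ k ih => exact pairingBound_of_massBound h.smooth (massBound_succ hW hu h ih)

/-- The limit of the currents `(△v_j)^k`. -/
def limitPower (v : ℕ → HSpace n → ℝ) (k : ℕ) (η : Form n) : ℂ :=
  limUnder atTop fun j => smoothPower (v j) k η

/-- By integration by parts the left side pairs `(△v_j)^k` with `v_j △η`. Replacing `v_j` by `u`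
costs the bound for the `k`-th powers times the sup of `|v_j - u|` on the support of △η, which tends
to 0. -/
theorem tendsto_smoothPower_succ (hW : IsOpen W) (hu : ContinuousOn u W) (h : IsPSHApprox W u v)
    (k : ℕ) {η : Form n} (hη : TestForm W η) {l : ℂ}
    (hl : Tendsto (fun j => smoothPower (v j) k (funMul u (baston η))) atTop (𝓝 l)) :
    Tendsto (fun j => smoothPower (v j) (k + 1) η) atTop (𝓝 l) := by
  have hb := hη.baston
  obtain ⟨A, hA⟩ := hb.1.continuous.bounded_above_of_compact_support hb.2.1
  have hA0 : 0 ≤ A := (norm_nonneg _).trans (hA 0)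
  obtain ⟨C, hC0, hC⟩ := pairingBound hW hu h k _ hb.2.1.isCompact hb.2.2
  have hζ : ContForm W (funMul u (baston η)) := hb.contForm.funMul hW hu
  have hdiff : Tendsto (fun j => smoothPower (v j) k (funMul (v j) (baston η))
      - smoothPower (v j) k (funMul u (baston η))) atTop (𝓝 0) := by
    rw [Metric.tendsto_nhds]
    intro ε hε
    have hε' : 0 < ε / (C * A + 1) := by positivity
    filter_upwards [hC, Metric.tendstoUniformlyOn_iff.1
      (h.unif _ hb.2.1.isCompact hb.2.2) _ hε'] with j hj hju
    have hcv : ContForm W (funMul (v j) (baston η)) :=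
      hb.contForm.funMul hW (h.smooth j).continuous.continuousOn
    rw [dist_zero_right, ← smoothPower_sub (h.smooth j) k hcv hζ]
    have hsub : funMul (v j) (baston η) - funMul u (baston η)
        = fun q => (v j q - u q) • baston η q := by
      ext q I
      simp [funMul, sub_mul]
    have hts : tsupport (funMul (v j) (baston η) - funMul u (baston η)) ⊆ tsupport (baston η) := by
      rw [hsub]
      exact tsupport_smul_subset_right _ _
    refine (hj _ (hcv.sub hζ).1 hts (ε / (C * A + 1) * A) fun q => ?_).trans_lt ?_
    · rw [hsub]
      simp only [norm_smul]
      by_cases hq : q ∈ tsupport (baston η)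
      · have h1 := hju q hq
        rw [dist_comm, dist_eq_norm] at h1
        exact mul_le_mul h1.le (hA q) (norm_nonneg _) hε'.le
      · rw [image_eq_zero_of_notMem_tsupport hq, norm_zero, mul_zero]
        positivity
    · have : C * (ε / (C * A + 1) * A) = ε * (C * A / (C * A + 1)) := by ring
      rw [this]
      have h1 : C * A / (C * A + 1) < 1 := by
        rw [div_lt_one (by positivity)]
        linarith
      nlinarith
  have := hdiff.add hl
  rw [zero_add] at this
  refine this.congr fun j => ?_
  rw [smoothPower_succ (h.smooth j) k hη.1 hη.2.1]
  ring

/-- On test forms the limit comes from the previous power. On continuous forms density of test forms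
and the uniform bound make the sequence Cauchy. The induction must run over continuous forms,
because `u △η` is only continuous. -/
theorem exists_tendsto_smoothPower (hW : IsOpen W) (hu : ContinuousOn u W)
    (h : IsPSHApprox W u v) (k : ℕ) {η : Form n} (hη : ContForm W η) :
    ∃ l, Tendsto (fun j => smoothPower (v j) k η) atTop (𝓝 l) := by
  induction k generalizing η with
  | zero => exact ⟨_, tendsto_const_nhds.congr fun j => by simp only [smoothPower, pow_zero]; rfl⟩
  | succ k ih =>
    have htest : ∀ ζ, TestForm W ζ → ∃ l, Tendsto (fun j => smoothPower (v j) (k + 1) ζ)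
        atTop (𝓝 l) := by
      intro ζ hζ
      obtain ⟨l, hl⟩ := ih (hζ.baston.contForm.funMul hW hu)
      exact ⟨l, tendsto_smoothPower_succ hW hu h k hζ hl⟩
    apply cauchySeq_tendsto_of_complete
    obtain ⟨K, hK, hKW, hηK, happ⟩ := exists_testForm_approx hW hη
    obtain ⟨C, hC0, hC⟩ := pairingBound hW hu h (k + 1) K hK hKW
    rw [Metric.cauchySeq_iff']
    intro ε hε
    -- With this accuracy, replacing `η` by `ζ` costs at most `ε / 4` at each of the two indices
    -- compared; the third quarter is the Cauchy condition for `ζ`.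
    obtain ⟨ζ, hζ, hζK, hζη⟩ := happ (ε / (4 * (C + 1))) (by positivity)
    obtain ⟨l, hl⟩ := htest ζ hζ
    obtain ⟨N₁, hN₁⟩ := Metric.cauchySeq_iff.1 hl.cauchySeq (ε / 4) (by positivity)
    obtain ⟨N₂, hN₂⟩ := eventually_atTop.1 hC
    have hsmall : ∀ j ≥ N₂, ‖smoothPower (v j) (k + 1) η - smoothPower (v j) (k + 1) ζ‖
        ≤ ε / 4 := by
      intro j hj
      rw [← smoothPower_sub (h.smooth j) (k + 1) hη hζ.contForm]
      refine (hN₂ j hj (η - ζ) (hη.sub hζ.contForm).1 ?_ _ hζη).trans ?_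
      · exact (tsupport_sub η ζ).trans (union_subset hηK hζK)
      · rw [mul_div_assoc', div_le_iff₀ (by positivity)]
        nlinarith
    refine ⟨max N₁ N₂, fun j hj => ?_⟩
    have h1 := hsmall j (le_of_max_le_right hj)
    have h2 := hsmall (max N₁ N₂) (le_max_right _ _)
    have h3 := hN₁ j (le_of_max_le_left hj) (max N₁ N₂) (le_max_left _ _)
    rw [dist_eq_norm] at h3 ⊢
    calc _ = ‖(smoothPower (v j) (k + 1) η - smoothPower (v j) (k + 1) ζ)
          + (smoothPower (v j) (k + 1) ζ - smoothPower (v (max N₁ N₂)) (k + 1) ζ)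
          - (smoothPower (v (max N₁ N₂)) (k + 1) η - smoothPower (v (max N₁ N₂)) (k + 1) ζ)‖ := by
            congr 1
            ring
      _ ≤ ε / 4 + ε / 4 + ε / 4 := (norm_sub_le _ _).trans
          (add_le_add ((norm_add_le _ _).trans (add_le_add h1 h3.le)) h2)
      _ < ε := by linarith

theorem tendsto_limitPower (hW : IsOpen W) (hu : ContinuousOn u W) (h : IsPSHApprox W u v) (k : ℕ)
    {η : Form n} (hη : ContForm W η) :
    Tendsto (fun j => smoothPower (v j) k η) atTop (𝓝 (limitPower v k η)) :=
  tendsto_nhds_limUnder (exists_tendsto_smoothPower hW hu h k hη)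

theorem isCurrent_limitPower (hW : IsOpen W) (hu : ContinuousOn u W) (h : IsPSHApprox W u v)
    (k : ℕ) : IsCurrent W (limitPower v k) where
  map_add η ζ hη hζ := by
    refine tendsto_nhds_unique (tendsto_limitPower hW hu h k (hη.add hζ)) ?_
    refine ((tendsto_limitPower hW hu h k hη).add (tendsto_limitPower hW hu h k hζ)).congr
      fun j => ?_
    rw [smoothPower_add (h.smooth j) k hη hζ]
  map_smul c η hη := by
    refine tendsto_nhds_unique (tendsto_limitPower hW hu h k (hη.smul c)) ?_
    refine ((tendsto_limitPower hW hu h k hη).const_mul c).congr fun j => ?_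
    rw [smoothPower_smul]
  bounded K hK hKW := by
    obtain ⟨C, -, hC⟩ := pairingBound hW hu h k K hK hKW
    refine ⟨C, fun η hη hηK M hM => ?_⟩
    refine le_of_tendsto (tendsto_limitPower hW hu h k hη).norm ?_
    filter_upwards [hC] with j hj
    exact hj η hη.1 hηK M hM

/-- Continuous limits of smooth plurisubharmonic functions have Baston powers, namely the limits
of the powers of the approximants. -/
theorem isBastonPower_limitPower (hW : IsOpen W) (hu : ContinuousOn u W) (h : IsPSHApprox W u v)
    (k : ℕ) : IsBastonPower W u k (limitPower v k) := by
  induction k with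
  | zero =>
    intro η hη
    refine tendsto_nhds_unique (tendsto_limitPower hW hu h 0 hη) ?_
    exact tendsto_const_nhds.congr fun j => by simp only [smoothPower, pow_zero]; rfl
  | succ k ih =>
    refine ⟨_, ih, isCurrent_limitPower hW hu h (k + 1), fun η hη => ?_⟩
    exact tendsto_nhds_unique (tendsto_limitPower hW hu h (k + 1) hη.contForm)
      (tendsto_smoothPower_succ hW hu h k hη
        (tendsto_limitPower hW hu h k (hη.baston.contForm.funMul hW hu)))

end Bounds

/-! ### Uniqueness and locality of Baston powers -/

/-- Both currents have order zero, so a uniform approximation by test forms supported in one compact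
set determines the values. -/
theorem IsCurrent.ext_of_testForm {W : Set (HSpace n)} (hW : IsOpen W) {T T' : Form n → ℂ}
    (hT : IsCurrent W T) (hT' : IsCurrent W T') (h : ∀ η, TestForm W η → T η = T' η) {η : Form n}
    (hη : ContForm W η) : T η = T' η := by
  obtain ⟨K, hK, hKW, hηK, happ⟩ := exists_testForm_approx hW hη
  obtain ⟨C, hC⟩ := hT.bounded K hK hKW
  obtain ⟨C', hC'⟩ := hT'.bounded K hK hKW
  have hsub : ∀ {T : Form n → ℂ}, IsCurrent W T → ∀ ζ, TestForm W ζ → T (η - ζ) = T η - T ζ := by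
    intro T hT ζ hζ
    rw [sub_eq_add_neg, ← neg_one_smul ℂ ζ, hT.map_add _ _ hη (hζ.contForm.smul _),
      hT.map_smul _ _ hζ.contForm]
    ring
  rw [← sub_eq_zero, ← norm_eq_zero]
  refine le_antisymm (le_of_forall_pos_le_add fun ε hε => ?_) (norm_nonneg _)
  obtain ⟨ζ, hζ, hζK, hζη⟩ := happ (ε / (|C| + |C'| + 1)) (by positivity)
  have hts : tsupport (η - ζ) ⊆ K := (tsupport_sub η ζ).trans (union_subset hηK hζK)
  have h1 := hC (η - ζ) (hη.sub hζ.contForm) hts _ hζη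
  have h2 := hC' (η - ζ) (hη.sub hζ.contForm) hts _ hζη
  rw [hsub hT ζ hζ] at h1
  rw [hsub hT' ζ hζ] at h2
  have h3 : T η - T' η = (T η - T ζ) - (T' η - T' ζ) := by
    rw [h ζ hζ]
    ring
  rw [h3, zero_add]
  refine (norm_sub_le _ _).trans ?_
  have hδ : 0 ≤ ε / (|C| + |C'| + 1) := by positivity
  calc _ ≤ C * (ε / (|C| + |C'| + 1)) + C' * (ε / (|C| + |C'| + 1)) := add_le_add h1 h2
    _ ≤ |C| * (ε / (|C| + |C'| + 1)) + |C'| * (ε / (|C| + |C'| + 1)) := by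
        gcongr <;> exact le_abs_self _
    _ = ε * ((|C| + |C'|) / (|C| + |C'| + 1)) := by ring
    _ ≤ ε := by
        have : (|C| + |C'|) / (|C| + |C'| + 1) ≤ 1 := by
          rw [div_le_one (by positivity)]
          linarith
        nlinarith

theorem ContForm.mono {W W' : Set (HSpace n)} (h : W' ⊆ W) {η : Form n} (hη : ContForm W' η) :
    ContForm W η := ⟨hη.1, hη.2.1, hη.2.2.trans h⟩

theorem TestForm.mono {W W' : Set (HSpace n)} (h : W' ⊆ W) {η : Form n} (hη : TestForm W' η) :
    TestForm W η := ⟨hη.1, hη.2.1, hη.2.2.trans h⟩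

theorem IsCurrent.mono {W W' : Set (HSpace n)} (h : W' ⊆ W) {T : Form n → ℂ}
    (hT : IsCurrent W T) : IsCurrent W' T where
  map_add η ζ hη hζ := hT.map_add η ζ (hη.mono h) (hζ.mono h)
  map_smul c η hη := hT.map_smul c η (hη.mono h)
  bounded K hK hKW := by
    obtain ⟨C, hC⟩ := hT.bounded K hK (hKW.trans h)
    exact ⟨C, fun η hη => hC η (hη.mono h)⟩

/-- Baston powers restrict to open subsets and depend only on the restriction of the function. -/
theorem IsBastonPower.local {W W' : Set (HSpace n)} (h : W' ⊆ W) {u u' : HSpace n → ℝ}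
    (huu' : ∀ q ∈ W', u q = u' q) {k : ℕ} {T : Form n → ℂ} (hT : IsBastonPower W u k T) :
    IsBastonPower W' u' k T := by
  induction k generalizing T with
  | zero => exact fun η hη => hT η (hη.mono h)
  | succ k ih =>
    obtain ⟨S, hS, hTc, hTS⟩ := hT
    refine ⟨S, ih hS, hTc.mono h, fun η hη => ?_⟩
    rw [hTS η (hη.mono h)]
    congr 1
    ext q I
    by_cases hq : q ∈ W'
    · simp [funMul, huu' q hq]
    · have : baston η q = 0 :=
        image_eq_zero_of_notMem_tsupport fun h => hq (hη.baston.2.2 h)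
      simp [funMul, this]

/-- A power is prescribed on test forms through the previous power of `u △η`, a merely continuous
form. Each stage must therefore be settled on all continuous forms, by order zero, before the next.
-/
theorem IsBastonPower.unique {W : Set (HSpace n)} (hW : IsOpen W) {u : HSpace n → ℝ}
    (hu : ContinuousOn u W) {k : ℕ} {T T' : Form n → ℂ} (hT : IsBastonPower W u k T)
    (hT' : IsBastonPower W u k T') {η : Form n} (hη : ContForm W η) : T η = T' η := by
  induction k generalizing T T' η with
  | zero => rw [hT η hη, hT' η hη]
  | succ k ih =>
    obtain ⟨S, hS, hTc, hTS⟩ := hT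
    obtain ⟨S', hS', hTc', hTS'⟩ := hT'
    refine hTc.ext_of_testForm hW hTc' (fun ζ hζ => ?_) hη
    rw [hTS ζ hζ, hTS' ζ hζ]
    exact ih hS hS' (hζ.baston.contForm.funMul hW hu)

/-! ### Plurisubharmonic functions -/

theorem rightMul_zero_right (v : HSpace n) : rightMul v 0 = 0 := map_zero (rightMulCLM v)

theorem rightMul_zero_left (c : EuclideanSpace ℝ (Fin 4)) : rightMul (0 : HSpace n) c = 0 := by
  ext ⟨l, b⟩
  fin_cases b <;> simp [rightMul, quatCoord, quaternion_mk_mul_mk]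

theorem average_const_closedBall {R : ℝ} (hR : 0 < R) (x : ℝ) :
    ⨍ _ in Metric.closedBall (0 : EuclideanSpace ℝ (Fin 4)) R, x = x :=
  setAverage_const (Metric.measure_closedBall_pos _ _ hR).ne'
    (isCompact_closedBall _ _).measure_ne_top x

theorem PSH.submean {Ω : Set (HSpace n)} {u : HSpace n → ℝ} (hu : PSH Ω u) (a v : HSpace n) {R : ℝ}
    (hR : 0 < R) (h : ∀ c ∈ Metric.closedBall (0 : EuclideanSpace ℝ (Fin 4)) R,
      a + rightMul v c ∈ Ω) :
    u a ≤ ⨍ c in Metric.closedBall (0 : EuclideanSpace ℝ (Fin 4)) R, u (a + rightMul v c) := by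
  by_cases hv : v = 0
  · subst hv
    simp only [rightMul_zero_left, add_zero]
    rw [average_const_closedBall hR]
  · have := ((hu.2 a v hv).2 0 R hR h).2
    simpa only [rightMul_zero_right, add_zero] using this

theorem exists_disc_subset {W : Set (HSpace n)} (hW : IsOpen W) {q : HSpace n} (hq : q ∈ W)
    (v : HSpace n) : ∃ R₀ > 0, ∀ R < R₀,
      ∀ c ∈ Metric.closedBall (0 : EuclideanSpace ℝ (Fin 4)) R, q + rightMul v c ∈ W := by
  have hc : Continuous fun c => q + rightMulCLM v c := by fun_prop
  have h0 : (fun c => q + rightMulCLM v c) ⁻¹' W ∈ 𝓝 0 :=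
    hc.continuousAt.preimage_mem_nhds (by simpa using hW.mem_nhds hq)
  obtain ⟨R₀, hR₀, hb⟩ := Metric.mem_nhds_iff.1 h0
  exact ⟨R₀, hR₀, fun R hR c hc => hb (Metric.closedBall_subset_ball hR hc)⟩

theorem hessOp_mem_posCone_of_PSH {Ω W : Set (HSpace n)} {u u' : HSpace n → ℝ} (hu : PSH Ω u)
    (hW : IsOpen W) (hWΩ : W ⊆ Ω) (hu' : ContDiff ℝ ∞ u') (huu' : ∀ q ∈ W, u' q = u q)
    {q : HSpace n} (hq : q ∈ W) : hessOp u' q ∈ posCone n := by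
  refine hessOp_mem_posCone hu' fun v => ?_
  obtain ⟨R₀, hR₀, hdisc⟩ := exists_disc_subset hW hq v
  refine ⟨R₀, hR₀, fun R hR hRR => ?_⟩
  rw [huu' q hq]
  refine (hu.submean q v hR fun c hc => hWΩ (hdisc R hRR c hc)).trans (le_of_eq ?_)
  refine setAverage_congr_fun measurableSet_closedBall ?_
  exact Eventually.of_forall fun c hc => (huu' _ (hdisc R hRR c hc)).symm

theorem PSH.max_const {Ω : Set (HSpace n)} {u : HSpace n → ℝ} (hu : PSH Ω u) (r : ℝ) :
    PSH Ω (fun q => max (u q) r) := by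
  have husc : ∀ {E : Type} [TopologicalSpace E] {D : Set E} {f : E → ℝ},
      UpperSemicontinuousOn f D → UpperSemicontinuousOn (fun x => max (f x) r) D := by
    intro E _ D f hf x hx y hy
    rw [max_lt_iff] at hy
    filter_upwards [hf x hx y hy.1] with z hz using max_lt hz hy.2
  refine ⟨husc hu.1, fun a v hv => ⟨husc (hu.2 a v hv).1, fun c R hR hD => ?_⟩⟩
  obtain ⟨h1, h2⟩ := (hu.2 a v hv).2 c R hR hD
  have hfin : volume (Metric.closedBall c R) ≠ ⊤ := (isCompact_closedBall _ _).measure_ne_top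
  have hpos : volume (Metric.closedBall c R) ≠ 0 := (Metric.measure_closedBall_pos _ _ hR).ne'
  have hc : IntegrableOn (fun _ : EuclideanSpace ℝ (Fin 4) => r) (Metric.closedBall c R) :=
    integrableOn_const hfin
  have hi : IntegrableOn (fun c => max (u (a + rightMul v c)) r) (Metric.closedBall c R) :=
    h1.sup hc
  refine ⟨hi, max_le (h2.trans ?_) ?_⟩
  · rw [setAverage_eq, setAverage_eq, smul_eq_mul, smul_eq_mul]
    exact mul_le_mul_of_nonneg_left (integral_mono h1 hi fun _ => le_max_left _ _) (by positivity)
  · refine (setAverage_const hpos hfin r).symm.le.trans ?_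
    rw [setAverage_eq, setAverage_eq, smul_eq_mul, smul_eq_mul]
    exact mul_le_mul_of_nonneg_left (integral_mono hc hi fun _ => le_max_right _ _) (by positivity)

/-! ### Regularization -/

/-- An exhaustion of `Ω` by compact sets. -/
def exhaustSet (Ω : Set (HSpace n)) (N : ℕ) : Set (HSpace n) :=
  Metric.closedBall 0 N ∩ (Metric.thickening (1 / (N + 1 : ℝ)) Ωᶜ)ᶜ

theorem isCompact_exhaustSet (Ω : Set (HSpace n)) (N : ℕ) : IsCompact (exhaustSet Ω N) :=
  (isCompact_closedBall _ _).inter_right Metric.isOpen_thickening.isClosed_compl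

theorem exhaustSet_subset (Ω : Set (HSpace n)) (N : ℕ) : exhaustSet Ω N ⊆ Ω := by
  intro q hq
  by_contra h
  exact hq.2 (Metric.self_subset_thickening (by positivity) _ h)

theorem subset_exhaustSet {Ω K : Set (HSpace n)} (hΩ : IsOpen Ω) (hK : IsCompact K) (hKΩ : K ⊆ Ω) :
    ∀ᶠ N in atTop, K ⊆ exhaustSet Ω N := by
  obtain ⟨δ, hδ, hδΩ⟩ := hK.exists_cthickening_subset_open hΩ hKΩ
  obtain ⟨A, hA⟩ := hK.isBounded.subset_closedBall 0
  obtain ⟨N₁, hN₁⟩ := exists_nat_gt A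
  obtain ⟨N₂, hN₂⟩ := exists_nat_one_div_lt hδ
  filter_upwards [eventually_ge_atTop N₁, eventually_ge_atTop N₂] with N h1 h2
  refine fun q hq => ⟨Metric.closedBall_subset_closedBall ?_ (hA hq), fun h => ?_⟩
  · exact hN₁.le.trans (by exact_mod_cast h1)
  · obtain ⟨z, hz, hqz⟩ := Metric.mem_thickening_iff.1 h
    refine hz (hδΩ (Metric.mem_cthickening_of_dist_le z q _ _ hq ?_))
    rw [dist_comm]
    refine hqz.le.trans (le_trans ?_ hN₂.le)
    exact one_div_le_one_div_of_le (by positivity) (by gcongr)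

/-- The bump function used for regularization at scale `1 / (N + 1)`. -/
def mollifier (n N : ℕ) : ContDiffBump (0 : HSpace n) :=
  ⟨1 / (N + 1 : ℝ) / 2, 1 / (N + 1 : ℝ), by positivity, by
    have : (0 : ℝ) < 1 / (N + 1 : ℝ) := by positivity
    linarith⟩

/-- The restriction of a function to a compact set, extended by zero. -/
def cutRestrict (Ω : Set (HSpace n)) (u : HSpace n → ℝ) (N : ℕ) : HSpace n → ℝ :=
  (exhaustSet Ω N).indicator u

/-- The regularization of `u`. -/
def regularize (Ω : Set (HSpace n)) (u : HSpace n → ℝ) (N : ℕ) : HSpace n → ℝ :=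
  convolution ((mollifier n N).normed volume) (cutRestrict Ω u N) (ContinuousLinearMap.lsmul ℝ ℝ)
    volume

section Regularize

variable {Ω : Set (HSpace n)} {u : HSpace n → ℝ}

theorem measurable_cutRestrict (hu : ContinuousOn u Ω) (N : ℕ) :
    Measurable (cutRestrict Ω u N) := by
  classical
  unfold cutRestrict
  rw [← Set.piecewise_eq_indicator]
  exact ContinuousOn.measurable_piecewise (hu.mono (exhaustSet_subset Ω N))
    continuous_zero.continuousOn (isCompact_exhaustSet Ω N).measurableSet

theorem integrable_cutRestrict (hu : ContinuousOn u Ω) (N : ℕ) :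
    Integrable (cutRestrict Ω u N) :=
  (integrable_indicator_iff (isCompact_exhaustSet Ω N).measurableSet).2
    ((hu.mono (exhaustSet_subset Ω N)).integrableOn_compact (isCompact_exhaustSet Ω N))

theorem exists_bound_cutRestrict (hu : ContinuousOn u Ω) (N : ℕ) :
    ∃ M, 0 ≤ M ∧ ∀ q, ‖cutRestrict Ω u N q‖ ≤ M := by
  obtain ⟨M, hM⟩ := (isCompact_exhaustSet Ω N).exists_bound_of_continuousOn
    (hu.mono (exhaustSet_subset Ω N))
  refine ⟨|M|, abs_nonneg _, fun q => ?_⟩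
  by_cases hq : q ∈ exhaustSet Ω N
  · rw [cutRestrict, indicator_of_mem hq]
    exact (hM q hq).trans (le_abs_self _)
  · rw [cutRestrict, indicator_of_notMem hq, norm_zero]
    exact abs_nonneg _

theorem contDiff_regularize (hu : ContinuousOn u Ω) (N : ℕ) :
    ContDiff ℝ ∞ (regularize Ω u N) :=
  (mollifier n N).hasCompactSupport_normed.contDiff_convolution_left _
    (mollifier n N).contDiff_normed (integrable_cutRestrict hu N).locallyIntegrable

theorem regularize_apply (N : ℕ) (q : HSpace n) : regularize Ω u N q
    = ∫ t, (mollifier n N).normed volume t * cutRestrict Ω u N (q - t) := rfl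

/-- Fubini: a convolution with a nonnegative kernel is a superposition of translates, each
satisfying the sub-mean value inequality. The hypothesis keeps all translated discs inside the set
where the truncation equals `u`. -/
theorem regularize_submean (hu : ContinuousOn u Ω) (hpsh : PSH Ω u) (N : ℕ) (q v : HSpace n)
    {R : ℝ} (hR : 0 < R)
    (h : ∀ c ∈ Metric.closedBall (0 : EuclideanSpace ℝ (Fin 4)) R,
      ∀ t ∈ Metric.ball (0 : HSpace n) (1 / (N + 1 : ℝ)), q + rightMul v c - t ∈ exhaustSet Ω N) :
    regularize Ω u N q
      ≤ ⨍ c in Metric.closedBall (0 : EuclideanSpace ℝ (Fin 4)) R,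
        regularize Ω u N (q + rightMul v c) := by
  set B := Metric.closedBall (0 : EuclideanSpace ℝ (Fin 4)) R with hB
  set b : HSpace n → ℝ := (mollifier n N).normed volume with hb
  set w := cutRestrict Ω u N with hw
  have hfin : volume B ≠ ⊤ := (isCompact_closedBall _ _).measure_ne_top
  have hvol : 0 < volume.real B := by
    rw [Measure.real, ENNReal.toReal_pos_iff]
    exact ⟨Metric.measure_closedBall_pos _ _ hR, (isCompact_closedBall _ _).measure_lt_top⟩
  have : IsFiniteMeasure (volume.restrict B) := ⟨by
    rw [Measure.restrict_apply_univ]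
    exact hfin.lt_top⟩
  obtain ⟨M, hM0, hM⟩ := exists_bound_cutRestrict (n := n) hu N
  have hwm : Measurable w := measurable_cutRestrict hu N
  have hbi : Integrable b := (mollifier n N).integrable_normed
  have hb0 : ∀ t, 0 ≤ b t := (mollifier n N).nonneg_normed
  have hbsupp : ∀ t, t ∉ Metric.ball (0 : HSpace n) (1 / (N + 1 : ℝ)) → b t = 0 := by
    intro t ht
    have := (mollifier n N).support_normed_eq (μ := volume)
    by_contra h0
    exact ht (this ▸ (Function.mem_support.2 h0))
  have hcv : Continuous fun c => rightMul v c := (rightMulCLM v).continuous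
  have hint : Integrable (Function.uncurry fun (c : EuclideanSpace ℝ (Fin 4)) (t : HSpace n) =>
      b t * w (q + rightMul v c - t)) ((volume.restrict B).prod volume) := by
    refine Integrable.mono' (g := fun p => M * b p.2) ((integrable_const M).mul_prod hbi) ?_ ?_
    · refine Measurable.aestronglyMeasurable ?_
      refine ((mollifier n N).continuous_normed.measurable.comp measurable_snd).mul (hwm.comp ?_)
      exact Continuous.measurable (by fun_prop)
    · refine Eventually.of_forall fun p => ?_
      simp only [Function.uncurry]
      rw [norm_mul, Real.norm_of_nonneg (hb0 _), mul_comm]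
      exact mul_le_mul_of_nonneg_right (hM _) (hb0 _)
  have hint0 : Integrable fun t => b t * w (q - t) := by
    refine Integrable.mono' (hbi.const_mul M) ?_ ?_
    · refine Measurable.aestronglyMeasurable ?_
      exact (mollifier n N).continuous_normed.measurable.mul
        (hwm.comp (measurable_const.sub measurable_id))
    · refine Eventually.of_forall fun t => ?_
      rw [norm_mul, Real.norm_of_nonneg (hb0 _), mul_comm]
      exact mul_le_mul_of_nonneg_right (hM _) (hb0 _)
  have hswap : ∫ c in B, regularize Ω u N (q + rightMul v c)
      = ∫ t, ∫ c in B, b t * w (q + rightMul v c - t) := by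
    simp only [regularize_apply]
    exact integral_integral_swap hint
  rw [setAverage_eq, smul_eq_mul, inv_mul_eq_div, le_div_iff₀ hvol, hswap, regularize_apply,
    ← integral_mul_const]
  refine integral_mono (hint0.mul_const _) hint.integral_prod_right fun t => ?_
  simp only
  rw [integral_const_mul, mul_assoc]
  by_cases ht : t ∈ Metric.ball (0 : HSpace n) (1 / (N + 1 : ℝ))
  swap
  · have h0 : (mollifier n N).normed volume t = 0 := hbsupp t ht
    have h1 : b t = 0 := h0
    simp [h0, h1]
  refine mul_le_mul_of_nonneg_left ?_ (hb0 t)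
  have hmem : ∀ c ∈ B, q - t + rightMul v c ∈ exhaustSet Ω N := by
    intro c hc
    have := h c hc t ht
    rwa [sub_add_eq_add_sub]
  have h0 : q - t ∈ exhaustSet Ω N := by
    have := hmem 0 (Metric.mem_closedBall_self hR.le)
    rwa [rightMul_zero_right, add_zero] at this
  have hsub := hpsh.submean (q - t) v hR fun c hc => exhaustSet_subset Ω N (hmem c hc)
  rw [setAverage_eq, smul_eq_mul, inv_mul_eq_div, le_div_iff₀ hvol] at hsub
  rw [hw, cutRestrict, indicator_of_mem h0]
  refine hsub.trans (le_of_eq (setIntegral_congr_fun measurableSet_closedBall fun c hc => ?_))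
  rw [← sub_add_eq_add_sub, indicator_of_mem (hmem c hc)]

theorem isPSHApprox_regularize (hΩ : IsOpen Ω) (hu : ContinuousOn u Ω) (hpsh : PSH Ω u) :
    IsPSHApprox Ω u (regularize Ω u) where
  smooth := contDiff_regularize hu
  pos K hK hKΩ := by
    obtain ⟨δ, hδ, hδΩ⟩ := hK.exists_cthickening_subset_open hΩ hKΩ
    -- Half of `δ` is spent on the quaternionic disc around `q`, half on the radius of the
    -- mollifier.
    have hδ2 : 0 < δ / 2 := by positivity
    filter_upwards [subset_exhaustSet hΩ hK.cthickening hδΩ,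
      (tendsto_one_div_add_atTop_nhds_zero_nat (𝕜 := ℝ)).eventually (gt_mem_nhds hδ2)]
      with N hN hNδ q hq
    refine hessOp_mem_posCone (contDiff_regularize hu N) fun v => ?_
    obtain ⟨R₀, hR₀, hdisc⟩ := exists_disc_subset Metric.isOpen_ball
      (Metric.mem_ball_self hδ2 : q ∈ Metric.ball q (δ / 2)) v
    refine ⟨R₀, hR₀, fun R hR hRR => regularize_submean hu hpsh N q v hR fun c hc t ht => hN ?_⟩
    refine Metric.mem_cthickening_of_dist_le _ q _ _ hq ?_
    have h1 := hdisc R hRR c hc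
    rw [mem_ball_iff_norm] at h1
    rw [mem_ball_zero_iff] at ht
    rw [dist_eq_norm]
    calc ‖q + rightMul v c - t - q‖ = ‖(q + rightMul v c - q) - t‖ := by congr 1; abel
      _ ≤ ‖q + rightMul v c - q‖ + ‖t‖ := norm_sub_le _ _
      _ ≤ δ := by linarith
  unif K hK hKΩ := by
    obtain ⟨δ, hδ, hδΩ⟩ := hK.exists_cthickening_subset_open hΩ hKΩ
    have huc := hK.cthickening (r := δ) |>.uniformContinuousOn_of_continuous (hu.mono hδΩ)
    rw [Metric.tendstoUniformlyOn_iff]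
    intro ε hε
    have hε2 : 0 < ε / 2 := by positivity
    obtain ⟨δ', hδ', huc'⟩ := Metric.uniformContinuousOn_iff.1 huc (ε / 2) hε2
    have hmin : 0 < min δ δ' := by positivity
    filter_upwards [subset_exhaustSet hΩ hK.cthickening hδΩ,
      (tendsto_one_div_add_atTop_nhds_zero_nat (𝕜 := ℝ)).eventually (gt_mem_nhds hmin)]
      with N hN hNδ q hq
    have hqK : q ∈ Metric.cthickening δ K := Metric.self_subset_cthickening K hq
    have hwq : ∀ x ∈ Metric.cthickening δ K, cutRestrict Ω u N x = u x := fun x hx =>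
      indicator_of_mem (hN hx) u
    have := (mollifier n N).dist_normed_convolution_le (μ := volume) (x₀ := q) (ε := ε / 2)
      (measurable_cutRestrict hu N).aestronglyMeasurable (fun x hx => by
        have hx' : dist x q < min δ δ' := lt_trans (Metric.mem_ball.1 hx) hNδ
        have hxK : x ∈ Metric.cthickening δ K :=
          Metric.mem_cthickening_of_dist_le x q _ _ hq (hx'.le.trans (min_le_left _ _))
        rw [hwq x hxK, hwq q hqK]
        exact (huc' x hxK q hqK (hx'.trans_le (min_le_right _ _))).le)
    rw [hwq q hqK] at this
    rw [dist_comm]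
    exact lt_of_le_of_lt this (by linarith)

end Regularize

/-! ### Comparison of measures -/

section MeasureComparison

variable {E : Type*} [NormedAddCommGroup E] [MeasurableSpace E] [BorelSpace E]

/-- The Lindelöf property gives a countable subcover; made disjoint, it allows the local
inequalities to be summed. -/
theorem restrict_le_of_locally [SecondCountableTopology E] {W : Set E} {A B : Measure E}
    (hW : MeasurableSet W)
    (h : ∀ p ∈ W, ∃ V, IsOpen V ∧ p ∈ V ∧ A.restrict V ≤ B.restrict V) :
    A.restrict W ≤ B.restrict W := by
  choose! V hVo hpV hV using h
  obtain ⟨T, hTW, hTc, hT⟩ := TopologicalSpace.countable_cover_nhdsWithin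
    (f := fun p => V p) (s := W) fun p hp => mem_nhdsWithin_of_mem_nhds ((hVo p hp).mem_nhds (hpV p hp))
  rcases T.eq_empty_or_nonempty with rfl | hne
  · have : W = ∅ := by simpa [subset_empty_iff] using hT
    simp [this]
  obtain ⟨e, rfl⟩ := hTc.exists_eq_range hne
  have heW : ∀ i, e i ∈ W := fun i => hTW ⟨i, rfl⟩
  set D := disjointed fun i => V (e i) with hD
  have hDm : ∀ i, MeasurableSet (D i) := MeasurableSet.disjointed fun i => (hVo _ (heW i)).measurableSet
  have hcov : W ⊆ ⋃ i, D i := by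
    rw [hD, iUnion_disjointed]
    simpa using hT
  refine Measure.le_iff.2 fun M hM => ?_
  rw [Measure.restrict_apply hM, Measure.restrict_apply hM]
  have hMU : M ∩ W = ⋃ i, (M ∩ W) ∩ D i := by
    rw [← inter_iUnion, inter_eq_left.2 (inter_subset_right.trans hcov)]
  have hdis : Pairwise (Function.onFun Disjoint fun i => (M ∩ W) ∩ D i) := fun i j hij =>
    (disjoint_disjointed _ hij).mono inter_subset_right inter_subset_right
  have hme : ∀ i, MeasurableSet ((M ∩ W) ∩ D i) := fun i => (hM.inter hW).inter (hDm i)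
  rw [hMU, measure_iUnion hdis hme, measure_iUnion hdis hme]
  refine ENNReal.tsum_le_tsum fun i => ?_
  have hsub : (M ∩ W) ∩ D i ⊆ V (e i) := inter_subset_right.trans (disjointed_subset _ i)
  have := Measure.le_iff.1 (hV _ (heW i)) _ (hme i)
  rwa [Measure.restrict_apply (hme i), Measure.restrict_apply (hme i), inter_eq_left.2 hsub] at this

/-- Cutoffs squeezed between a compact set and its thickenings give the inequality on compact sets.
In particular `A` is finite on small balls, and inner regularity there extends it to measurable
sets. -/
theorem restrict_le_of_lintegral_le [NormedSpace ℝ E] [FiniteDimensional ℝ E] {W : Set E}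
    {A B : Measure E} (hW : IsOpen W)
    (hB : ∀ K : Set E, IsCompact K → K ⊆ W → B K < ⊤) {c : ENNReal} (hc : c ≠ ⊤)
    (h : ∀ f : E → ℝ, Continuous f → HasCompactSupport f → tsupport f ⊆ W → (∀ x, 0 ≤ f x) →
      ∫⁻ x, ENNReal.ofReal (f x) ∂A ≤ c * ∫⁻ x, ENNReal.ofReal (f x) ∂B) :
    A.restrict W ≤ (c • B).restrict W := by
  have : ProperSpace E := FiniteDimensional.proper_real E
  have hcpt : ∀ K : Set E, IsCompact K → K ⊆ W → A K ≤ c * B K := by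
    intro K hK hKW
    obtain ⟨δ, hδ, hδW⟩ := hK.exists_cthickening_subset_open hW hKW
    have hlim := tendsto_measure_thickening_of_isClosed (μ := B) (s := K) ⟨δ, hδ,
      ((measure_mono (Metric.thickening_subset_cthickening _ _)).trans_lt
        (hB _ hK.cthickening hδW)).ne⟩ hK.isClosed
    refine ge_of_tendsto (ENNReal.Tendsto.const_mul hlim (Or.inr hc)) ?_
    filter_upwards [Ioo_mem_nhdsGT hδ] with s hs
    obtain ⟨χ, hχs, hχc, hχV, hχ1, hχ01⟩ := exists_cutoff hK
      (Metric.isOpen_thickening (δ := s) (E := K)) (Metric.self_subset_thickening hs.1 K)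
    have hVW : Metric.thickening s K ⊆ W :=
      ((Metric.thickening_mono hs.2.le K).trans (Metric.thickening_subset_cthickening _ _)).trans hδW
    calc A K = ∫⁻ x, K.indicator 1 x ∂A := (lintegral_indicator_one hK.measurableSet).symm
      _ ≤ ∫⁻ x, ENNReal.ofReal (χ x) ∂A := by
        refine lintegral_mono fun x => ?_
        by_cases hx : x ∈ K
        · simp [hx, hχ1 x hx]
        · simp [hx]
      _ ≤ c * ∫⁻ x, ENNReal.ofReal (χ x) ∂B := h χ hχs.continuous hχc (hχV.trans hVW) fun x => (hχ01 x).1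
      _ ≤ c * ∫⁻ x, (Metric.thickening s K).indicator 1 x ∂B := by
        gcongr with x
        by_cases hx : x ∈ Metric.thickening s K
        · rw [indicator_of_mem hx]
          simpa using (hχ01 x).2
        · have : χ x = 0 := image_eq_zero_of_notMem_tsupport fun h => hx (hχV h)
          simp [this]
      _ = c * B (Metric.thickening s K) := by
        rw [lintegral_indicator_one Metric.isOpen_thickening.measurableSet]
  refine restrict_le_of_locally hW.measurableSet fun p hp => ?_
  obtain ⟨ε, hε, hεW⟩ := Metric.isOpen_iff.1 hW p hp
  have hKW : Metric.closedBall p (ε / 2) ⊆ W :=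
    (Metric.closedBall_subset_ball (by linarith)).trans hεW
  refine ⟨Metric.ball p (ε / 2), Metric.isOpen_ball, Metric.mem_ball_self (by positivity), ?_⟩
  have hAK : A (Metric.closedBall p (ε / 2)) < ⊤ :=
    (hcpt _ (isCompact_closedBall _ _) hKW).trans_lt
      (ENNReal.mul_lt_top hc.lt_top (hB _ (isCompact_closedBall _ _) hKW))
  have hfin : IsFiniteMeasure (A.restrict (Metric.ball p (ε / 2))) := ⟨by
    rw [Measure.restrict_apply_univ]
    exact (measure_mono Metric.ball_subset_closedBall).trans_lt hAK⟩
  refine Measure.le_iff.2 fun M hM => ?_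
  have hM' := hM.inter (Metric.isOpen_ball (x := p) (ε := ε / 2)).measurableSet
  rw [Measure.restrict_apply hM, Measure.restrict_apply hM]
  have hsup := hM'.measure_eq_iSup_isCompact_of_ne_top
    (μ := A.restrict (Metric.ball p (ε / 2))) (measure_ne_top _ _)
  rw [Measure.restrict_apply hM', inter_assoc, inter_self] at hsup
  rw [hsup]
  refine iSup_le fun K => iSup_le fun hKM => iSup_le fun hK => ?_
  rw [Measure.restrict_apply hK.measurableSet, inter_eq_left.2 (hKM.trans inter_subset_right)]
  refine (hcpt K hK (((hKM.trans inter_subset_right).trans Metric.ball_subset_closedBall).trans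
    hKW)).trans ?_
  rw [Measure.smul_apply, smul_eq_mul]
  gcongr

theorem integrable_of_compact_subset {W : Set E} {A : Measure E}
    (hA : ∀ K : Set E, IsCompact K → K ⊆ W → A K < ⊤) {F : Type*} [NormedAddCommGroup F]
    [SecondCountableTopology F] {f : E → F} (hf : Continuous f) (hc : HasCompactSupport f)
    (hs : tsupport f ⊆ W) : Integrable f A := by
  obtain ⟨C, hC⟩ := hf.bounded_above_of_compact_support hc
  have hK := hA _ hc.isCompact hs
  rw [← integrableOn_iff_integrable_of_support_subset (subset_tsupport f)]
  exact Measure.integrableOn_of_bounded hK.ne hf.aestronglyMeasurable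
    (Eventually.of_forall hC)

end MeasureComparison

/-! ### Monge–Ampère measures -/

theorem zeroForm_eq_smul_vac (f : HSpace n → ℂ) : zeroForm f = fun q => f q • vac := by
  ext q I
  simp [zeroForm, vac, Pi.single_apply]

theorem tsupport_zeroForm_subset (f : HSpace n → ℂ) : tsupport (zeroForm f) ⊆ tsupport f := by
  rw [zeroForm_eq_smul_vac]
  exact tsupport_smul_subset_left f fun _ => vac

theorem ContForm.zeroForm {W : Set (HSpace n)} {f : HSpace n → ℂ} (hf : Continuous f)
    (hc : HasCompactSupport f) (hs : tsupport f ⊆ W) : ContForm W (zeroForm f) := by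
  refine ⟨?_, hc.of_isClosed_subset (isClosed_tsupport _) (tsupport_zeroForm_subset f),
    (tsupport_zeroForm_subset f).trans hs⟩
  rw [zeroForm_eq_smul_vac]
  exact hf.smul continuous_const

theorem ContForm.zeroForm_ofReal {W : Set (HSpace n)} {f : HSpace n → ℝ} (hf : Continuous f)
    (hc : HasCompactSupport f) (hs : tsupport f ⊆ W) :
    ContForm W (QuatMA.zeroForm fun q => (f q : ℂ)) := by
  have h : tsupport (fun q => (f q : ℂ)) ⊆ tsupport f :=
    closure_mono fun q hq => by simpa using hq
  exact ContForm.zeroForm (Complex.continuous_ofReal.comp hf)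
    (hc.of_isClosed_subset (isClosed_tsupport _) h) (h.trans hs)

theorem smoothPower_zeroForm (u : HSpace n → ℝ) (k : ℕ) (f : HSpace n → ℂ) :
    smoothPower u k (zeroForm f) = ∫ q, f q * topCoeff ((hessOp u q ^ k) vac) := by
  simp [smoothPower, zeroForm_eq_smul_vac]

theorem topCoeff_hessOp_pow_nonneg {u : HSpace n → ℝ} {q : HSpace n} (h : hessOp u q ∈ posCone n) :
    0 ≤ (topCoeff ((hessOp u q ^ n) vac)).re ∧ (topCoeff ((hessOp u q ^ n) vac)).im = 0 := by
  have := topCoeff_pow_mul_nonneg h n [] (by simp)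
  simp only [List.map_nil, List.prod_nil, mul_one] at this
  rw [Complex.le_def] at this
  exact ⟨this.1, this.2.symm⟩

theorem smoothPower_zeroForm_nonneg {u : HSpace n → ℝ} {f : HSpace n → ℝ}
    (h : ∀ q ∈ tsupport f, hessOp u q ∈ posCone n) :
    ((∀ q, 0 ≤ f q) → 0 ≤ (smoothPower u n (zeroForm fun q => (f q : ℂ))).re) ∧
      (smoothPower u n (zeroForm fun q => (f q : ℂ))).im = 0 := by
  have key : ∀ q, (f q : ℂ) * topCoeff ((hessOp u q ^ n) vac)
      = ((f q * (topCoeff ((hessOp u q ^ n) vac)).re : ℝ) : ℂ) := by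
    intro q
    by_cases hq : f q = 0
    · simp [hq]
    · have := (topCoeff_hessOp_pow_nonneg (h q (subset_tsupport _ hq))).2
      apply Complex.ext <;> simp [this]
  rw [smoothPower_zeroForm]
  simp only [key]
  rw [integral_complex_ofReal, Complex.ofReal_re, Complex.ofReal_im]
  refine ⟨fun hf => integral_nonneg fun q => ?_, rfl⟩
  by_cases hq : f q = 0
  · simp [hq]
  · exact mul_nonneg (hf q) (topCoeff_hessOp_pow_nonneg (h q (subset_tsupport _ hq))).1

/-! ### Existence of the Monge–Ampère measure by Riesz representation. -/

section Existence

variable {Ω : Set (HSpace n)} {u : HSpace n → ℝ} {v : ℕ → HSpace n → ℝ}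

theorem limitPower_nonneg (hΩ : IsOpen Ω) (hu : ContinuousOn u Ω) (h : IsPSHApprox Ω u v)
    {f : HSpace n → ℝ} (hf : Continuous f) (hc : HasCompactSupport f) (hs : tsupport f ⊆ Ω) :
    ((∀ q, 0 ≤ f q) → 0 ≤ (limitPower v n (zeroForm fun q => (f q : ℂ))).re) ∧
      (limitPower v n (zeroForm fun q => (f q : ℂ))).im = 0 := by
  have hlim := tendsto_limitPower hΩ hu h n (ContForm.zeroForm_ofReal hf hc hs)
  have hev : ∀ᶠ j in atTop,
      ((∀ q, 0 ≤ f q) → 0 ≤ (smoothPower (v j) n (zeroForm fun q => (f q : ℂ))).re) ∧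
      (smoothPower (v j) n (zeroForm fun q => (f q : ℂ))).im = 0 := by
    filter_upwards [h.pos _ hc.isCompact hs] with j hj
    exact smoothPower_zeroForm_nonneg hj
  constructor
  · intro hf0
    exact ge_of_tendsto ((Complex.continuous_re.tendsto _).comp hlim)
      (hev.mono fun j hj => hj.1 hf0)
  · refine tendsto_nhds_unique ((Complex.continuous_im.tendsto _).comp hlim) ?_
    exact tendsto_const_nhds.congr' (hev.mono fun j hj => hj.2.symm)

theorem zeroForm_add (f g : HSpace n → ℂ) : zeroForm (f + g) = zeroForm f + zeroForm g := by
  simp only [zeroForm_eq_smul_vac, Pi.add_apply, add_smul]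
  rfl

theorem zeroForm_smul (c : ℂ) (f : HSpace n → ℂ) : zeroForm (c • f) = c • zeroForm f := by
  simp only [zeroForm_eq_smul_vac, Pi.smul_apply, smul_assoc]
  rfl

/-- Extension by zero of a real function on a subset to a complex function. -/
def extendZero {Ω : Set (HSpace n)} (f : Ω → ℝ) (q : HSpace n) : ℝ :=
  Function.extend (Subtype.val : Ω → HSpace n) f (0 : HSpace n → ℝ) q

theorem extendZero_coe (f : Ω → ℝ) (q : Ω) : extendZero f q = f q :=
  Subtype.val_injective.extend_apply f 0 q

theorem extendZero_of_notMem (f : Ω → ℝ) {q : HSpace n} (hq : q ∉ Ω) : extendZero f q = 0 :=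
  Function.extend_apply' f (0 : HSpace n → ℝ) q fun ⟨a, ha⟩ => hq (ha ▸ a.2)

theorem continuous_extendZero (hΩ : IsOpen Ω) {f : Ω → ℝ} (hf : Continuous f)
    (hc : HasCompactSupport f) : Continuous (extendZero f) := hc.continuous_extend_zero hΩ hf

theorem tsupport_extendZero {f : Ω → ℝ} (hc : HasCompactSupport f) :
    tsupport (extendZero f) = Subtype.val '' tsupport f :=
  hc.tsupport_extend_zero continuous_subtype_val Subtype.val_injective

theorem hasCompactSupport_extendZero {f : Ω → ℝ} (hc : HasCompactSupport f) :
    HasCompactSupport (extendZero f) := by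
  rw [HasCompactSupport, tsupport_extendZero hc]
  exact hc.isCompact.image continuous_subtype_val

theorem tsupport_extendZero_subset {f : Ω → ℝ} (hc : HasCompactSupport f) :
    tsupport (extendZero f) ⊆ Ω := by
  rw [tsupport_extendZero hc]
  exact Subtype.coe_image_subset _ _

theorem contForm_extendZero (hΩ : IsOpen Ω) (f : CompactlySupportedContinuousMap Ω ℝ) :
    ContForm Ω (zeroForm fun q => (extendZero f q : ℂ)) :=
  ContForm.zeroForm_ofReal (continuous_extendZero hΩ f.continuous f.hasCompactSupport)
    (hasCompactSupport_extendZero f.hasCompactSupport)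
    (tsupport_extendZero_subset f.hasCompactSupport)

theorem extendZero_add (f g : Ω → ℝ) (q : HSpace n) :
    extendZero (f + g) q = extendZero f q + extendZero g q := by
  by_cases hq : q ∈ Ω
  · have e : ∀ h : Ω → ℝ, extendZero h q = h ⟨q, hq⟩ := fun h => extendZero_coe h ⟨q, hq⟩
    simp [e]
  · simp [extendZero_of_notMem _ hq]

theorem extendZero_smul (c : ℝ) (f : Ω → ℝ) (q : HSpace n) :
    extendZero (c • f) q = c * extendZero f q := by
  by_cases hq : q ∈ Ω
  · have e : ∀ h : Ω → ℝ, extendZero h q = h ⟨q, hq⟩ := fun h => extendZero_coe h ⟨q, hq⟩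
    simp [e]
  · simp [extendZero_of_notMem _ hq]

/-- The positive functional that represents the top power. -/
def topFunctional (hΩ : IsOpen Ω) (hu : ContinuousOn u Ω) (h : IsPSHApprox Ω u v) :
    CompactlySupportedContinuousMap Ω ℝ →ₚ[ℝ] ℝ :=
  PositiveLinearMap.mk₀
    { toFun := fun f => (limitPower v n (zeroForm fun q => (extendZero f q : ℂ))).re
      map_add' := fun f g => by
        rw [← Complex.add_re, ← (isCurrent_limitPower hΩ hu h n).map_add _ _
          (contForm_extendZero hΩ f) (contForm_extendZero hΩ g), ← zeroForm_add]
        congr 3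
        ext q
        simp [extendZero_add]
      map_smul' := fun c f => by
        have := (isCurrent_limitPower hΩ hu h n).map_smul c _ (contForm_extendZero hΩ f)
        rw [← zeroForm_smul] at this
        simp only [RingHom.id_apply, smul_eq_mul]
        rw [← Complex.re_ofReal_mul, ← this]
        congr 3
        ext q
        simp [extendZero_smul] }
    fun f hf => (limitPower_nonneg hΩ hu h
      (continuous_extendZero hΩ f.continuous f.hasCompactSupport)
      (hasCompactSupport_extendZero f.hasCompactSupport)
      (tsupport_extendZero_subset f.hasCompactSupport)).1 fun q => by
        by_cases hq : q ∈ Ω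
        · exact (hf ⟨q, hq⟩).trans_eq (extendZero_coe f ⟨q, hq⟩).symm
        · exact (extendZero_of_notMem f hq).ge

/-- The limit current is a positive functional on functions, being a limit of positive ones. The
Riesz theorem is applied on the locally compact space `Ω`, and the measure is pushed forward to the
ambient space. -/
theorem exists_isMongeAmpere_of_approx (hΩ : IsOpen Ω) (hu : ContinuousOn u Ω)
    (h : IsPSHApprox Ω u v) : ∃ μ, IsMongeAmpere Ω u μ := by
  have : LocallyCompactSpace Ω := hΩ.locallyCompactSpace
  set ν := RealRMK.rieszMeasure (topFunctional hΩ hu h) with hν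
  have hemb : MeasurableEmbedding (Subtype.val : Ω → HSpace n) :=
    MeasurableEmbedding.subtype_coe hΩ.measurableSet
  have hfinite : ∀ K : Set (HSpace n), IsCompact K → K ⊆ Ω → ν.map Subtype.val K < ⊤ := by
    intro K hK hKΩ
    rw [hemb.map_apply]
    refine IsCompact.measure_lt_top ?_
    rw [Subtype.isCompact_iff, Subtype.image_preimage_coe, inter_eq_right.2 hKΩ]
    exact hK
  refine ⟨ν.map Subtype.val, ?_, hfinite, limitPower v n, isBastonPower_limitPower hΩ hu h n, ?_⟩
  · rw [hemb.map_apply]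
    simp
  have hreal : ∀ f : HSpace n → ℝ, Continuous f → HasCompactSupport f → tsupport f ⊆ Ω →
      (limitPower v n (zeroForm fun q => (f q : ℂ))).re = ∫ q, f q ∂(ν.map Subtype.val) := by
    intro f hf hc hs
    have hfc : HasCompactSupport fun q : Ω => f q := by
      refine HasCompactSupport.intro (K := Subtype.val ⁻¹' tsupport f) ?_ fun q hq =>
        image_eq_zero_of_notMem_tsupport hq
      rw [Subtype.isCompact_iff, Subtype.image_preimage_coe, inter_eq_right.2 hs]
      exact hc.isCompact
    let F : CompactlySupportedContinuousMap Ω ℝ :=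
      ⟨⟨fun q => f q, hf.comp continuous_subtype_val⟩, hfc⟩
    have hF : extendZero F = f := by
      ext q
      by_cases hq : q ∈ Ω
      · exact extendZero_coe F ⟨q, hq⟩
      · rw [extendZero_of_notMem _ hq, image_eq_zero_of_notMem_tsupport fun h => hq (hs h)]
    rw [hemb.integral_map]
    have := RealRMK.integral_rieszMeasure (topFunctional hΩ hu h) F
    rw [← hν] at this
    refine Eq.trans ?_ this.symm
    change _ = (limitPower v n (zeroForm fun q => (extendZero F q : ℂ))).re
    rw [hF]
  have hcomplex : ∀ f : HSpace n → ℝ, Continuous f → HasCompactSupport f → tsupport f ⊆ Ω →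
      limitPower v n (zeroForm fun q => (f q : ℂ)) = ∫ q, (f q : ℂ) ∂(ν.map Subtype.val) := by
    intro f hf hc hs
    rw [integral_complex_ofReal, ← hreal f hf hc hs]
    exact Complex.ext (by simp) (by simp [(limitPower_nonneg hΩ hu h hf hc hs).2])
  intro f hf hc hs
  have hsupp : ∀ {g : HSpace n → ℝ}, (∀ q, f q = 0 → g q = 0) → HasCompactSupport g ∧
      tsupport g ⊆ Ω := fun {g} hg => by
    have : tsupport g ⊆ tsupport f := closure_mono fun q hq => fun h0 => hq (hg q h0)
    exact ⟨hc.of_isClosed_subset (isClosed_tsupport _) this, this.trans hs⟩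
  obtain ⟨hrc, hrs⟩ := hsupp (g := fun q => (f q).re) fun q hq => by simp [hq]
  obtain ⟨hic, his⟩ := hsupp (g := fun q => (f q).im) fun q hq => by simp [hq]
  have hrf : Continuous fun q => (f q).re := Complex.continuous_re.comp hf
  have hif : Continuous fun q => (f q).im := Complex.continuous_im.comp hf
  have hcF := isCurrent_limitPower hΩ hu h n
  have hr := ContForm.zeroForm_ofReal hrf hrc hrs
  have hi := ContForm.zeroForm_ofReal hif hic his
  have hsplit : f = (fun q => ((f q).re : ℂ)) + Complex.I • (fun q => ((f q).im : ℂ)) := by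
    ext q
    simp [mul_comm Complex.I]
  rw [hsplit, zeroForm_add, zeroForm_smul, hcF.map_add _ _ hr (hi.smul _), hcF.map_smul _ _ hi,
    hcomplex _ hrf hrc hrs, hcomplex _ hif hic his, ← integral_const_mul]
  refine (integral_add ?_ ?_).symm
  · exact (integrable_of_compact_subset hfinite hrf hrc hrs).ofReal
  · exact (integrable_of_compact_subset hfinite hif hic his).ofReal.const_mul _

theorem exists_isMongeAmpere (hΩ : IsOpen Ω) (hu : ContinuousOn u Ω) (hpsh : PSH Ω u) :
    ∃ μ, IsMongeAmpere Ω u μ :=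
  exists_isMongeAmpere_of_approx hΩ hu (isPSHApprox_regularize hΩ hu hpsh)

end Existence

/-! ### Monge–Ampère measures depend only on local data. -/

section Locality

variable {Ω Ω' W : Set (HSpace n)} {u u' : HSpace n → ℝ} {μ μ' : Measure (HSpace n)}

/-- Restricting the powers to `W` and invoking uniqueness there, the measure can be computed from
any local representative and any choice of its power. -/
theorem IsMongeAmpere.integral_eq_of_isBastonPower (hμ : IsMongeAmpere Ω u μ) (hW : IsOpen W)
    (hWΩ : W ⊆ Ω) (huu' : ∀ q ∈ W, u q = u' q) (hu' : ContinuousOn u' W) {T : Form n → ℂ}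
    (hT : IsBastonPower W u' n T) {f : HSpace n → ℝ} (hf : Continuous f)
    (hc : HasCompactSupport f) (hs : tsupport f ⊆ W) :
    T (zeroForm fun q => (f q : ℂ)) = ∫ q, (f q : ℂ) ∂μ := by
  obtain ⟨S, hS, hSf⟩ := hμ.2.2
  have hη := ContForm.zeroForm_ofReal hf hc hs
  have h1 : HasCompactSupport fun q => (f q : ℂ) :=
    hc.comp_left (g := fun x : ℝ => (x : ℂ)) Complex.ofReal_zero
  have h2 : tsupport (fun q => (f q : ℂ)) ⊆ tsupport f :=
    closure_mono fun q hq => by simpa using hq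
  have hfc : Continuous fun q => (f q : ℂ) := Complex.continuous_ofReal.comp hf
  rw [← hSf _ hfc h1 ((h2.trans hs).trans hWΩ)]
  exact hT.unique hW hu' (hS.local hWΩ huu') hη

theorem IsMongeAmpere.integral_eq (hμ : IsMongeAmpere Ω u μ) (hμ' : IsMongeAmpere Ω' u' μ')
    (hW : IsOpen W) (hWΩ : W ⊆ Ω) (hWΩ' : W ⊆ Ω') (huu' : ∀ q ∈ W, u q = u' q)
    (hu' : ContinuousOn u' W) {f : HSpace n → ℝ} (hf : Continuous f) (hc : HasCompactSupport f)
    (hs : tsupport f ⊆ W) : ∫ q, f q ∂μ = ∫ q, f q ∂μ' := by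
  obtain ⟨T, hT, -⟩ := hμ'.2.2
  have hT' : IsBastonPower W u' n T := hT.local hWΩ' fun _ _ => rfl
  have h1 := hμ.integral_eq_of_isBastonPower hW hWΩ huu' hu' hT' hf hc hs
  have h2 := hμ'.integral_eq_of_isBastonPower hW hWΩ' (fun _ _ => rfl) hu' hT' hf hc hs
  rw [h1, integral_complex_ofReal, integral_complex_ofReal] at h2
  exact Complex.ofReal_injective h2

theorem IsMongeAmpere.lintegral_eq (hμ : IsMongeAmpere Ω u μ) (hμ' : IsMongeAmpere Ω' u' μ')
    (hW : IsOpen W) (hWΩ : W ⊆ Ω) (hWΩ' : W ⊆ Ω') (huu' : ∀ q ∈ W, u q = u' q)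
    (hu' : ContinuousOn u' W) {f : HSpace n → ℝ} (hf : Continuous f) (hc : HasCompactSupport f)
    (hs : tsupport f ⊆ W) (hf0 : ∀ q, 0 ≤ f q) :
    ∫⁻ q, ENNReal.ofReal (f q) ∂μ = ∫⁻ q, ENNReal.ofReal (f q) ∂μ' := by
  rw [← ofReal_integral_eq_lintegral_ofReal
      (integrable_of_compact_subset hμ.2.1 hf hc (hs.trans hWΩ)) (Eventually.of_forall hf0),
    ← ofReal_integral_eq_lintegral_ofReal
      (integrable_of_compact_subset hμ'.2.1 hf hc (hs.trans hWΩ')) (Eventually.of_forall hf0),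
    hμ.integral_eq hμ' hW hWΩ hWΩ' huu' hu' hf hc hs]

/-- The approximation is arbitrary and needs to exist only on `W`. This freedom allows `max φ r` to
be approximated by functions of `φ`, for which the powers are explicit. -/
theorem IsMongeAmpere.tendsto (hμ : IsMongeAmpere Ω u μ) (hW : IsOpen W) (hWΩ : W ⊆ Ω)
    (huu' : ∀ q ∈ W, u q = u' q) (hu' : ContinuousOn u' W) {v : ℕ → HSpace n → ℝ}
    (hv : IsPSHApprox W u' v) {f : HSpace n → ℝ} (hf : Continuous f) (hc : HasCompactSupport f)
    (hs : tsupport f ⊆ W) :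
    Tendsto (fun j => ∫ q, f q * (topCoeff ((hessOp (v j) q ^ n) vac)).re) atTop
      (𝓝 (∫ q, f q ∂μ)) := by
  have h1 := hμ.integral_eq_of_isBastonPower hW hWΩ huu' hu'
    (isBastonPower_limitPower hW hu' hv n) hf hc hs
  have h2 := tendsto_limitPower hW hu' hv n (ContForm.zeroForm_ofReal hf hc hs)
  rw [h1, integral_complex_ofReal] at h2
  refine ((Complex.continuous_re.tendsto _).comp h2).congr fun j => ?_
  simp only [Function.comp_apply, smoothPower_zeroForm]
  have hint : Integrable fun q => (f q : ℂ) * topCoeff ((hessOp (v j) q ^ n) vac) := by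
    have := integrable_topCoeff_hessOp_pow (hv.smooth j) n
      (ContForm.zeroForm_ofReal hf hc hs).1 (ContForm.zeroForm_ofReal hf hc hs).2.1
    simpa [zeroForm_eq_smul_vac] using this
  rw [← Complex.reCLM_apply, ← Complex.reCLM.integral_comp_comm hint]
  simp

end Locality

/-! ### The Hessian of a composition -/

/-- The vector of first partial derivatives. -/
def gradVec (φ : HSpace n → ℝ) (q : HSpace n) (m : Fin n × Fin 4) : ℝ := pd m φ q

theorem pd_comp {φ : HSpace n → ℝ} {χ : ℝ → ℝ} {χ' : ℝ} {q : HSpace n}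
    (hφ : DifferentiableAt ℝ φ q) (hχ : HasDerivAt χ χ' (φ q)) (m : Fin n × Fin 4) :
    pd m (fun p => χ (φ p)) q = χ' * pd m φ q := by
  unfold pd
  have := (hχ.comp_hasFDerivAt q hφ.hasFDerivAt).fderiv
  rw [show (fun p => χ (φ p)) = χ ∘ φ from rfl, this]
  rfl

theorem pd_mul {f g : HSpace n → ℝ} {q : HSpace n} (hf : DifferentiableAt ℝ f q)
    (hg : DifferentiableAt ℝ g q) (m : Fin n × Fin 4) :
    pd m (fun p => f p * g p) q = pd m f q * g q + f q * pd m g q := by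
  unfold pd
  rw [fderiv_fun_mul hf hg]
  simp
  ring

theorem hessForm_smul (c : ℝ) (Q : Matrix (Fin n × Fin 4) (Fin n × Fin 4) ℝ) :
    hessForm (c • Q) = (c : ℂ) • hessForm Q := by
  simp only [hessForm, Matrix.smul_apply, smul_eq_mul, Complex.ofReal_mul, mul_smul,
    Finset.smul_sum]

theorem hessForm_vecMulVec (x : Fin n × Fin 4 → ℝ) :
    hessForm (Matrix.vecMulVec x x) = simpleTwo x := by
  simp only [hessForm, simpleTwo, symbOp_eq_sum 0, symbOp_eq_sum 1, Finset.sum_mul,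
    Finset.mul_sum, Matrix.vecMulVec_apply, smul_mul_smul_comm, Complex.ofReal_mul]
  exact Finset.sum_comm

theorem hessForm_commute (P Q : Matrix (Fin n × Fin 4) (Fin n × Fin 4) ℝ) :
    Commute (hessForm P) (hessForm Q) := by
  unfold hessForm
  refine Commute.sum_left _ _ _ fun _ _ => Commute.sum_left _ _ _ fun _ _ =>
    Commute.sum_right _ _ _ fun _ _ => Commute.sum_right _ _ _ fun _ _ => ?_
  exact ((symbOp_comm_mul _ _ _ _ _ _ _ _).smul_left _).smul_right _

theorem mul_mul_self_eq_zero_of_anticomm {R : Type*} [Ring R] {a b : R} (hba : b * a = -(a * b))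
    (haa : a * a = 0) : a * b * (a * b) = 0 := by
  rw [mul_assoc, ← mul_assoc b, hba, neg_mul, mul_assoc a, mul_neg, ← mul_assoc a, haa]
  simp

theorem simpleTwo_mul_self (x : Fin n × Fin 4 → ℝ) : simpleTwo x * simpleTwo x = 0 :=
  mul_mul_self_eq_zero_of_anticomm (symbOp_anticomm _ _ _ _) (wedgeVec_sq _)

theorem hessOp_comp {φ : HSpace n → ℝ} (hφ : ContDiff ℝ ∞ φ) {χ h : ℝ → ℝ} {h' : ℝ}
    {q : HSpace n} (hχ : ∀ t, HasDerivAt χ (h t) t) (hh : HasDerivAt h h' (φ q)) :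
    hessOp (fun p => χ (φ p)) q
      = (h (φ q) : ℂ) • hessOp φ q + (h' : ℂ) • simpleTwo (gradVec φ q) := by
  have hd : Differentiable ℝ φ := hφ.differentiable (by simp)
  have h1 : ∀ m, pd m (fun p => χ (φ p)) = fun p => h (φ p) * pd m φ p := fun m =>
    funext fun p => pd_comp (hd p) (hχ _) m
  have h2 : hessian (fun p => χ (φ p)) q
      = h (φ q) • hessian φ q + h' • Matrix.vecMulVec (gradVec φ q) (gradVec φ q) := by
    ext m m'
    simp only [hessian, Matrix.of_apply, Matrix.add_apply, Matrix.smul_apply, smul_eq_mul,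
      Matrix.vecMulVec_apply, gradVec]
    rw [h1, pd_mul (f := fun p => h (φ p)) (hh.comp_hasFDerivAt q (hd q).hasFDerivAt).differentiableAt
      ((ContDiff.pd hφ m').differentiable (by simp) q), pd_comp (hd q) hh]
    ring
  unfold hessOp
  rw [h2, hessForm_add, hessForm_smul, hessForm_smul, hessForm_vecMulVec]

/-- The binomial formula stops after the linear term in `S`. -/
theorem add_smul_pow_of_sq_zero {R : Type*} [Ring R] [Algebra ℂ R] {M S : R} (hc : Commute S M)
    (hS : S * S = 0) (a b : ℂ) {N : ℕ} (hN : N ≠ 0) :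
    (a • M + b • S) ^ N = a ^ N • M ^ N + ((N : ℂ) * a ^ (N - 1) * b) • (S * M ^ (N - 1)) := by
  obtain ⟨k, rfl⟩ := Nat.exists_eq_succ_of_ne_zero hN
  simp only [Nat.succ_eq_add_one, Nat.add_sub_cancel]
  induction k with
  | zero => simp
  | succ k ih =>
    rw [pow_succ, ih (Nat.succ_ne_zero k)]
    have h1 : M ^ (k + 1) * S = S * M ^ (k + 1) := (hc.pow_right (k + 1)).symm.eq
    have h2 : S * M ^ k * S = 0 := by
      rw [mul_assoc, ← (hc.pow_right k).eq, ← mul_assoc, hS, zero_mul]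
    simp only [add_mul, mul_add, smul_mul_smul_comm, h1, h2, smul_zero, add_zero, mul_assoc S,
      ← pow_succ]
    rw [add_assoc, ← add_smul]
    congr 2
    push_cast
    ring

/-- The density, relative to the volume form, of `d_0 φ ∧ d_1 φ ∧ (△φ)^{n-1}`. -/
def fluxDensity (φ : HSpace n → ℝ) (q : HSpace n) : ℂ :=
  topCoeff ((simpleTwo (gradVec φ q) * hessOp φ q ^ (n - 1)) vac)

theorem simpleTwo_commute_hessOp (x : Fin n × Fin 4 → ℝ) (φ : HSpace n → ℝ) (q : HSpace n) :
    Commute (simpleTwo x) (hessOp φ q) := by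
  rw [← hessForm_vecMulVec]
  exact hessForm_commute _ _

theorem topCoeff_hessOp_comp_pow [NeZero n] {φ : HSpace n → ℝ} (hφ : ContDiff ℝ ∞ φ)
    {χ h : ℝ → ℝ} {h' : ℝ} {q : HSpace n} (hχ : ∀ t, HasDerivAt χ (h t) t)
    (hh : HasDerivAt h h' (φ q)) :
    topCoeff ((hessOp (fun p => χ (φ p)) q ^ n) vac)
      = ((h (φ q) ^ n : ℝ) : ℂ) * topCoeff ((hessOp φ q ^ n) vac)
        + ((n * h (φ q) ^ (n - 1) * h' : ℝ) : ℂ) * fluxDensity φ q := by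
  rw [hessOp_comp hφ hχ hh, add_smul_pow_of_sq_zero (simpleTwo_commute_hessOp _ _ _)
    (simpleTwo_mul_self _) _ _ (NeZero.ne n)]
  simp [fluxDensity]

theorem fluxDensity_nonneg [NeZero n] {φ : HSpace n → ℝ} {q : HSpace n}
    (h : hessOp φ q ∈ posCone n) :
    0 ≤ (fluxDensity φ q).re ∧ (fluxDensity φ q).im = 0 := by
  have hn : n - 1 + 1 = n := Nat.succ_pred_eq_of_ne_zero (NeZero.ne n)
  have := topCoeff_pow_mul_nonneg h (n - 1) [gradVec φ q] (by simpa using hn)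
  simp only [List.map_cons, List.map_nil, List.prod_cons, List.prod_nil, mul_one] at this
  rw [← ((simpleTwo_commute_hessOp _ _ _).pow_right _).eq, Complex.le_def] at this
  exact ⟨this.1, this.2.symm⟩

theorem continuous_fluxDensity {φ : HSpace n → ℝ} (hφ : ContDiff ℝ ∞ φ) :
    Continuous (fluxDensity φ) := by
  have : fluxDensity φ = fun q => topCoeff (simpleTwo (gradVec φ q) ((hessOp φ q ^ (n - 1)) vac)) :=
    rfl
  rw [this]
  apply topCoeff_continuous
  simp only [← hessForm_vecMulVec, hessForm, LinearMap.sum_apply, LinearMap.smul_apply,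
    Matrix.vecMulVec_apply]
  refine continuous_finsetSum _ fun m _ => continuous_finsetSum _ fun m' _ => ?_
  have h1 : Continuous fun q => gradVec φ q m := (ContDiff.pd hφ m).continuous
  have h2 : Continuous fun q => gradVec φ q m' := (ContDiff.pd hφ m').continuous
  exact (Complex.continuous_ofReal.comp (h1.mul h2)).smul
    (FormOp.continuous _ (continuous_hessOp_pow hφ _ continuous_const))

/-! ### The boundary density -/

theorem nabla_ofReal {φ : HSpace n → ℝ} {q : HSpace n} (hφ : DifferentiableAt ℝ φ q) (j : Idx n)
    (α : Fin 2) : nabla j α (fun p => (φ p : ℂ)) q = blockEntry j α fun m => (gradVec φ q m : ℂ) := by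
  unfold nabla
  congr 1
  ext m
  exact pd_ofReal hφ m

theorem nabla_congr {f g : HSpace n → ℂ} {q : HSpace n} (h : f =ᶠ[𝓝 q] g) (j : Idx n)
    (α : Fin 2) : nabla j α f q = nabla j α g q := by
  simp only [nabla, partialD, h.fderiv_eq]

theorem triangle_congr {f g : HSpace n → ℂ} {q : HSpace n} (h : f =ᶠ[𝓝 q] g) (i j : Idx n) :
    triangle i j f q = triangle i j g q := by
  have h1 : ∀ (j : Idx n) (α : Fin 2), nabla j α f =ᶠ[𝓝 q] nabla j α g := fun j α =>
    h.eventuallyEq_nhds.mono fun p hp => nabla_congr hp j α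
  simp only [triangle, nabla_congr (h1 _ _)]

theorem boundaryDensity_congr [NeZero n] {φ ψ : HSpace n → ℝ} {q : HSpace n} (h : φ =ᶠ[𝓝 q] ψ) :
    boundaryDensity φ q = boundaryDensity ψ q := by
  have h1 : (fun p => (φ p : ℂ)) =ᶠ[𝓝 q] fun p => (ψ p : ℂ) := h.mono fun p hp => by simp [hp]
  simp only [boundaryDensity, nabla_congr h1, triangle_congr h1, normalEntry, outerNormal,
    gradient, h.fderiv_eq]

theorem gradient_apply (φ : HSpace n → ℝ) (q : HSpace n) (m : Fin n × Fin 4) :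
    gradient φ q m = gradVec φ q m := by
  have : inner ℝ (gradient φ q) (EuclideanSpace.single m (1 : ℝ)) = gradVec φ q m := by
    rw [gradient, InnerProductSpace.toDual_symm_apply]
    rfl
  rw [← this, EuclideanSpace.inner_single_right]
  simp

theorem nabla_nabla {φ : HSpace n → ℝ} (hφ : ContDiff ℝ ∞ φ) (i j : Idx n) (α β : Fin 2)
    (q : HSpace n) : nabla i α (nabla j β fun p => (φ p : ℂ)) q
      = ∑ m, ∑ m', ((pd m (pd m' φ) q : ℝ) : ℂ) * (blockEntry i α (Pi.single m 1)
        * blockEntry j β (Pi.single m' 1)) := by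
  have hd : Differentiable ℝ φ := hφ.differentiable (by simp)
  have h1 : nabla j β (fun p => (φ p : ℂ))
      = fun p => ∑ m', ((pd m' φ p * 1 : ℝ) : ℂ) • blockEntry j β (Pi.single m' 1) := by
    ext p
    rw [nabla_eq_sum]
    simp [pd_ofReal (hd p)]
  have hdd : ∀ m', Differentiable ℝ (pd m' φ) := fun m' =>
    (ContDiff.pd hφ m').differentiable (by simp)
  rw [h1, nabla_eq_sum]
  refine Finset.sum_congr rfl fun m _ => ?_
  have h2 : ∀ m', DifferentiableAt ℝ (fun p => ((pd m' φ p : ℝ) : ℂ)) q := fun m' =>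
    Complex.ofRealCLM.differentiableAt.comp q (hdd m' q)
  rw [pd_sum, Finset.sum_mul]
  · refine Finset.sum_congr rfl fun m' _ => ?_
    simp only [mul_one, smul_eq_mul]
    have h3 := pd_clm ((ContinuousLinearMap.mul ℝ ℂ).flip (blockEntry j β (Pi.single m' 1)))
      (h2 m') m
    simp only [ContinuousLinearMap.flip_apply, ContinuousLinearMap.mul_apply'] at h3
    rw [h3, pd_ofReal (hdd m' q)]
    ring
  · intro m' _
    simp only [mul_one, smul_eq_mul]
    exact (h2 m').mul_const _

theorem nabla_comm {φ : HSpace n → ℝ} (hφ : ContDiff ℝ ∞ φ) (i j : Idx n) (α β : Fin 2)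
    (q : HSpace n) : nabla i α (nabla j β fun p => (φ p : ℂ)) q
      = nabla j β (nabla i α fun p => (φ p : ℂ)) q := by
  rw [nabla_nabla hφ, nabla_nabla hφ, Finset.sum_comm]
  refine Finset.sum_congr rfl fun m _ => Finset.sum_congr rfl fun m' _ => ?_
  rw [pd_comm hφ]
  ring

theorem sum_smul_sum_mul_sum {R : Type*} [Ring R] [Algebra ℂ R] {ι κ : Type*} [Fintype ι]
    [Fintype κ] (Q : ι → ι → ℂ) (B C : κ → ι → ℂ) (w : κ → R) :
    ∑ m, ∑ m', Q m m' • ((∑ k, B k m • w k) * ∑ l, C l m' • w l)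
      = ∑ k, ∑ l, (∑ m, ∑ m', Q m m' * (B k m * C l m')) • (w k * w l) := by
  simp only [Finset.sum_mul_sum, Finset.smul_sum, Finset.sum_smul, smul_mul_smul_comm, smul_smul]
  calc _ = ∑ m, ∑ k, ∑ m', ∑ l, (Q m m' * (B k m * C l m')) • (w k * w l) :=
        Finset.sum_congr rfl fun m _ => Finset.sum_comm
    _ = ∑ m, ∑ k, ∑ l, ∑ m', (Q m m' * (B k m * C l m')) • (w k * w l) :=
        Finset.sum_congr rfl fun m _ => Finset.sum_congr rfl fun k _ => Finset.sum_comm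
    _ = ∑ k, ∑ m, ∑ l, ∑ m', (Q m m' * (B k m * C l m')) • (w k * w l) := Finset.sum_comm
    _ = _ := Finset.sum_congr rfl fun k _ => Finset.sum_comm

theorem smul_neg_eq_neg_smul {R : Type*} [Ring R] [Algebra ℂ R] (c : ℂ) (x : R) :
    c • (-x) = (-c) • x := by
  rw [smul_neg, neg_smul]

theorem eq_sum_of_eq_sum {R : Type*} [Ring R] [Algebra ℂ R] {κ : Type*} [Fintype κ] {M : R}
    {a b : κ → κ → ℂ} {w : κ → κ → R} (h1 : M = ∑ i, ∑ j, a i j • w i j)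
    (h2 : M = ∑ i, ∑ j, (-b i j) • w i j) :
    M = ∑ p : κ × κ, ((1 / 2) * (a p.1 p.2 - b p.1 p.2)) • w p.1 p.2 := by
  have h3 : M = (1 / 2 : ℂ) • (M + M) := by
    rw [← two_smul ℂ, smul_smul]
    norm_num
  rw [h3]
  conv_lhs =>
    rw [h1]
    arg 2
    arg 2
    rw [← h1, h2]
  rw [Fintype.sum_prod_type]
  simp only [← Finset.sum_add_distrib, ← add_smul, Finset.smul_sum, smul_smul, sub_eq_add_neg]

/-- The direct expansion has the coefficients `∇_{i0} ∇_{j1} φ`. Renaming the indices, with ω^i∧ω^j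
antisymmetric and the operators commuting, gives a second one with `-∇_{i1} ∇_{j0} φ`; their mean
has the coefficients `△_{ij} φ`. -/
theorem hessOp_eq_sum_triangle {φ : HSpace n → ℝ} (hφ : ContDiff ℝ ∞ φ) (q : HSpace n) :
    hessOp φ q = ∑ p : Idx n × Idx n,
      triangle p.1 p.2 (fun p => (φ p : ℂ)) q • (wedgeLeft p.1 * wedgeLeft p.2) := by
  have h1 : hessOp φ q = ∑ i : Idx n, ∑ j : Idx n,
      nabla i 0 (nabla j 1 fun p => (φ p : ℂ)) q • (wedgeLeft i * wedgeLeft j) := by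
    simp only [hessOp, hessForm, hessian, Matrix.of_apply, coordOp_eq_sum, nabla_nabla hφ]
    exact sum_smul_sum_mul_sum _ _ _ _
  have h2 : hessOp φ q = ∑ i : Idx n, ∑ j : Idx n,
      (-nabla i 1 (nabla j 0 fun p => (φ p : ℂ)) q) • (wedgeLeft i * wedgeLeft j) := by
    rw [h1, Finset.sum_comm]
    refine Finset.sum_congr rfl fun i _ => Finset.sum_congr rfl fun j _ => ?_
    rw [wedgeLeft_anticomm, nabla_comm hφ]
    exact smul_neg_eq_neg_smul _ _
  simp only [triangle]
  exact eq_sum_of_eq_sum (a := fun i j => nabla i 0 (nabla j 1 fun p => (φ p : ℂ)) q)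
    (b := fun i j => nabla i 1 (nabla j 0 fun p => (φ p : ℂ)) q)
    (w := fun i j => wedgeLeft i * wedgeLeft j) h1 h2

theorem simpleTwo_eq_sum {φ : HSpace n → ℝ} {q : HSpace n} (hφ : DifferentiableAt ℝ φ q)
    (hg : gradient φ q ≠ 0) :
    simpleTwo (gradVec φ q) = (‖gradient φ q‖ : ℂ) • ∑ p : Idx n × Idx n,
      (normalEntry φ p.1 0 q * nabla p.2 1 (fun p => (φ p : ℂ)) q)
        • (wedgeLeft p.1 * wedgeLeft p.2) := by
  have hne : (‖gradient φ q‖ : ℂ) ≠ 0 := by simpa using hg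
  have h1 : ∀ i : Idx n, (‖gradient φ q‖ : ℂ) * normalEntry φ i 0 q
      = blockEntry i 0 fun m => (gradVec φ q m : ℂ) := by
    intro i
    have : (fun m => (gradVec φ q m : ℂ))
        = (‖gradient φ q‖ : ℂ) • fun m => ((outerNormal φ q m : ℝ) : ℂ) := by
      ext m
      simp [outerNormal, gradient_apply, hne]
    rw [this]
    exact (congrFun ((symb 0).map_smul (‖gradient φ q‖ : ℂ)
      fun m => ((outerNormal φ q m : ℝ) : ℂ)) i).symm
  simp only [Finset.smul_sum, smul_smul, ← mul_assoc, h1, nabla_ofReal hφ]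
  rw [Fintype.sum_prod_type]
  simp only [simpleTwo, symbOp, LinearMap.comp_apply, wedgeVec_apply, Finset.sum_mul,
    Finset.mul_sum, smul_mul_smul_comm, symb_apply]
  exact Finset.sum_comm

/-- Multilinear expansion of d₀φ∧d₁φ∧(△φ)ⁿ⁻¹ in the ω^i∧ω^j produces the permutation signs. The
division comes from the normalized gradient: `n_{i0}` replaces `∇_{i0} φ`. -/
theorem boundaryDensity_eq [NeZero n] {φ : HSpace n → ℝ} (hφ : ContDiff ℝ ∞ φ) {q : HSpace n}
    (hg : gradient φ q ≠ 0) :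
    boundaryDensity φ q = fluxDensity φ q / ‖gradient φ q‖ := by
  have hne : (‖gradient φ q‖ : ℂ) ≠ 0 := by simpa using hg
  rw [eq_div_iff hne]
  -- Slot 0 carries d₀φ∧d₁φ without the factor `‖gradient φ q‖`; every other slot carries △φ.
  set c : Fin n → Idx n × Idx n → ℂ := fun s p =>
    if s = 0 then normalEntry φ p.1 0 q * nabla p.2 1 (fun p => (φ p : ℂ)) q
    else triangle p.1 p.2 (fun p => (φ p : ℂ)) q with hc
  set A : Fin n → FormOp n := fun s => ∑ p, c s p • (wedgeLeft p.1 * wedgeLeft p.2) with hA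
  have hprod : fluxDensity φ q = ‖gradient φ q‖ * topCoeff ((List.ofFn A).prod vac) := by
    have : simpleTwo (gradVec φ q) * hessOp φ q ^ (n - 1)
        = (‖gradient φ q‖ : ℂ) • (List.ofFn A).prod := by
      have hS : simpleTwo (gradVec φ q) = (‖gradient φ q‖ : ℂ) • A 0 := by
        rw [simpleTwo_eq_sum (hφ.differentiable (by simp) q) hg]
        simp [hA, hc]
      have hM : ∀ s, s ≠ 0 → A s = hessOp φ q := by
        intro s hs
        rw [hessOp_eq_sum_triangle hφ]
        simp [hA, hc, hs]
      clear_value A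
      obtain ⟨k, rfl⟩ := Nat.exists_eq_succ_of_ne_zero (NeZero.ne n)
      rw [List.ofFn_succ, List.prod_cons, hS, smul_mul_assoc]
      congr 2
      have : (fun i : Fin k => A i.succ) = fun _ => hessOp φ q :=
        funext fun i => hM _ (Fin.succ_ne_zero i)
      rw [this]
      simp
    rw [fluxDensity, this]
    simp
  have hexp : (List.ofFn A).prod = ∑ r : Fin n → Idx n × Idx n,
      (∏ s, c s (r s)) • (List.ofFn fun s => wedgeLeft (r s).1 * wedgeLeft (r s).2).prod := by
    have := (MultilinearMap.mkPiAlgebraFin ℂ n (FormOp n)).map_sum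
      (fun (s : Fin n) (p : Idx n × Idx n) => c s p • (wedgeLeft p.1 * wedgeLeft p.2))
    rw [MultilinearMap.mkPiAlgebraFin_apply] at this
    rw [hA, this]
    refine Finset.sum_congr rfl fun r _ => ?_
    rw [MultilinearMap.map_smul_univ, MultilinearMap.mkPiAlgebraFin_apply]
  rw [hprod, hexp, mul_comm]
  congr 1
  simp only [LinearMap.sum_apply, LinearMap.smul_apply, map_sum, map_smul, smul_eq_mul,
    topAlt_eq_deltaSign, boundaryDensity]
  rw [← Fintype.sum_prod_type', ← (Equiv.arrowProdEquivProdArrow (Fin n) (fun _ => Idx n)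
    (fun _ => Idx n)).sum_comp]
  refine Finset.sum_congr rfl fun r _ => ?_
  have h0 := Finset.mul_prod_erase Finset.univ (fun s => c s (r s)) (Finset.mem_univ (0 : Fin n))
  have h1 : ∏ s ∈ Finset.univ.erase (0 : Fin n), c s (r s)
      = ∏ s ∈ Finset.univ.erase (0 : Fin n), triangle (r s).1 (r s).2 (fun p => (φ p : ℂ)) q :=
    Finset.prod_congr rfl fun s hs => by simp [hc, Finset.ne_of_mem_erase hs]
  rw [← h0, h1]
  simp only [hc, if_true, Equiv.arrowProdEquivProdArrow_apply]
  ring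

/-! ### Integration along hyperplanes -/

section Flat

variable {E : Type*} [NormedAddCommGroup E] [InnerProductSpace ℝ E] [FiniteDimensional ℝ E]
  [MeasurableSpace E] [BorelSpace E]

/-- The measure on hyperplanes. -/
def surfaceHausdorff (E : Type*) [NormedAddCommGroup E] [InnerProductSpace ℝ E]
    [MeasurableSpace E] [BorelSpace E] : Measure E :=
  Measure.euclideanHausdorffMeasure (Module.finrank ℝ E - 1)

/-- The affine hyperplane through `p` orthogonal to `e`. -/
def hyperplane (p e : E) : Set E := {z | inner ℝ e (z - p) = 0}

/-- Fubini for the orthogonal splitting into the line spanned by `e` and its complement, centred at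
`p`. -/
theorem lintegral_eq_lintegral_orthogonal (p : E) {e : E} (he : ‖e‖ = 1) {H : E → ENNReal}
    (hH : Measurable H) :
    ∫⁻ z, H z = ∫⁻ y : (Submodule.span ℝ {e})ᗮ, ∫⁻ t : ℝ, H (t • e + y + p) := by
  set K := Submodule.span ℝ {e} with hK
  have hmp := (K.measurePreserving_measurableEquivProd p).symm
  rw [InnerProductSpace.euclideanHausdorffMeasure_eq_volume] at hmp
  rw [← hmp.lintegral_comp hH, Measure.volume_eq_prod,
    lintegral_prod_symm' (fun x => H ((K.measurableEquivProd p).symm x))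
      (hH.comp (MeasurableEquiv.measurable _))]
  refine lintegral_congr fun y => ?_
  have hl := (LinearIsometryEquiv.toSpanUnitSingleton (𝕜 := ℝ) e he).measurePreserving
  have := hl.lintegral_comp (f := fun w : K => H ((K.measurableEquivProd p).symm (w, y)))
    (hH.comp ((MeasurableEquiv.measurable _).comp measurable_prodMk_right))
  rw [← this]
  refine lintegral_congr fun t => ?_
  simp

theorem lintegral_hyperplane (p : E) {e : E} (he : ‖e‖ = 1) {H : E → ENNReal}
    (hH : Measurable H) :
    ∫⁻ z in hyperplane p e, H z ∂(surfaceHausdorff E)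
      = ∫⁻ y : (Submodule.span ℝ {e})ᗮ, H (y + p) := by
  set K := Submodule.span ℝ {e} with hK
  have hne : e ≠ 0 := fun h => by simp [h] at he
  have hrank : Module.finrank ℝ Kᗮ = Module.finrank ℝ E - 1 := by
    have h1 := K.finrank_add_finrank_orthogonal
    have h2 : Module.finrank ℝ K = 1 := finrank_span_singleton hne
    omega
  have hiso : Isometry fun y : Kᗮ => (y : E) + p :=
    (IsometryEquiv.addRight p).isometry.comp isometry_subtype_coe
  have hrange : range (fun y : Kᗮ => (y : E) + p) = hyperplane p e := by
    ext z
    constructor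
    · rintro ⟨y, rfl⟩
      have := Submodule.mem_orthogonal_singleton_iff_inner_right.1 y.2
      simpa [hyperplane] using this
    · intro hz
      exact ⟨⟨z - p, Submodule.mem_orthogonal_singleton_iff_inner_right.2 hz⟩, by simp⟩
  rw [surfaceHausdorff, ← hrange, ← hiso.map_euclideanHausdorffMeasure, ← hrank,
    InnerProductSpace.euclideanHausdorffMeasure_eq_volume,
    lintegral_map hH hiso.continuous.measurable]

/-- Approximate identities on the line. -/
theorem tendsto_lintegral_approxIdentity {k : ℕ → ℝ → ENNReal} {δ : ℕ → ℝ} {C : ENNReal}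
    (hk : ∀ j, Measurable (k j)) (hC : C ≠ ⊤) (hint : ∀ j, ∫⁻ t, k j t = C)
    (hsupp : ∀ j t, k j t ≠ 0 → |t| ≤ δ j) (hδ : Tendsto δ atTop (𝓝 0)) {c : ℝ → ℝ}
    (hc : Continuous c) :
    Tendsto (fun j => ∫⁻ t, ENNReal.ofReal (c t) * k j t) atTop (𝓝 (ENNReal.ofReal (c 0) * C)) := by
  rw [ENNReal.tendsto_nhds (ENNReal.mul_ne_top ENNReal.ofReal_ne_top hC)]
  intro ε hε
  obtain ⟨η, hη, hηε⟩ : ∃ η : ℝ, 0 < η ∧ ENNReal.ofReal η * C ≤ ε := by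
    have h0 : Tendsto (fun η : ℝ => ENNReal.ofReal η * C) (𝓝[>] 0) (𝓝 (ENNReal.ofReal 0 * C)) :=
      ENNReal.Tendsto.mul_const
        ((ENNReal.continuous_ofReal.tendsto 0).mono_left nhdsWithin_le_nhds) (Or.inr hC)
    rw [ENNReal.ofReal_zero, zero_mul] at h0
    obtain ⟨η, h1, h2⟩ := ((h0.eventually (gt_mem_nhds hε)).and self_mem_nhdsWithin).exists
    exact ⟨η, h2, h1.le⟩
  obtain ⟨d, hd, hcd⟩ := Metric.continuousAt_iff.1 (hc.continuousAt (x := 0)) η hη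
  filter_upwards [hδ.eventually (gt_mem_nhds hd)] with j hj
  have hclose : ∀ t, k j t ≠ 0 → |c t - c 0| < η := fun t ht => by
    have := hcd (x := t) (by simpa using (hsupp j t ht).trans_lt hj)
    rwa [Real.dist_eq] at this
  have hmul : ∀ a : ENNReal, ∫⁻ t, a * k j t = a * C := fun a => by
    rw [lintegral_const_mul _ (hk j), hint]
  constructor
  · rw [tsub_le_iff_right]
    calc ENNReal.ofReal (c 0) * C = ∫⁻ t, ENNReal.ofReal (c 0) * k j t := (hmul _).symm
      _ ≤ ∫⁻ t, (ENNReal.ofReal (c t) * k j t + ENNReal.ofReal η * k j t) := by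
        refine lintegral_mono fun t => ?_
        by_cases ht : k j t = 0
        · simp [ht]
        · rw [← add_mul]
          gcongr
          refine (ENNReal.ofReal_le_ofReal ?_).trans ENNReal.ofReal_add_le
          linarith [(abs_lt.1 (hclose t ht)).1]
      _ = (∫⁻ t, ENNReal.ofReal (c t) * k j t) + ENNReal.ofReal η * C := by
        rw [lintegral_add_right _ ((hk j).const_mul _), hmul]
      _ ≤ _ := by gcongr
  · have : ∫⁻ t, ENNReal.ofReal (c t) * k j t
        ≤ ∫⁻ t, (ENNReal.ofReal (c 0) * k j t + ENNReal.ofReal η * k j t) := by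
        refine lintegral_mono fun t => ?_
        by_cases ht : k j t = 0
        · simp [ht]
        · rw [← add_mul]
          gcongr
          refine (ENNReal.ofReal_le_ofReal ?_).trans ENNReal.ofReal_add_le
          linarith [(abs_lt.1 (hclose t ht)).2]
    rw [lintegral_add_right _ ((hk j).const_mul _), hmul, hmul] at this
    exact this.trans (by gcongr)

/-- The flat case of the coarea limit: Fubini along normals, the one-dimensional approximate
identity on each normal, and dominated convergence over the hyperplane. -/
theorem tendsto_lintegral_hyperplane (p : E) {e : E} (he : ‖e‖ = 1) {k : ℕ → ℝ → ENNReal}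
    {δ : ℕ → ℝ} {C : ENNReal} (hk : ∀ j, Measurable (k j)) (hC : C ≠ ⊤)
    (hint : ∀ j, ∫⁻ t, k j t = C) (hsupp : ∀ j t, k j t ≠ 0 → |t| ≤ δ j)
    (hδ : Tendsto δ atTop (𝓝 0)) {G : E → ℝ} (hG : Continuous G) (hGc : HasCompactSupport G) :
    Tendsto (fun j => ∫⁻ z, ENNReal.ofReal (G z) * k j (inner ℝ e (z - p))) atTop
      (𝓝 ((∫⁻ z in hyperplane p e, ENNReal.ofReal (G z) ∂(surfaceHausdorff E)) * C)) := by
  have hGm : Measurable fun z => ENNReal.ofReal (G z) := hG.measurable.ennreal_ofReal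
  rw [lintegral_hyperplane p he hGm]
  set K := Submodule.span ℝ {e} with hK
  have hy : ∀ y : Kᗮ, inner ℝ e (y : E) = 0 := fun y =>
    Submodule.mem_orthogonal_singleton_iff_inner_right.1 y.2
  have hee : inner ℝ e e = (1 : ℝ) := by rw [real_inner_self_eq_norm_sq, he, one_pow]
  have hH : ∀ j, Measurable fun z => ENNReal.ofReal (G z) * k j (inner ℝ e (z - p)) := fun j =>
    hGm.mul ((hk j).comp (Continuous.measurable (by fun_prop)))
  have hin : ∀ j, ∫⁻ z, ENNReal.ofReal (G z) * k j (inner ℝ e (z - p))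
      = ∫⁻ y : Kᗮ, ∫⁻ t : ℝ, ENNReal.ofReal (G (t • e + y + p)) * k j t := by
    intro j
    rw [lintegral_eq_lintegral_orthogonal p he (hH j)]
    simp only [add_sub_cancel_right, inner_add_right, inner_smul_right, hy, hee, mul_one, add_zero]
    rfl
  simp only [hin]
  rw [← lintegral_mul_const _ (by fun_prop :
    Measurable fun y : Kᗮ => ENNReal.ofReal (G (y + p)))]
  obtain ⟨M, hM⟩ := hG.bounded_above_of_compact_support hGc
  obtain ⟨R, hR⟩ := hGc.isCompact.isBounded.subset_closedBall p
  -- By Pythagoras a normal based outside the ball of radius `R` misses the support of `G`, so the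
  -- dominating function may be cut off at that ball.
  have hsmall : ∀ (y : Kᗮ) (t : ℝ), R < ‖y‖ → G (t • e + y + p) = 0 := by
    intro y t hyR
    refine image_eq_zero_of_notMem_tsupport fun h => ?_
    have h1 := hR h
    rw [mem_closedBall_iff_norm, add_sub_cancel_right] at h1
    have h2 : ‖t • e + (y : E)‖ ^ 2 = ‖t • e‖ ^ 2 + ‖(y : E)‖ ^ 2 := by
      rw [norm_add_sq_real, inner_smul_left, hy]
      simp
    have h3 : ‖(y : E)‖ ≤ ‖t • e + (y : E)‖ := by
      refine le_of_sq_le_sq ?_ (norm_nonneg _)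
      nlinarith [sq_nonneg ‖t • e‖]
    exact absurd (hyR.trans_le (h3.trans h1)) (lt_irrefl _)
  refine tendsto_lintegral_of_dominated_convergence
    (fun y : Kᗮ => (Metric.closedBall (0 : Kᗮ) R).indicator
      (fun _ => ENNReal.ofReal M * C) y) ?_ ?_ ?_ ?_
  · intro j
    refine Measurable.lintegral_prod_right' (f := fun x : Kᗮ × ℝ =>
      ENNReal.ofReal (G (x.2 • e + x.1 + p)) * k j x.2) ?_
    have h1 : Continuous fun x : Kᗮ × ℝ => G (x.2 • e + x.1 + p) := by fun_prop
    exact h1.measurable.ennreal_ofReal.mul ((hk j).comp measurable_snd)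
  · refine fun j => Eventually.of_forall fun y => ?_
    by_cases hyR : y ∈ Metric.closedBall (0 : Kᗮ) R
    · simp only
      rw [indicator_of_mem hyR, ← hint j, ← lintegral_const_mul _ (hk j)]
      refine lintegral_mono fun t => ?_
      gcongr
      exact (le_abs_self _).trans (hM _)
    · have : ∀ t, G (t • e + y + p) = 0 := fun t => hsmall y t (by simpa using hyR)
      simp [this]
  · rw [lintegral_indicator_const measurableSet_closedBall]
    exact ENNReal.mul_ne_top (ENNReal.mul_ne_top ENNReal.ofReal_ne_top hC)
      (isCompact_closedBall _ _).measure_ne_top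
  · refine Eventually.of_forall fun y => ?_
    have := tendsto_lintegral_approxIdentity hk hC hint hsupp hδ (c := fun t => G (t • e + y + p))
      (by fun_prop)
    simpa using this

end Flat

end QuatMA

namespace QuatMA

open Filter Topology
open scoped NNReal

/-! ### Flattening a hypersurface by a nearly isometric map -/

section Bilipschitz

theorem lintegral_eq_setLIntegral {α : Type*} [MeasurableSpace α] {W : Set α}
    (hW : MeasurableSet W) {μ : Measure α} {h : α → ENNReal} (h0 : ∀ x ∉ W, h x = 0) :
    ∫⁻ x, h x ∂μ = ∫⁻ x in W, h x ∂μ := by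
  rw [← lintegral_indicator hW]
  refine lintegral_congr fun x => ?_
  by_cases hx : x ∈ W
  · rw [indicator_of_mem hx]
  · rw [indicator_of_notMem hx, h0 x hx]

variable {E : Type*} [NormedAddCommGroup E]

section Hausdorff

variable [MeasurableSpace E] [BorelSpace E]

theorem euclideanHausdorffMeasure_image_le {K : ℝ≥0} {f : E → E} {s : Set E}
    (h : LipschitzOnWith K f s) (d : ℕ) :
    (Measure.euclideanHausdorffMeasure d : Measure E) (f '' s)
      ≤ (K : ENNReal) ^ d * (Measure.euclideanHausdorffMeasure d : Measure E) s := by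
  simp only [Measure.euclideanHausdorffMeasure_def, Measure.smul_apply]
  have := h.hausdorffMeasure_image_le (d := d) (by positivity)
  rw [ENNReal.rpow_natCast] at this
  rw [ENNReal.smul_def, ENNReal.smul_def, smul_eq_mul, smul_eq_mul, mul_left_comm]
  gcongr

/-- Change of variables inequalities for a bilipschitz map. -/
theorem lintegral_comp_le_of_lipschitz {K : ℝ≥0} {f g : E → E} {W : Set E}
    (hf : Continuous f) (hl : LipschitzOnWith K f W)
    (hg : LipschitzOnWith K g (f '' W)) (hgf : ∀ x ∈ W, g (f x) = x) (d : ℕ) {G : E → ENNReal}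
    (hG : Measurable G) :
    (∫⁻ x in W, G (f x) ∂(Measure.euclideanHausdorffMeasure d)
      ≤ (K : ENNReal) ^ d * ∫⁻ z in f '' W, G z ∂(Measure.euclideanHausdorffMeasure d)) ∧
    ∫⁻ z in f '' W, G z ∂(Measure.euclideanHausdorffMeasure d)
      ≤ (K : ENNReal) ^ d * ∫⁻ x in W, G (f x) ∂(Measure.euclideanHausdorffMeasure d) := by
  set κ : Measure E := Measure.euclideanHausdorffMeasure d with hκ
  have himg : ∀ B : Set E, f '' (W ∩ f ⁻¹' B) = B ∩ f '' W := fun B => by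
    rw [image_inter_preimage, inter_comm]
  have h1 : (κ.restrict W).map f ≤ ((K : ENNReal) ^ d) • κ.restrict (f '' W) := by
    refine Measure.le_iff.2 fun B hB => ?_
    rw [Measure.map_apply hf.measurable hB, Measure.restrict_apply (hf.measurable hB),
      Measure.smul_apply, Measure.restrict_apply hB, smul_eq_mul, inter_comm]
    have h2 : W ∩ f ⁻¹' B = g '' (B ∩ f '' W) := by
      rw [← himg, image_image]
      ext x
      constructor
      · exact fun hx => ⟨x, hx, hgf x hx.1⟩
      · rintro ⟨y, hy, rfl⟩
        change g (f y) ∈ _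
        rwa [hgf y hy.1]
    rw [h2]
    exact euclideanHausdorffMeasure_image_le (hg.mono inter_subset_right) d
  have h2 : κ.restrict (f '' W) ≤ ((K : ENNReal) ^ d) • (κ.restrict W).map f := by
    refine Measure.le_iff.2 fun B hB => ?_
    rw [Measure.smul_apply, Measure.map_apply hf.measurable hB,
      Measure.restrict_apply (hf.measurable hB), Measure.restrict_apply hB, smul_eq_mul, ← himg,
      inter_comm (f ⁻¹' B)]
    exact euclideanHausdorffMeasure_image_le (hl.mono inter_subset_left) d
  rw [← lintegral_map hG hf.measurable]
  constructor
  · refine (lintegral_mono' h1 le_rfl).trans_eq ?_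
    rw [lintegral_smul_measure, smul_eq_mul]
  · refine (lintegral_mono' h2 le_rfl).trans_eq ?_
    rw [lintegral_smul_measure, smul_eq_mul]

end Hausdorff

theorem exists_extension_of_openPartialHomeomorph (P : OpenPartialHomeomorph E E) {F : E → ℝ}
    (hF : Continuous F) (hc : HasCompactSupport F) (hs : tsupport F ⊆ P.source) :
    ∃ G : E → ℝ, Continuous G ∧ HasCompactSupport G ∧ (∀ x ∈ P.source, G (P x) = F x) ∧
      ∀ z ∉ P.target, G z = 0 := by
  classical
  set G : E → ℝ := P.target.indicator (F ∘ P.symm) with hG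
  have hK : IsCompact (P '' tsupport F) := hc.isCompact.image_of_continuousOn (P.continuousOn.mono hs)
  have hKt : P '' tsupport F ⊆ P.target := by
    rintro _ ⟨x, hx, rfl⟩
    exact P.map_source (hs hx)
  have hsub : tsupport G ⊆ P '' tsupport F := by
    refine closure_minimal (fun z hz => ?_) hK.isClosed
    rw [hG, support_indicator] at hz
    exact ⟨P.symm z, subset_tsupport _ hz.2, P.right_inv hz.1⟩
  refine ⟨G, ?_, hK.of_isClosed_subset (isClosed_tsupport _) hsub, fun x hx => ?_,
    fun z hz => indicator_of_notMem hz _⟩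
  · refine continuous_of_tsupport fun z hz => ?_
    have hzt : z ∈ P.target := hKt (hsub hz)
    have : ContinuousAt (F ∘ P.symm) z := hF.continuousAt.comp (P.continuousAt_symm hzt)
    refine this.congr ?_
    filter_upwards [P.open_target.mem_nhds hzt] with y hy using (indicator_of_mem hy _).symm
  · rw [hG, indicator_of_mem (P.map_source hx)]
    simp [P.left_inv hx]

variable [InnerProductSpace ℝ E] [FiniteDimensional ℝ E]

/-- The normal coordinate of `x` is replaced by the rescaled value of `φ - r`, and the tangential
ones are kept. The derivative at `p` is the identity, so near `p` the map is bilipschitz with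
constant as close to 1 as desired, while {φ = r} goes exactly into a hyperplane. -/
theorem exists_flattening {φ : E → ℝ} (hφ : ContDiff ℝ 1 φ) {p : E}
    (hg : gradient φ p ≠ 0) (r : ℝ) {L : ℝ≥0} (hL : 1 < L) :
    ∃ P : OpenPartialHomeomorph E E, p ∈ P.source ∧ Continuous P ∧
      LipschitzOnWith L P P.source ∧ LipschitzOnWith L P.symm P.target ∧
      ∀ x, inner ℝ (‖gradient φ p‖⁻¹ • gradient φ p) (P x - p) = ‖gradient φ p‖⁻¹ * (φ x - r) := by
  set a := ‖gradient φ p‖ with ha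
  have ha0 : 0 < a := norm_pos_iff.2 hg
  set e := a⁻¹ • gradient φ p with he
  have hee : inner ℝ e e = (1 : ℝ) := by
    rw [real_inner_self_eq_norm_sq, he, norm_smul, norm_inv, norm_norm, inv_mul_cancel₀ ha0.ne',
      one_pow]
  set Ψ : E → E := fun x => x + (a⁻¹ * (φ x - r) - inner ℝ e (x - p)) • e with hΨ
  have hΨd : HasStrictFDerivAt Ψ (ContinuousLinearMap.id ℝ E) p := by
    have h1 : HasStrictFDerivAt φ (fderiv ℝ φ p) p :=
      hφ.contDiffAt.hasStrictFDerivAt one_ne_zero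
    have h2 : HasStrictFDerivAt (fun x => inner ℝ e (x - p)) (innerSL ℝ e) p := by
      have : (fun x => inner ℝ e (x - p)) = fun x => innerSL ℝ e x - inner ℝ e p := by
        ext x
        rw [inner_sub_right, innerSL_apply_apply]
      rw [this]
      exact (innerSL ℝ e).hasStrictFDerivAt.sub_const _
    have h3 := (hasStrictFDerivAt_id p).add
      ((((h1.sub_const r).const_mul a⁻¹).sub h2).smul_const e)
    have h4 : a⁻¹ • fderiv ℝ φ p = innerSL ℝ e := by
      ext v
      have : inner ℝ (gradient φ p) v = fderiv ℝ φ p v := by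
        rw [gradient, InnerProductSpace.toDual_symm_apply]
      simp [he, this]
    rw [h4, sub_self] at h3
    convert h3 using 1
    · ext v
      simp [hΨ]
    · ext v
      simp
  have hLinv : L⁻¹ < 1 := inv_lt_one_of_one_lt₀ hL
  -- The map distorts distances by factors between `1 - δ` and `1 + δ`; here `1 - δ = L⁻¹`, and `1 +
  -- δ ≤ L` because `L + L⁻¹ ≥ 2`.
  set δ : ℝ≥0 := 1 - L⁻¹ with hδ
  have hδ0 : 0 < δ := tsub_pos_of_lt hLinv
  have hδr : (δ : ℝ) = 1 - (L : ℝ)⁻¹ := by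
    rw [hδ, NNReal.coe_sub hLinv.le]
    simp
  have hL0 : (0 : ℝ) < L := lt_trans one_pos (by exact_mod_cast hL)
  obtain ⟨s, hs, hsa⟩ := hΨd.approximates_deriv_on_nhds (c := δ) (Or.inr hδ0)
  obtain ⟨W, hWs, hW, hpW⟩ := mem_nhds_iff.1 hs
  have happ : ApproximatesLinearOn Ψ
      ((ContinuousLinearEquiv.refl ℝ E : E ≃L[ℝ] E) : E →L[ℝ] E) W δ := hsa.mono_set hWs
  have hE : Nontrivial E := ⟨⟨gradient φ p, 0, hg⟩⟩
  have hδ1 : δ < ‖((ContinuousLinearEquiv.refl ℝ E).symm : E →L[ℝ] E)‖₊⁻¹ := by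
    have : ‖((ContinuousLinearEquiv.refl ℝ E).symm : E →L[ℝ] E)‖₊ = 1 := by
      have h := ContinuousLinearMap.norm_id (𝕜 := ℝ) (E := E)
      exact NNReal.eq h
    rw [this, inv_one, hδ]
    exact tsub_lt_self one_pos (by positivity)
  have hnorm : ∀ x ∈ W, ∀ y ∈ W, ‖Ψ x - Ψ y - (x - y)‖ ≤ δ * ‖x - y‖ := fun x hx y hy =>
    happ x hx y hy
  refine ⟨happ.toOpenPartialHomeomorph Ψ W (Or.inr hδ1) hW, hpW, ?_, ?_, ?_, ?_⟩
  · change Continuous Ψ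
    have := hφ.continuous
    fun_prop
  · refine lipschitzOnWith_iff_norm_sub_le.2 fun x hx y hy => ?_
    change ‖Ψ x - Ψ y‖ ≤ _
    have h1 := hnorm x hx y hy
    have h2 : ‖Ψ x - Ψ y‖ ≤ ‖Ψ x - Ψ y - (x - y)‖ + ‖x - y‖ := by
      simpa using norm_add_le (Ψ x - Ψ y - (x - y)) (x - y)
    have h3 : (1 + δ : ℝ) ≤ L := by
      have h4 : (L : ℝ) * (L : ℝ)⁻¹ = 1 := mul_inv_cancel₀ hL0.ne'
      have h5 : (L : ℝ)⁻¹ < 1 := by exact_mod_cast hLinv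
      have h6 : (0 : ℝ) < (L : ℝ)⁻¹ := by positivity
      have h7 : (1 : ℝ) < L := by exact_mod_cast hL
      rw [hδr]
      nlinarith
    nlinarith [norm_nonneg (x - y)]
  · refine lipschitzOnWith_iff_norm_sub_le.2 fun z hz w hw => ?_
    set P := happ.toOpenPartialHomeomorph Ψ W (Or.inr hδ1) hW with hP
    have hx := P.map_target hz
    have hy := P.map_target hw
    have h1 := hnorm _ hx _ hy
    have hzx : Ψ (P.symm z) = z := P.right_inv hz
    have hwy : Ψ (P.symm w) = w := P.right_inv hw
    rw [hzx, hwy] at h1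
    have h2 : ‖P.symm z - P.symm w‖ ≤ ‖z - w - (P.symm z - P.symm w)‖ + ‖z - w‖ := by
      have := norm_sub_le (z - w) (z - w - (P.symm z - P.symm w))
      rw [sub_sub_cancel] at this
      linarith
    rw [hδr] at h1
    have h3 : (L : ℝ)⁻¹ * ‖P.symm z - P.symm w‖ ≤ ‖z - w‖ := by linarith
    rwa [inv_mul_le_iff₀ hL0] at h3
  · intro x
    change inner ℝ e (Ψ x - p) = _
    rw [hΨ]
    simp only
    rw [add_sub_right_comm, inner_add_right, inner_smul_right, hee]
    ring

theorem lintegral_comp_add_mul {a : ℝ} (ha : 0 < a) (r : ℝ) {k : ℝ → ENNReal} (hk : Measurable k) :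
    ∫⁻ t, k (r + a * t) = ENNReal.ofReal a⁻¹ * ∫⁻ t, k t := by
  have h1 : ∫⁻ t, k (r + a * t) = ∫⁻ t, k (r + t) ∂(Measure.map (a * ·) volume) := by
    rw [lintegral_map (f := fun t => k (r + t)) (hk.comp (measurable_const_add r))
      (measurable_const_mul a)]
  rw [h1, Real.map_volume_mul_left ha.ne', lintegral_smul_measure, smul_eq_mul,
    abs_of_pos (inv_pos.2 ha), lintegral_add_left_eq_self]

variable [MeasurableSpace E] [BorelSpace E]

/-- A localized and approximate version of the coarea formula at a regular level: averages over
shrinking one-sided neighbourhoods of the level set compare with surface integrals. -/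
theorem exists_nhds_coarea {φ : E → ℝ} (hφ : ContDiff ℝ 1 φ) {p : E} {r : ℝ}
    (hg : gradient φ p ≠ 0) {c : ℝ≥0} (hc : 1 < c) :
    ∃ W, IsOpen W ∧ p ∈ W ∧ ∀ F : E → ℝ, Continuous F → HasCompactSupport F → tsupport F ⊆ W →
      ∀ (k : ℕ → ℝ → ENNReal) (δ : ℕ → ℝ), (∀ j, Measurable (k j)) → (∀ j, ∫⁻ t, k j t = 1) →
      (∀ j t, k j t ≠ 0 → |t - r| ≤ δ j) → Tendsto δ atTop (𝓝 0) → ∀ ℓ,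
      Tendsto (fun j => ∫⁻ x, ENNReal.ofReal (F x) * k j (φ x)) atTop (𝓝 ℓ) →
      ℓ ≤ c * ∫⁻ x in {x | φ x = r}, ENNReal.ofReal (F x) * ENNReal.ofReal ‖gradient φ x‖⁻¹
        ∂(surfaceHausdorff E) ∧
      ∫⁻ x in {x | φ x = r}, ENNReal.ofReal (F x) * ENNReal.ofReal ‖gradient φ x‖⁻¹
        ∂(surfaceHausdorff E) ≤ c * ℓ := by
  set N := Module.finrank ℝ E with hN
  have hE : Nontrivial E := ⟨⟨gradient φ p, 0, hg⟩⟩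
  have hN1 : N - 1 + 1 = N := Nat.succ_pred_eq_of_pos Module.finrank_pos
  -- The total loss is `L ^ N` for volumes, `L ^ (N - 1)` for surface measure and `L` for the
  -- oscillation of the gradient norm.
  obtain ⟨L, hL, hLc⟩ : ∃ L : ℝ≥0, 1 < L ∧ L ^ (2 * N) ≤ c := by
    have h1 : Tendsto (fun L : ℝ≥0 => L ^ (2 * N)) (𝓝[>] 1) (𝓝 (1 ^ (2 * N))) :=
      ((continuous_pow (2 * N)).tendsto 1).mono_left nhdsWithin_le_nhds
    rw [one_pow] at h1
    obtain ⟨L, h2, h3⟩ := ((h1.eventually (gt_mem_nhds hc)).and self_mem_nhdsWithin).exists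
    exact ⟨L, h3, h2.le⟩
  obtain ⟨P, hpP, hPc, hPl, hPs, hPφ⟩ := exists_flattening hφ hg r hL
  set a := ‖gradient φ p‖ with ha
  have ha0 : 0 < a := norm_pos_iff.2 hg
  set e := a⁻¹ • gradient φ p with he
  have he1 : ‖e‖ = 1 := by rw [he, norm_smul, norm_inv, norm_norm, inv_mul_cancel₀ ha0.ne']
  have hL0 : (0 : ℝ) < L := lt_trans one_pos (by exact_mod_cast hL)
  have hgc : Continuous fun x => ‖gradient φ x‖ :=
    ((InnerProductSpace.toDual ℝ E).symm.continuous.comp (hφ.continuous_fderiv one_ne_zero)).norm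
  set W₀ : Set E := {x | L⁻¹ * a < ‖gradient φ x‖ ∧ ‖gradient φ x‖ < L * a} with hW₀
  have hW₀o : IsOpen W₀ :=
    (isOpen_lt continuous_const hgc).inter (isOpen_lt hgc continuous_const)
  have hL1 : (1 : ℝ) < L := by exact_mod_cast hL
  have hpW₀ : p ∈ W₀ := by
    have h2 : (L : ℝ)⁻¹ < 1 := inv_lt_one_of_one_lt₀ hL1
    constructor
    · rw [NNReal.coe_inv]
      nlinarith
    · nlinarith
  refine ⟨P.source ∩ W₀, P.open_source.inter hW₀o, ⟨hpP, hpW₀⟩, ?_⟩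
  intro F hF hFc hFs k δ hk hk1 hkδ hδ ℓ hℓ
  have hFW : ∀ x ∉ P.source ∩ W₀, F x = 0 := fun x hx =>
    image_eq_zero_of_notMem_tsupport fun h => hx (hFs h)
  have hF0 : ∀ x ∉ P.source, F x = 0 := fun x hx => hFW x fun h => hx h.1
  obtain ⟨G, hG, hGc, hGF, hG0⟩ := exists_extension_of_openPartialHomeomorph P hF hFc
    (hFs.trans inter_subset_left)
  have hrk : ∀ x, r + a * inner ℝ e (P x - p) = φ x := fun x => by
    rw [hPφ, mul_inv_cancel_left₀ ha0.ne']
    ring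
  have hkm : ∀ j, Measurable fun t => k j (r + a * t) := fun j => (hk j).comp (by fun_prop)
  -- In the flat coordinate `φ` equals `r + a * t`, and rescaling the kernel produces the factor `1
  -- / |∇φ|` frozen at `p`.
  have hkint : ∀ j, ∫⁻ t, k j (r + a * t) = ENNReal.ofReal a⁻¹ := fun j => by
    rw [lintegral_comp_add_mul ha0 r (hk j), hk1, mul_one]
  set J : ℕ → ENNReal := fun j => ∫⁻ z, ENNReal.ofReal (G z) * k j (r + a * inner ℝ e (z - p))
    with hJ
  set S : ENNReal := ∫⁻ z in hyperplane p e, ENNReal.ofReal (G z) ∂(surfaceHausdorff E) with hS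
  have hJlim : Tendsto J atTop (𝓝 (S * ENNReal.ofReal a⁻¹)) := by
    refine tendsto_lintegral_hyperplane p he1 (δ := fun j => a⁻¹ * δ j) hkm ENNReal.ofReal_ne_top
      hkint (fun j t ht => ?_) ?_ hG hGc
    · have := hkδ j _ ht
      rw [add_sub_cancel_left, abs_mul, abs_of_pos ha0] at this
      rwa [le_inv_mul_iff₀ ha0]
    · simpa using hδ.const_mul a⁻¹
  have himg : P '' P.source = P.target := P.image_source_eq_target
  have hsymm : ∀ x ∈ P.source, P.symm (P x) = x := fun x hx => P.left_inv hx
  have hcomp := fun (d : ℕ) (H : E → ENNReal) (hH : Measurable H) =>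
    lintegral_comp_le_of_lipschitz hPc hPl (himg.symm ▸ hPs) hsymm d hH
  rw [himg] at hcomp
  have hvol : (Measure.euclideanHausdorffMeasure N : Measure E) = volume :=
    InnerProductSpace.euclideanHausdorffMeasure_eq_volume
  have hIJ : ∀ j, (∫⁻ x, ENNReal.ofReal (F x) * k j (φ x) ≤ (L : ENNReal) ^ N * J j) ∧
      J j ≤ (L : ENNReal) ^ N * ∫⁻ x, ENNReal.ofReal (F x) * k j (φ x) := by
    intro j
    have h1 := hcomp N (fun z => ENNReal.ofReal (G z) * k j (r + a * inner ℝ e (z - p)))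
      (hG.measurable.ennreal_ofReal.mul ((hk j).comp (Continuous.measurable (by fun_prop))))
    rw [hvol] at h1
    have h2 : ∫⁻ x, ENNReal.ofReal (F x) * k j (φ x)
        = ∫⁻ x in P.source, ENNReal.ofReal (G (P x)) * k j (r + a * inner ℝ e (P x - p)) := by
      rw [lintegral_eq_setLIntegral P.open_source.measurableSet fun x hx => by simp [hF0 x hx]]
      refine setLIntegral_congr_fun P.open_source.measurableSet fun x hx => ?_
      simp only [hGF x hx, hrk]
    have h3 : J j = ∫⁻ z in P.target, ENNReal.ofReal (G z) * k j (r + a * inner ℝ e (z - p)) :=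
      lintegral_eq_setLIntegral P.open_target.measurableSet fun z hz => by simp [hG0 z hz]
    rwa [← h2, ← h3] at h1
  set T : ENNReal := ∫⁻ x in P.source, (hyperplane p e).indicator
    (fun z => ENNReal.ofReal (G z)) (P x) ∂(surfaceHausdorff E) with hT
  have hhm : MeasurableSet (hyperplane p e) :=
    (isClosed_eq (by fun_prop) continuous_const).measurableSet
  have hST : T ≤ (L : ENNReal) ^ (N - 1) * S ∧ S ≤ (L : ENNReal) ^ (N - 1) * T := by
    have h1 := hcomp (N - 1) ((hyperplane p e).indicator fun z => ENNReal.ofReal (G z))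
      (hG.measurable.ennreal_ofReal.indicator hhm)
    have h3 : S = ∫⁻ z in P.target, (hyperplane p e).indicator (fun z => ENNReal.ofReal (G z)) z
        ∂(surfaceHausdorff E) := by
      rw [hS, ← lintegral_indicator hhm]
      refine lintegral_eq_setLIntegral P.open_target.measurableSet fun z hz => ?_
      by_cases hzh : z ∈ hyperplane p e
      · simp [hzh, hG0 z hz]
      · simp [hzh]
    rwa [h3]
  have hmem : ∀ x, P x ∈ hyperplane p e ↔ φ x = r := fun x => by
    rw [hyperplane, mem_ofPred_eq, hPφ, mul_eq_zero, inv_eq_zero, sub_eq_zero]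
    simp [ha0.ne']
  set R : ENNReal := ∫⁻ x in {x | φ x = r}, ENNReal.ofReal (F x)
    * ENNReal.ofReal ‖gradient φ x‖⁻¹ ∂(surfaceHausdorff E) with hR
  have hlm : MeasurableSet {x | φ x = r} :=
    (isClosed_eq hφ.continuous continuous_const).measurableSet
  have hRe : R = ∫⁻ x in P.source, (hyperplane p e).indicator (fun z => ENNReal.ofReal (G z)) (P x)
      * ENNReal.ofReal ‖gradient φ x‖⁻¹ ∂(surfaceHausdorff E) := by
    rw [hR, ← lintegral_indicator hlm, lintegral_eq_setLIntegral P.open_source.measurableSet]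
    · refine setLIntegral_congr_fun P.open_source.measurableSet fun x hx => ?_
      by_cases hxr : φ x = r
      · have h1 : P x ∈ hyperplane p e := (hmem x).2 hxr
        rw [indicator_of_mem (show x ∈ {x | φ x = r} from hxr), indicator_of_mem h1, hGF x hx]
      · have h1 : P x ∉ hyperplane p e := fun h => hxr ((hmem x).1 h)
        rw [indicator_of_notMem (show x ∉ {x | φ x = r} from hxr), indicator_of_notMem h1, zero_mul]
    · intro x hx
      simp [indicator, hF0 x hx]
  have hzero : ∀ x ∈ P.source, x ∉ W₀ →
      (hyperplane p e).indicator (fun z => ENNReal.ofReal (G z)) (P x) = 0 := by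
    intro x hx hx0
    have : G (P x) = 0 := by rw [hGF x hx, hFW x fun h => hx0 h.2]
    simp [indicator, this]
  have hgm : Measurable fun x => (hyperplane p e).indicator (fun z => ENNReal.ofReal (G z)) (P x) :=
    (hG.measurable.ennreal_ofReal.indicator hhm).comp hPc.measurable
  have hLE : ENNReal.ofReal (L : ℝ) = (L : ENNReal) := ENNReal.ofReal_coe_nnreal
  have hRT : R ≤ (L * ENNReal.ofReal a⁻¹) * T ∧ ENNReal.ofReal a⁻¹ * T ≤ L * R := by
    rw [hRe, hT, ← lintegral_const_mul _ hgm, ← lintegral_const_mul _ hgm,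
      ← lintegral_const_mul' _ _ ENNReal.coe_ne_top]
    constructor
    · refine setLIntegral_mono' P.open_source.measurableSet fun x hx => ?_
      by_cases hx0 : x ∈ W₀
      · rw [mul_comm]
        gcongr
        rw [← hLE, ← ENNReal.ofReal_mul hL0.le]
        refine ENNReal.ofReal_le_ofReal ?_
        have h1 := hx0.1
        rw [NNReal.coe_inv] at h1
        have h2 : ((L : ℝ)⁻¹ * a)⁻¹ = L * a⁻¹ := by rw [mul_inv, inv_inv]
        rw [← h2]
        exact inv_anti₀ (by positivity) h1.le
      · rw [hzero x hx hx0, zero_mul, mul_zero]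
    · refine setLIntegral_mono' P.open_source.measurableSet fun x hx => ?_
      by_cases hx0 : x ∈ W₀
      · rw [mul_left_comm, mul_comm]
        gcongr
        rw [← hLE, ← ENNReal.ofReal_mul hL0.le]
        refine ENNReal.ofReal_le_ofReal ?_
        have h0 : 0 < ‖gradient φ x‖ := lt_trans (by positivity) hx0.1
        rw [← div_eq_mul_inv, le_div_iff₀ h0, inv_mul_le_iff₀ ha0, mul_comm a]
        exact hx0.2.le
      · rw [hzero x hx hx0]
        simp
  have hpow : (L : ENNReal) ^ N * ((L : ENNReal) ^ (N - 1) * L) ≤ c := by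
    rw [← pow_succ, hN1, ← pow_add, ← two_mul]
    exact_mod_cast hLc
  have hLN : ((L : ENNReal) ^ N) ≠ ⊤ := ENNReal.pow_ne_top ENNReal.coe_ne_top
  constructor
  · calc ℓ ≤ (L : ENNReal) ^ N * (S * ENNReal.ofReal a⁻¹) :=
        le_of_tendsto_of_tendsto' hℓ (ENNReal.Tendsto.const_mul hJlim (Or.inr hLN))
          fun j => (hIJ j).1
      _ ≤ (L : ENNReal) ^ N * (((L : ENNReal) ^ (N - 1) * T) * ENNReal.ofReal a⁻¹) := by
        gcongr
        exact hST.2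
      _ = (L : ENNReal) ^ N * ((L : ENNReal) ^ (N - 1) * (ENNReal.ofReal a⁻¹ * T)) := by ring
      _ ≤ (L : ENNReal) ^ N * ((L : ENNReal) ^ (N - 1) * (L * R)) := by
        gcongr (L : ENNReal) ^ N * ((L : ENNReal) ^ (N - 1) * ?_)
        exact hRT.2
      _ = (L : ENNReal) ^ N * ((L : ENNReal) ^ (N - 1) * L) * R := by ring
      _ ≤ c * R := by gcongr
  · calc R ≤ (L * ENNReal.ofReal a⁻¹) * T := hRT.1
      _ ≤ (L * ENNReal.ofReal a⁻¹) * ((L : ENNReal) ^ (N - 1) * S) := by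
        gcongr
        exact hST.1
      _ = ((L : ENNReal) ^ (N - 1) * L) * (S * ENNReal.ofReal a⁻¹) := by ring
      _ ≤ ((L : ENNReal) ^ (N - 1) * L) * ((L : ENNReal) ^ N * ℓ) := by
        gcongr ((L : ENNReal) ^ (N - 1) * L) * ?_
        exact le_of_tendsto_of_tendsto' hJlim (ENNReal.Tendsto.const_mul hℓ (Or.inr hLN))
          fun j => (hIJ j).2
      _ = (L : ENNReal) ^ N * ((L : ENNReal) ^ (N - 1) * L) * ℓ := by ring
      _ ≤ c * ℓ := by gcongr

end Bilipschitz

/-! ### Smooth approximations of `max t r` -/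

/-- A smooth approximation of the indicator function of `[r, ∞)`. -/
def stepFn (r : ℝ) (j : ℕ) (t : ℝ) : ℝ := Real.smoothTransition ((j + 1) * (t - r) + 1)

/-- The primitive of `stepFn r j` that agrees with the identity on `[r, ∞)`. -/
def stepPrim (r : ℝ) (j : ℕ) (t : ℝ) : ℝ := r + ∫ s in r..t, stepFn r j s

/-- The derivative of the `n`-th power of `stepFn r j`. -/
def stepDensity (n : ℕ) (r : ℝ) (j : ℕ) (t : ℝ) : ℝ :=
  n * stepFn r j t ^ (n - 1) * deriv (stepFn r j) t

section Step

variable (r : ℝ) (j : ℕ)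

theorem contDiff_stepFn : ContDiff ℝ ∞ (stepFn r j) :=
  Real.smoothTransition.contDiff.comp (by fun_prop)

theorem stepFn_nonneg (t : ℝ) : 0 ≤ stepFn r j t := Real.smoothTransition.nonneg _

theorem stepFn_le_one (t : ℝ) : stepFn r j t ≤ 1 := Real.smoothTransition.le_one _

/-- The transition lies entirely to the left of `r`, so the functions converge pointwise to the
indicator of the closed half-line, matching the complement of the open sublevel set even on the
level itself. -/
theorem stepFn_eq_one {t : ℝ} (ht : r ≤ t) : stepFn r j t = 1 := by
  refine Real.smoothTransition.one_of_one_le ?_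
  have : (0 : ℝ) ≤ (j + 1) * (t - r) := mul_nonneg (by positivity) (by linarith)
  linarith

theorem stepFn_eq_zero {t : ℝ} (ht : t ≤ r - 1 / (j + 1)) : stepFn r j t = 0 := by
  refine Real.smoothTransition.zero_of_nonpos ?_
  have hj : (0 : ℝ) < j + 1 := by positivity
  have : (j + 1 : ℝ) * (t - r) ≤ (j + 1) * (-(1 / (j + 1))) :=
    mul_le_mul_of_nonneg_left (by linarith) hj.le
  rw [mul_neg, mul_one_div_cancel hj.ne'] at this
  linarith

theorem monotone_stepFn : Monotone (stepFn r j) := fun s t h =>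
  Real.smoothTransition.monotone (by gcongr)

theorem hasDerivAt_stepFn (t : ℝ) : HasDerivAt (stepFn r j) (deriv (stepFn r j) t) t :=
  ((contDiff_stepFn r j).differentiable (by simp) t).hasDerivAt

theorem deriv_stepFn_nonneg (t : ℝ) : 0 ≤ deriv (stepFn r j) t :=
  (monotone_stepFn r j).deriv_nonneg

theorem hasDerivAt_stepPrim (t : ℝ) : HasDerivAt (stepPrim r j) (stepFn r j t) t :=
  ((contDiff_stepFn r j).continuous.integral_hasStrictDerivAt r t).hasDerivAt.const_add r

theorem contDiff_stepPrim : ContDiff ℝ ∞ (stepPrim r j) := by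
  refine contDiff_infty_iff_deriv.2 ⟨fun t => (hasDerivAt_stepPrim r j t).differentiableAt, ?_⟩
  rw [funext fun t => (hasDerivAt_stepPrim r j t).deriv]
  exact contDiff_stepFn r j

/-- To the right of `r` the two functions agree. To the left their difference is an integral of
`stepFn`, at most 1 and supported on an interval of length `1 / (j + 1)`. -/
theorem abs_stepPrim_sub_max_le (t : ℝ) : |stepPrim r j t - max t r| ≤ 1 / (j + 1) := by
  have hj : (0 : ℝ) < 1 / (j + 1) := by positivity
  have hi : ∀ a b, IntervalIntegrable (stepFn r j) volume a b := fun a b =>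
    (contDiff_stepFn r j).continuous.intervalIntegrable a b
  rcases le_total r t with h | h
  · have : ∫ s in r..t, stepFn r j s = ∫ s in r..t, (1 : ℝ) :=
      intervalIntegral.integral_congr fun s hs => by
        rw [uIcc_of_le h] at hs
        exact stepFn_eq_one r j hs.1
    rw [stepPrim, this, max_eq_left h, intervalIntegral.integral_const, smul_eq_mul, mul_one,
      add_sub_cancel, sub_self, abs_zero]
    exact hj.le
  · rw [stepPrim, max_eq_right h, intervalIntegral.integral_symm, add_sub_cancel_left, abs_neg,
      abs_of_nonneg (intervalIntegral.integral_nonneg h fun s _ => stepFn_nonneg r j s)]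
    have key : ∀ a, r - 1 / (j + 1) ≤ a → a ≤ r → ∫ s in a..r, stepFn r j s ≤ 1 / (j + 1) := by
      intro a h1 h2
      calc ∫ s in a..r, stepFn r j s ≤ ∫ s in a..r, (1 : ℝ) :=
            intervalIntegral.integral_mono_on h2 (hi _ _) (by simp) fun s _ => stepFn_le_one r j s
        _ ≤ _ := by
            rw [intervalIntegral.integral_const, smul_eq_mul, mul_one]
            linarith
    rcases le_total (r - 1 / (j + 1)) t with h' | h'
    · exact key t h' h
    · rw [← intervalIntegral.integral_add_adjacent_intervals (hi t (r - 1 / (j + 1))) (hi _ r)]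
      have : ∫ s in t..(r - 1 / (j + 1)), stepFn r j s = ∫ s in t..(r - 1 / (j + 1)), (0 : ℝ) :=
        intervalIntegral.integral_congr fun s hs => by
          rw [uIcc_of_le h'] at hs
          exact stepFn_eq_zero r j hs.2
      rw [this]
      simpa using key _ le_rfl (by linarith)

theorem stepDensity_nonneg (n : ℕ) (t : ℝ) : 0 ≤ stepDensity n r j t :=
  mul_nonneg (mul_nonneg (by positivity) (pow_nonneg (stepFn_nonneg r j t) _))
    (deriv_stepFn_nonneg r j t)

theorem continuous_stepDensity (n : ℕ) : Continuous (stepDensity n r j) :=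
  (continuous_const.mul ((contDiff_stepFn r j).continuous.pow _)).mul
    ((contDiff_stepFn r j).continuous_deriv (by simp))

theorem stepDensity_eq_zero {n : ℕ} {t : ℝ} (h : t < r - 1 / (j + 1) ∨ r < t) :
    stepDensity n r j t = 0 := by
  have : deriv (stepFn r j) t = 0 := by
    rcases h with h | h
    · have : stepFn r j =ᶠ[𝓝 t] fun _ => 0 := by
        filter_upwards [Iio_mem_nhds h] with s hs using stepFn_eq_zero r j (le_of_lt hs)
      rw [this.deriv_eq, deriv_const]
    · have : stepFn r j =ᶠ[𝓝 t] fun _ => 1 := by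
        filter_upwards [Ioi_mem_nhds h] with s hs using stepFn_eq_one r j (le_of_lt hs)
      rw [this.deriv_eq, deriv_const]
  rw [stepDensity, this, mul_zero]

theorem abs_sub_le_of_stepDensity_ne_zero {n : ℕ} {t : ℝ} (h : stepDensity n r j t ≠ 0) :
    |t - r| ≤ 1 / (j + 1) := by
  have h1 : ¬ (t < r - 1 / (j + 1) ∨ r < t) := fun h' => h (stepDensity_eq_zero r j h')
  push Not at h1
  rw [abs_le]
  have : (0 : ℝ) ≤ 1 / (j + 1) := by positivity
  constructor <;> linarith

theorem lintegral_stepDensity {n : ℕ} (hn : n ≠ 0) :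
    ∫⁻ t, ENNReal.ofReal (stepDensity n r j t) = 1 := by
  have hj : (0 : ℝ) < 1 / (j + 1) := by positivity
  -- The additional 1 makes points `t ≤ b` lie strictly to the left of the transition, as
  -- `stepDensity_eq_zero` demands. The integral is then that of the derivative of `stepFn ^ n`,
  -- which runs from 0 to 1.
  set b := r - 1 / (j + 1) - 1 with hb
  have hbr : b ≤ r := by linarith
  have hint : IntervalIntegrable (stepDensity n r j) volume b r :=
    (continuous_stepDensity r j n).intervalIntegrable _ _
  have hd : ∀ t ∈ uIcc b r, HasDerivAt (fun t => stepFn r j t ^ n) (stepDensity n r j t) t :=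
    fun t _ => (hasDerivAt_stepFn r j t).fun_pow n
  rw [lintegral_eq_setLIntegral (W := Ioc b r) measurableSet_Ioc fun t ht => ?_,
    ← ofReal_integral_eq_lintegral_ofReal
      ((intervalIntegrable_iff_integrableOn_Ioc_of_le hbr).1 hint)
      (Eventually.of_forall fun t => stepDensity_nonneg r j n t),
    ← intervalIntegral.integral_of_le hbr,
    intervalIntegral.integral_eq_sub_of_hasDerivAt hd hint,
    stepFn_eq_one r j le_rfl, stepFn_eq_zero r j (by linarith)]
  · simp [hn]
  · rw [stepDensity_eq_zero, ENNReal.ofReal_zero]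
    rw [mem_Ioc, not_and_or, not_lt, not_le] at ht
    rcases ht with h | h
    · left; linarith
    · exact Or.inr h

theorem tendsto_stepFn_pow {n : ℕ} (hn : n ≠ 0) (t : ℝ) :
    Tendsto (fun j => stepFn r j t ^ n) atTop (𝓝 ((Ici r).indicator 1 t)) := by
  by_cases h : r ≤ t
  · simp [stepFn_eq_one r _ h, h]
  · have h' : t < r := not_le.1 h
    obtain ⟨N, hN⟩ := exists_nat_one_div_lt (sub_pos.2 h')
    rw [indicator_of_notMem (by simpa using h')]
    refine tendsto_const_nhds.congr' ?_
    filter_upwards [eventually_ge_atTop N] with j hj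
    rw [stepFn_eq_zero, zero_pow hn]
    have : (1 : ℝ) / (j + 1) ≤ 1 / (N + 1) :=
      one_div_le_one_div_of_le (by positivity) (by gcongr)
    linarith

end Step

variable {n : ℕ}

/-- An increasing convex function of a smooth plurisubharmonic function is plurisubharmonic: both
coefficients in the chain rule are nonnegative. -/
theorem isPSHApprox_stepPrim {φ : HSpace n → ℝ} (hφ : ContDiff ℝ ∞ φ) {W : Set (HSpace n)}
    (hW : ∀ q ∈ W, hessOp φ q ∈ posCone n) (r : ℝ) :
    IsPSHApprox W (fun q => max (φ q) r) (fun j q => stepPrim r j (φ q)) where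
  smooth j := (contDiff_stepPrim r j).comp hφ
  pos K _ hKW := Eventually.of_forall fun j q hq => by
    rw [hessOp_comp hφ (hasDerivAt_stepPrim r j) (hasDerivAt_stepFn r j _)]
    exact add_mem (posCone_smul (stepFn_nonneg _ _ _) (hW q (hKW hq)))
      (posCone_smul (deriv_stepFn_nonneg _ _ _) (simpleTwo_mem _))
  unif K _ _ := by
    rw [Metric.tendstoUniformlyOn_iff]
    intro ε hε
    filter_upwards [(tendsto_one_div_add_atTop_nhds_zero_nat (𝕜 := ℝ)).eventually
      (gt_mem_nhds hε)] with j hj q _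
    rw [dist_comm, Real.dist_eq]
    exact (abs_stepPrim_sub_max_le r j _).trans_lt hj

theorem isPSHApprox_const {φ : HSpace n → ℝ} (hφ : ContDiff ℝ ∞ φ) {W : Set (HSpace n)}
    (hW : ∀ q ∈ W, hessOp φ q ∈ posCone n) : IsPSHApprox W φ (fun _ => φ) where
  smooth _ := hφ
  pos _ _ hKW := Eventually.of_forall fun _ q hq => hW q (hKW hq)
  unif _ _ _ := by
    rw [Metric.tendstoUniformlyOn_iff]
    intro ε hε
    exact Eventually.of_forall fun _ _ _ => by simpa using hε

/-- The density of the Monge–Ampère measure of a smooth function. -/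
def smoothDensity (φ : HSpace n → ℝ) (q : HSpace n) : ℝ := (topCoeff ((hessOp φ q ^ n) vac)).re

theorem continuous_smoothDensity {φ : HSpace n → ℝ} (hφ : ContDiff ℝ ∞ φ) :
    Continuous (smoothDensity φ) :=
  Complex.continuous_re.comp (topCoeff_continuous (continuous_hessOp_pow hφ n continuous_const))

/-! ### Monge–Ampère measures where the function is smooth. -/

section SmoothLocal

variable {Ω W : Set (HSpace n)} {u φ : HSpace n → ℝ} {μ μr : Measure (HSpace n)} {r : ℝ}

theorem IsMongeAmpere.integral_eq_smooth (hμ : IsMongeAmpere Ω u μ) (hW : IsOpen W) (hWΩ : W ⊆ Ω)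
    (hφ : ContDiff ℝ ∞ φ) (huφ : ∀ q ∈ W, u q = φ q) (hpos : ∀ q ∈ W, hessOp φ q ∈ posCone n)
    {f : HSpace n → ℝ} (hf : Continuous f) (hc : HasCompactSupport f) (hs : tsupport f ⊆ W) :
    ∫ q, f q ∂μ = ∫ q, f q * smoothDensity φ q :=
  tendsto_nhds_unique (hμ.tendsto hW hWΩ huφ hφ.continuous.continuousOn (isPSHApprox_const hφ hpos)
    hf hc hs) tendsto_const_nhds

theorem IsMongeAmpere.restrict_eq_smooth (hμ : IsMongeAmpere Ω u μ) (hW : IsOpen W) (hWΩ : W ⊆ Ω)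
    (hφ : ContDiff ℝ ∞ φ) (huφ : ∀ q ∈ W, u q = φ q) (hpos : ∀ q ∈ W, hessOp φ q ∈ posCone n) :
    μ.restrict W = (volume.withDensity fun q => ENNReal.ofReal (smoothDensity φ q)).restrict W := by
  have hcont := continuous_smoothDensity hφ
  set ν := (volume : Measure (HSpace n)).withDensity fun q => ENNReal.ofReal (smoothDensity φ q)
    with hν
  have hνK : ∀ K : Set (HSpace n), IsCompact K → K ⊆ W → ν K < ⊤ := by
    intro K hK _
    rw [hν, withDensity_apply _ hK.measurableSet]
    obtain ⟨C, hC⟩ := hK.exists_bound_of_continuousOn hcont.continuousOn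
    refine (setLIntegral_mono' hK.measurableSet (g := fun _ => ENNReal.ofReal C) fun q hq =>
      ENNReal.ofReal_le_ofReal ((le_abs_self _).trans (hC q hq))).trans_lt ?_
    rw [setLIntegral_const]
    exact ENNReal.mul_lt_top ENNReal.ofReal_lt_top hK.measure_lt_top
  have key : ∀ f : HSpace n → ℝ, Continuous f → HasCompactSupport f → tsupport f ⊆ W →
      (∀ q, 0 ≤ f q) → ∫⁻ q, ENNReal.ofReal (f q) ∂μ = ∫⁻ q, ENNReal.ofReal (f q) ∂ν := by
    intro f hf hc hs hf0
    have hfM : ∀ q, 0 ≤ f q * smoothDensity φ q := fun q => by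
      by_cases hq : f q = 0
      · simp [hq]
      · exact mul_nonneg (hf0 q) (topCoeff_hessOp_pow_nonneg (hpos q (hs (subset_tsupport _ hq)))).1
    have hi : Integrable fun q => f q * smoothDensity φ q :=
      (hf.mul hcont).integrable_of_hasCompactSupport hc.mul_right
    rw [← ofReal_integral_eq_lintegral_ofReal
        (integrable_of_compact_subset hμ.2.1 hf hc (hs.trans hWΩ)) (Eventually.of_forall hf0),
      hμ.integral_eq_smooth hW hWΩ hφ huφ hpos hf hc hs,
      ofReal_integral_eq_lintegral_ofReal hi (Eventually.of_forall hfM),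
      hν, lintegral_withDensity_eq_lintegral_mul _ hcont.measurable.ennreal_ofReal
        hf.measurable.ennreal_ofReal]
    refine lintegral_congr fun q => ?_
    rw [Pi.mul_apply, mul_comm (f q), ENNReal.ofReal_mul' (hf0 q)]
  have h1 := restrict_le_of_lintegral_le hW hνK (c := 1) ENNReal.one_ne_top fun f h1 h2 h3 h4 =>
    (key f h1 h2 h3 h4).le.trans_eq (one_mul _).symm
  have h2 := restrict_le_of_lintegral_le hW (fun K hK hKW => hμ.2.1 K hK (hKW.trans hWΩ)) (c := 1)
    ENNReal.one_ne_top fun f h1 h2 h3 h4 => (key f h1 h2 h3 h4).ge.trans_eq (one_mul _).symm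
  rw [one_smul] at h1 h2
  exact le_antisymm h1 h2

/-- The part of the Monge–Ampère measure of `max φ r` that is not carried by `{φ ≥ r}` is the limit
of the averages of the flux density. -/
theorem IsMongeAmpere.tendsto_flux [NeZero n]
    (hμr : IsMongeAmpere Ω (fun q => max (u q) r) μr) (hμ : IsMongeAmpere Ω u μ) (hW : IsOpen W)
    (hWΩ : W ⊆ Ω) (hφ : ContDiff ℝ ∞ φ) (huφ : ∀ q ∈ W, u q = φ q)
    (hpos : ∀ q ∈ W, hessOp φ q ∈ posCone n) {f : HSpace n → ℝ} (hf : Continuous f)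
    (hc : HasCompactSupport f) (hs : tsupport f ⊆ W) (hf0 : ∀ q, 0 ≤ f q) :
    ∃ ℓ : ENNReal, Tendsto (fun j => ∫⁻ q, ENNReal.ofReal (f q * (fluxDensity φ q).re)
        * ENNReal.ofReal (stepDensity n r j (φ q))) atTop (𝓝 ℓ) ∧
      ∫⁻ q, ENNReal.ofReal (f q) ∂μr
        = ℓ + ∫⁻ q in {q | r ≤ φ q}, ENNReal.ofReal (f q) ∂μ := by
  have hn : n ≠ 0 := NeZero.ne n
  have hMc := continuous_smoothDensity hφ
  have hDc : Continuous fun q => (fluxDensity φ q).re :=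
    Complex.continuous_re.comp (continuous_fluxDensity hφ)
  have hlim := hμr.tendsto hW hWΩ (u' := fun q => max (φ q) r) (fun q hq => by rw [huφ q hq])
    (by have := hφ.continuous; fun_prop) (isPSHApprox_stepPrim hφ hpos r) hf hc hs
  -- The volume part and the flux part of `(△(χ∘φ))^n`.
  have hsplit : ∀ j, ∫ q, f q * (topCoeff ((hessOp (fun q => stepPrim r j (φ q)) q ^ n) vac)).re
      = (∫ q, f q * smoothDensity φ q * stepFn r j (φ q) ^ n)
        + ∫ q, f q * (fluxDensity φ q).re * stepDensity n r j (φ q) := by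
    intro j
    rw [← integral_add]
    · refine integral_congr_ae (Eventually.of_forall fun q => ?_)
      simp only
      rw [topCoeff_hessOp_comp_pow hφ (hasDerivAt_stepPrim r j) (hasDerivAt_stepFn r j _),
        Complex.add_re, Complex.re_ofReal_mul, Complex.re_ofReal_mul, smoothDensity, stepDensity]
      ring
    · refine Continuous.integrable_of_hasCompactSupport ?_ (hc.mul_right.mul_right)
      exact (hf.mul hMc).mul (((contDiff_stepFn r j).continuous.comp hφ.continuous).pow n)
    · refine Continuous.integrable_of_hasCompactSupport ?_ (hc.mul_right.mul_right)
      exact (hf.mul hDc).mul ((continuous_stepDensity r j n).comp hφ.continuous)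
  have hfM0 : ∀ q, 0 ≤ f q * smoothDensity φ q := fun q => by
    by_cases hq : f q = 0
    · simp [hq]
    · exact mul_nonneg (hf0 q) (topCoeff_hessOp_pow_nonneg (hpos q (hs (subset_tsupport _ hq)))).1
  have hfD0 : ∀ q, 0 ≤ f q * (fluxDensity φ q).re := fun q => by
    by_cases hq : f q = 0
    · simp [hq]
    · exact mul_nonneg (hf0 q) (fluxDensity_nonneg (hpos q (hs (subset_tsupport _ hq)))).1
  have hfMi : Integrable fun q => f q * smoothDensity φ q :=
    (hf.mul hMc).integrable_of_hasCompactSupport hc.mul_right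
  have hlm : MeasurableSet {q | r ≤ φ q} :=
    (isClosed_le continuous_const hφ.continuous).measurableSet
  have h1 : Tendsto (fun j => ∫ q, f q * smoothDensity φ q * stepFn r j (φ q) ^ n) atTop
      (𝓝 (∫ q in {q | r ≤ φ q}, f q * smoothDensity φ q)) := by
    rw [← integral_indicator hlm]
    refine tendsto_integral_of_dominated_convergence (fun q => f q * smoothDensity φ q)
      (fun j => ?_) hfMi (fun j => Eventually.of_forall fun q => ?_)
      (Eventually.of_forall fun q => ?_)
    · exact ((hf.mul hMc).mul
        (((contDiff_stepFn r j).continuous.comp hφ.continuous).pow n)).aestronglyMeasurable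
    · rw [Real.norm_of_nonneg (mul_nonneg (hfM0 q) (pow_nonneg (stepFn_nonneg _ _ _) _))]
      exact mul_le_of_le_one_right (hfM0 q)
        (pow_le_one₀ (stepFn_nonneg _ _ _) (stepFn_le_one _ _ _))
    · have := (tendsto_stepFn_pow r hn (φ q)).const_mul (f q * smoothDensity φ q)
      convert this using 2
      by_cases hq : r ≤ φ q
      · simp [indicator, hq]
      · simp [indicator, hq]
  -- The flux integrals converge because the total and the volume part do. Hence the coarea estimate
  -- only has to compare an existing limit with the surface integral.
  have h2 : Tendsto (fun j => ∫ q, f q * (fluxDensity φ q).re * stepDensity n r j (φ q)) atTop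
      (𝓝 (∫ q, f q ∂μr - ∫ q in {q | r ≤ φ q}, f q * smoothDensity φ q)) := by
    refine (hlim.sub h1).congr fun j => ?_
    rw [hsplit j]
    ring
  have hnn : ∀ j q, 0 ≤ f q * (fluxDensity φ q).re * stepDensity n r j (φ q) := fun j q =>
    mul_nonneg (hfD0 q) (stepDensity_nonneg r j n _)
  have hge : 0 ≤ ∫ q, f q ∂μr - ∫ q in {q | r ≤ φ q}, f q * smoothDensity φ q :=
    ge_of_tendsto' h2 fun j => integral_nonneg (hnn j)
  refine ⟨ENNReal.ofReal (∫ q, f q ∂μr - ∫ q in {q | r ≤ φ q}, f q * smoothDensity φ q), ?_, ?_⟩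
  · refine ((ENNReal.continuous_ofReal.tendsto _).comp h2).congr fun j => ?_
    simp only [Function.comp_apply]
    rw [ofReal_integral_eq_lintegral_ofReal _ (Eventually.of_forall (hnn j))]
    · refine lintegral_congr fun q => ?_
      rw [ENNReal.ofReal_mul (hfD0 q)]
    · refine Continuous.integrable_of_hasCompactSupport ?_ (hc.mul_right.mul_right)
      exact (hf.mul hDc).mul ((continuous_stepDensity r j n).comp hφ.continuous)
  -- On `W` the measure `μ` has the density `smoothDensity φ`, which identifies the limit of the
  -- volume part.
  · have h3 : ∫⁻ q in {q | r ≤ φ q}, ENNReal.ofReal (f q) ∂μ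
        = ENNReal.ofReal (∫ q in {q | r ≤ φ q}, f q * smoothDensity φ q) := by
      have hW0 : ∀ q ∉ W, ({q | r ≤ φ q}.indicator fun q => ENNReal.ofReal (f q)) q = 0 :=
        fun q hq => by
          have : f q = 0 := image_eq_zero_of_notMem_tsupport fun h => hq (hs h)
          simp [indicator, this]
      rw [ofReal_integral_eq_lintegral_ofReal hfMi.integrableOn (Eventually.of_forall hfM0),
        ← lintegral_indicator hlm, lintegral_eq_setLIntegral hW.measurableSet hW0,
        hμ.restrict_eq_smooth hW hWΩ hφ huφ hpos, ← lintegral_eq_setLIntegral hW.measurableSet hW0,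
        lintegral_withDensity_eq_lintegral_mul _ hMc.measurable.ennreal_ofReal
          (hf.measurable.ennreal_ofReal.indicator hlm), ← lintegral_indicator hlm]
      refine lintegral_congr fun q => ?_
      rw [Pi.mul_apply]
      by_cases hq : q ∈ {q | r ≤ φ q}
      · rw [indicator_of_mem hq, indicator_of_mem hq, mul_comm (f q), ENNReal.ofReal_mul' (hf0 q)]
      · rw [indicator_of_notMem hq, indicator_of_notMem hq, mul_zero]
    rw [h3, ← ENNReal.ofReal_add hge (integral_nonneg hfM0), sub_add_cancel,
      ofReal_integral_eq_lintegral_ofReal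
        (integrable_of_compact_subset hμr.2.1 hf hc (hs.trans hWΩ)) (Eventually.of_forall hf0)]

end SmoothLocal

end QuatMA

namespace QuatMA

open Filter Topology
open scoped NNReal

variable {n : ℕ}

/-- Multiplication by a cutoff replaces the locally smooth `φ` by a globally smooth function, to
which the pointwise calculus applies. -/
theorem exists_local_extension {Ω U : Set (HSpace n)} (hΩ : IsOpen Ω) (hU : IsOpen U)
    {φ : HSpace n → ℝ} (hφ : ContDiffOn ℝ ∞ φ U) {p : HSpace n} (hpΩ : p ∈ Ω) (hpU : p ∈ U) :
    ∃ (ψ : HSpace n → ℝ) (W : Set (HSpace n)), ContDiff ℝ ∞ ψ ∧ IsOpen W ∧ p ∈ W ∧ W ⊆ Ω ∧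
      ∀ q ∈ W, φ q = ψ q := by
  obtain ⟨ε, hε, hεU⟩ := Metric.nhds_basis_closedBall.mem_iff.1 ((hΩ.inter hU).mem_nhds ⟨hpΩ, hpU⟩)
  obtain ⟨χ, hχ, -, hχU, hχ1, -⟩ :=
    exists_cutoff (isCompact_closedBall p ε) (hΩ.inter hU) hεU
  refine ⟨fun q => χ q * φ q, Metric.ball p ε, ?_, Metric.isOpen_ball, Metric.mem_ball_self hε,
    fun q hq => (hεU (Metric.ball_subset_closedBall hq)).1, fun q hq => ?_⟩
  · refine contDiff_iff_contDiffAt.2 fun q => ?_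
    by_cases hq : q ∈ tsupport χ
    · exact hχ.contDiffAt.mul (hφ.contDiffAt (hU.mem_nhds (hχU hq).2))
    · have : (fun q => χ q * φ q) =ᶠ[𝓝 q] fun _ => 0 := by
        filter_upwards [notMem_tsupport_iff_eventuallyEq.1 hq] with x hx
        simp [hx]
      exact contDiffAt_const.congr_of_eventuallyEq this
  · simp only [hχ1 q (Metric.ball_subset_closedBall hq), one_mul]

theorem hessOp_const (r : ℝ) (q : HSpace n) : hessOp (fun _ => r) q = 0 := by
  have h : ∀ m, pd m (fun _ : HSpace n => r) = fun _ => 0 := fun m => by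
    funext x
    simp [pd]
  have h0 : ∀ m, pd m (fun _ : HSpace n => (0 : ℝ)) = fun _ => 0 := fun m => by
    funext x
    simp [pd]
  simp [hessOp, hessForm, hessian, h, h0]

theorem setLIntegral_congr_inter {α : Type*} [MeasurableSpace α] {μ : Measure α} {W s t : Set α}
    (hW : MeasurableSet W) (hst : W ∩ s = W ∩ t) {h : α → ENNReal} (h0 : ∀ x ∉ W, h x = 0) :
    ∫⁻ x in s, h x ∂μ = ∫⁻ x in t, h x ∂μ := by
  rw [lintegral_eq_setLIntegral hW h0, lintegral_eq_setLIntegral (μ := μ.restrict t) hW h0,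
    Measure.restrict_restrict hW, Measure.restrict_restrict hW, hst]

/-- Two measures that are locally comparable with constants arbitrarily close to `1` agree. -/
theorem eq_of_locally_comparable {W : Set (HSpace n)} {A B : Measure (HSpace n)} (hW : IsOpen W)
    (hA0 : A Wᶜ = 0) (hB0 : B Wᶜ = 0) (hB : ∀ K : Set (HSpace n), IsCompact K → K ⊆ W → B K < ⊤)
    (h : ∀ c : ℝ≥0, 1 < c → ∀ p ∈ W, ∃ V, IsOpen V ∧ p ∈ V ∧ V ⊆ W ∧
      ∀ f : HSpace n → ℝ, Continuous f → HasCompactSupport f → tsupport f ⊆ V → (∀ x, 0 ≤ f x) →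
        ∫⁻ x, ENNReal.ofReal (f x) ∂A ≤ c * ∫⁻ x, ENNReal.ofReal (f x) ∂B ∧
        ∫⁻ x, ENNReal.ofReal (f x) ∂B ≤ c * ∫⁻ x, ENNReal.ofReal (f x) ∂A) : A = B := by
  have hAr : A.restrict W = A := Measure.restrict_eq_self_of_ae_mem (by
    rw [ae_iff]; exact hA0)
  have hBr : B.restrict W = B := Measure.restrict_eq_self_of_ae_mem (by
    rw [ae_iff]; exact hB0)
  have h1 : ∀ c : ℝ≥0, 1 < c → A ≤ (c : ENNReal) • B := by
    intro c hc
    rw [← hAr, ← hBr, ← Measure.restrict_smul]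
    refine restrict_le_of_locally hW.measurableSet fun p hp => ?_
    obtain ⟨V, hV, hpV, hVW, hf⟩ := h c hc p hp
    exact ⟨V, hV, hpV, restrict_le_of_lintegral_le hV (fun K hK hKV => hB K hK (hKV.trans hVW))
      ENNReal.coe_ne_top fun f h1 h2 h3 h4 => (hf f h1 h2 h3 h4).1⟩
  have hA : ∀ K : Set (HSpace n), IsCompact K → K ⊆ W → A K < ⊤ := fun K hK hKW =>
    (h1 2 one_lt_two K).trans_lt (by
      rw [Measure.smul_apply, smul_eq_mul]
      exact ENNReal.mul_lt_top ENNReal.coe_lt_top (hB K hK hKW))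
  have h2 : ∀ c : ℝ≥0, 1 < c → B ≤ (c : ENNReal) • A := by
    intro c hc
    rw [← hAr, ← hBr, ← Measure.restrict_smul]
    refine restrict_le_of_locally hW.measurableSet fun p hp => ?_
    obtain ⟨V, hV, hpV, hVW, hf⟩ := h c hc p hp
    exact ⟨V, hV, hpV, restrict_le_of_lintegral_le hV (fun K hK hKV => hA K hK (hKV.trans hVW))
      ENNReal.coe_ne_top fun f h1 h2 h3 h4 => (hf f h1 h2 h3 h4).2⟩
  -- The constants have been made global for each fixed `c`; now `c` tends to 1.
  have key : ∀ C D : Measure (HSpace n), (∀ c : ℝ≥0, 1 < c → C ≤ (c : ENNReal) • D) → C ≤ D := by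
    intro C D hCD
    refine Measure.le_iff.2 fun s _ => ?_
    have hlim : Tendsto (fun c : ℝ≥0 => (c : ENNReal) * D s) (𝓝[>] 1)
        (𝓝 (((1 : ℝ≥0) : ENNReal) * D s)) :=
      ENNReal.Tendsto.mul_const (ENNReal.tendsto_coe.2 (tendsto_id.mono_left nhdsWithin_le_nhds))
        (Or.inl (by simp))
    rw [ENNReal.coe_one, one_mul] at hlim
    refine ge_of_tendsto hlim ?_
    filter_upwards [self_mem_nhdsWithin] with c hc
    simpa using hCD c hc s
  exact le_antisymm (key A B h1) (key B A h2)

/-! ### The boundary density and the jump formula. -/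

section Boundary

variable {Ω : Set (HSpace n)} {φ : HSpace n → ℝ} {r : ℝ} {μ μr : Measure (HSpace n)}

theorem surfaceHausdorff_hSpace :
    surfaceHausdorff (HSpace n) = Measure.euclideanHausdorffMeasure (4 * n - 1) := by
  rw [surfaceHausdorff, finrank_euclideanSpace]
  simp [mul_comm]

theorem isOpen_sublevel (hΩ : IsOpen Ω) (hφ : ContinuousOn φ Ω) : IsOpen (sublevel Ω φ r) :=
  hφ.isOpen_inter_preimage hΩ isOpen_Iio

theorem gradient_ne_zero_of_eventuallyEq {ψ : HSpace n → ℝ} {q : HSpace n} (h : φ =ᶠ[𝓝 q] ψ)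
    (hd : fderiv ℝ φ q ≠ 0) : gradient ψ q ≠ 0 := by
  rw [gradient, ← h.fderiv_eq]
  simpa using hd

theorem boundaryDensity_nonneg [NeZero n] {U : Set (HSpace n)} (hΩ : IsOpen Ω) (hφ : PSH Ω φ)
    (hU : IsOpen U) (hφU : ContDiffOn ℝ ∞ φ U) {q : HSpace n} (hqΩ : q ∈ Ω) (hqU : q ∈ U)
    (hd : fderiv ℝ φ q ≠ 0) : (boundaryDensity φ q).im = 0 ∧ 0 ≤ (boundaryDensity φ q).re := by
  obtain ⟨ψ, W, hψ, hW, hqW, hWΩ, hφψ⟩ := exists_local_extension hΩ hU hφU hqΩ hqU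
  have hev : φ =ᶠ[𝓝 q] ψ := by filter_upwards [hW.mem_nhds hqW] using hφψ
  have hpos := fluxDensity_nonneg
    (hessOp_mem_posCone_of_PSH hφ hW hWΩ hψ (fun x hx => (hφψ x hx).symm) hqW)
  rw [boundaryDensity_congr hev, boundaryDensity_eq hψ (gradient_ne_zero_of_eventuallyEq hev hd),
    Complex.div_ofReal_re, Complex.div_ofReal_im]
  exact ⟨by rw [hpos.2, zero_div], div_nonneg hpos.1 (norm_nonneg _)⟩

/-- The measure given by the boundary density. -/
def densityMeasure [NeZero n] (Ω : Set (HSpace n)) (φ : HSpace n → ℝ) (r : ℝ) :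
    Measure (HSpace n) :=
  (surfaceMeasure Ω φ r).withDensity fun q => ENNReal.ofReal (boundaryDensity φ q).re

theorem densityMeasure_eq_zero [NeZero n] {W : Set (HSpace n)} (hW : MeasurableSet W)
    (h : W ∩ level Ω φ r = ∅) : densityMeasure Ω φ r W = 0 := by
  refine withDensity_absolutelyContinuous _ _ ?_
  rw [surfaceMeasure, Measure.restrict_apply hW, h, measure_empty]

/-- This brings the candidate measure into the form of the surface integral in `exists_nhds_coarea`,
with `f` times the flux density as the function integrated. -/
theorem lintegral_densityMeasure [NeZero n] {W : Set (HSpace n)} {ψ : HSpace n → ℝ}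
    (hψ : ContDiff ℝ ∞ ψ) (hW : IsOpen W) (hWΩ : W ⊆ Ω) (hφψ : ∀ q ∈ W, φ q = ψ q)
    (hg : ∀ q ∈ level Ω φ r, fderiv ℝ φ q ≠ 0) {f : HSpace n → ℝ} (hf : Continuous f)
    (hs : tsupport f ⊆ W) (hf0 : ∀ q, 0 ≤ f q) :
    ∫⁻ q, ENNReal.ofReal (f q) ∂(densityMeasure Ω φ r)
      = ∫⁻ q in {q | ψ q = r}, ENNReal.ofReal (f q * (fluxDensity ψ q).re)
          * ENNReal.ofReal ‖gradient ψ q‖⁻¹ ∂(surfaceHausdorff (HSpace n)) := by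
  have hfW : ∀ q ∉ W, f q = 0 := fun q hq => image_eq_zero_of_notMem_tsupport fun h => hq (hs h)
  have hgc : Continuous (gradient ψ) :=
    (InnerProductSpace.toDual ℝ (HSpace n)).symm.continuous.comp (hψ.continuous_fderiv (by simp))
  have hDm : Measurable fun q => ENNReal.ofReal ((fluxDensity ψ q).re * ‖gradient ψ q‖⁻¹) :=
    ((Complex.continuous_re.comp (continuous_fluxDensity hψ)).measurable.mul
      hgc.norm.measurable.inv).ennreal_ofReal
  have hlev : W ∩ level Ω φ r = W ∩ {q | ψ q = r} := by
    ext q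
    constructor
    · rintro ⟨h1, _, h2⟩
      exact ⟨h1, (hφψ q h1).symm.trans h2⟩
    · rintro ⟨h1, h2⟩
      exact ⟨h1, hWΩ h1, (hφψ q h1).trans h2⟩
  have hm : MeasurableSet (W ∩ {q | ψ q = r}) :=
    hW.measurableSet.inter (isClosed_eq hψ.continuous continuous_const).measurableSet
  have hres : (densityMeasure Ω φ r).restrict W = ((surfaceHausdorff (HSpace n)).restrict
      (W ∩ {q | ψ q = r})).withDensity
        fun q => ENNReal.ofReal ((fluxDensity ψ q).re * ‖gradient ψ q‖⁻¹) := by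
    rw [densityMeasure, restrict_withDensity hW.measurableSet, surfaceMeasure,
      Measure.restrict_restrict hW.measurableSet, hlev, surfaceHausdorff_hSpace]
    refine withDensity_congr_ae ((ae_restrict_iff' hm).2 (Eventually.of_forall fun q hq => ?_))
    have hev : φ =ᶠ[𝓝 q] ψ := by filter_upwards [hW.mem_nhds hq.1] using hφψ
    simp only
    rw [boundaryDensity_congr hev, boundaryDensity_eq hψ
      (gradient_ne_zero_of_eventuallyEq hev (hg q (hlev.ge hq).2)), Complex.div_ofReal_re,
      div_eq_mul_inv]
  rw [lintegral_eq_setLIntegral hW.measurableSet (fun q hq => by simp [hfW q hq]), hres,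
    lintegral_withDensity_eq_lintegral_mul _ hDm hf.measurable.ennreal_ofReal,
    setLIntegral_congr_inter (t := {q | ψ q = r}) hW.measurableSet
      (by rw [← inter_assoc, inter_self]) (fun q hq => by simp [hfW q hq])]
  refine lintegral_congr fun q => ?_
  rw [Pi.mul_apply, ENNReal.ofReal_mul' (inv_nonneg.2 (norm_nonneg _)), ENNReal.ofReal_mul (hf0 q)]
  ring

/-- Locally the maximum is the constant `r`, whose Hessian form vanishes; its `n`-th power is zero
because `n ≠ 0`. -/
theorem lintegral_max_eq_zero [NeZero n]
    (hμr : IsMongeAmpere Ω (fun q => max (φ q) r) μr) {W : Set (HSpace n)} (hW : IsOpen W)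
    (hWΩ : W ⊆ Ω) (h : ∀ q ∈ W, φ q < r) {f : HSpace n → ℝ} (hf : Continuous f)
    (hc : HasCompactSupport f) (hs : tsupport f ⊆ W) (hf0 : ∀ q, 0 ≤ f q) :
    ∫⁻ q, ENNReal.ofReal (f q) ∂μr = 0 := by
  rw [← ofReal_integral_eq_lintegral_ofReal
      (integrable_of_compact_subset hμr.2.1 hf hc (hs.trans hWΩ)) (Eventually.of_forall hf0),
    hμr.integral_eq_smooth (φ := fun _ => r) hW hWΩ contDiff_const
      (fun q hq => max_eq_right (h q hq).le)
      (fun q _ => by rw [hessOp_const]; exact zero_mem _) hf hc hs]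
  simp [smoothDensity, hessOp_const, zero_pow (NeZero.ne n)]

/-- The jump formula for the Monge–Ampère measure of `max φ r`. -/
theorem densityMeasure_add_restrict [NeZero n] {U : Set (HSpace n)} (hΩ : IsOpen Ω)
    (hφc : ContinuousOn φ Ω) (hφ : PSH Ω φ) (hU : IsOpen U) (hlU : level Ω φ r ⊆ U)
    (hφU : ContDiffOn ℝ ∞ φ U) (hd : ∀ q ∈ level Ω φ r, fderiv ℝ φ q ≠ 0)
    (hμ : IsMongeAmpere Ω φ μ) (hμr : IsMongeAmpere Ω (fun q => max (φ q) r) μr) :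
    densityMeasure Ω φ r + μ.restrict (Ω \ sublevel Ω φ r) = μr := by
  refine eq_of_locally_comparable hΩ ?_ hμr.1 hμr.2.1 fun c hc p hp => ?_
  · rw [Measure.add_apply, densityMeasure_eq_zero hΩ.measurableSet.compl, zero_add]
    · exact le_antisymm ((Measure.restrict_le_self _).trans_eq hμ.1) zero_le
    · exact (disjoint_compl_left_iff_subset.2 fun q hq => hq.1).inter_eq
  have hc1 : (1 : ENNReal) ≤ c := by exact_mod_cast hc.le
  simp only [lintegral_add_measure]
  have hvan : ∀ {f : HSpace n → ℝ} {V : Set (HSpace n)}, tsupport f ⊆ V → ∀ q ∉ V,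
      ENNReal.ofReal (f q) = 0 := fun hs q hq => by
    rw [image_eq_zero_of_notMem_tsupport fun h => hq (hs h), ENNReal.ofReal_zero]
  have hm0 : ∀ {f : HSpace n → ℝ} {V : Set (HSpace n)}, IsOpen V → tsupport f ⊆ V →
      V ∩ level Ω φ r = ∅ → ∫⁻ q, ENNReal.ofReal (f q) ∂(densityMeasure Ω φ r) = 0 := by
    intro f V hV hs hVl
    rw [lintegral_eq_setLIntegral hV.measurableSet (hvan hs),
      Measure.restrict_eq_zero.2 (densityMeasure_eq_zero hV.measurableSet hVl),
      lintegral_zero_measure]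
  -- Below the level every term vanishes, and above it the maximum is `φ` itself and no surface term
  -- occurs. Only points of the level set need the constant `c`.
  rcases lt_trichotomy (φ p) r with hpr | hpr | hpr
  · have hV := isOpen_sublevel (r := r) hΩ hφc
    refine ⟨sublevel Ω φ r, hV, ⟨hp, hpr⟩, fun q hq => hq.1, fun f hf hfc hs hf0 => ?_⟩
    rw [lintegral_max_eq_zero hμr hV (fun q hq => hq.1) (fun q hq => hq.2) hf hfc hs hf0,
      hm0 hV hs, setLIntegral_congr_inter (t := ∅) hV.measurableSet _ (hvan hs)]
    · simp
    · simp
    · ext q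
      simp only [sublevel, level, mem_inter_iff, mem_ofPred_eq, mem_empty_iff_false, iff_false]
      rintro ⟨⟨_, h1⟩, _, h2⟩
      exact h1.ne h2
  · obtain ⟨ψ, W, hψ, hW, hpW, hWΩ, hφψ⟩ :=
      exists_local_extension hΩ hU hφU hp (hlU ⟨hp, hpr⟩)
    have hpos : ∀ q ∈ W, hessOp ψ q ∈ posCone n := fun q hq =>
      hessOp_mem_posCone_of_PSH hφ hW hWΩ hψ (fun x hx => (hφψ x hx).symm) hq
    have hev : φ =ᶠ[𝓝 p] ψ := by filter_upwards [hW.mem_nhds hpW] using hφψ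
    obtain ⟨W', hW', hpW', hcoarea⟩ := exists_nhds_coarea (r := r)
      (hψ.of_le (by exact_mod_cast le_top) : ContDiff ℝ 1 ψ)
      (gradient_ne_zero_of_eventuallyEq hev (hd p ⟨hp, hpr⟩)) hc
    refine ⟨W ∩ W', hW.inter hW', ⟨hpW, hpW'⟩, inter_subset_left.trans hWΩ,
      fun f hf hfc hs hf0 => ?_⟩
    have hsW := hs.trans inter_subset_left
    have hsW' := hs.trans inter_subset_right
    obtain ⟨ℓ, hℓ, hμrℓ⟩ := hμr.tendsto_flux hμ hW hWΩ hψ hφψ hpos hf hfc hsW hf0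
    have hDc : Continuous fun q => (fluxDensity ψ q).re :=
      Complex.continuous_re.comp (continuous_fluxDensity hψ)
    obtain ⟨h1, h2⟩ := hcoarea (fun q => f q * (fluxDensity ψ q).re) (hf.mul hDc) hfc.mul_right
      (tsupport_mul_subset_left.trans hsW') (fun j t => ENNReal.ofReal (stepDensity n r j t))
      (fun j => 1 / (j + 1)) (fun j => (continuous_stepDensity r j n).measurable.ennreal_ofReal)
      (fun j => lintegral_stepDensity r j (NeZero.ne n))
      (fun j t ht => abs_sub_le_of_stepDensity_ne_zero r j fun h => ht (by rw [h]; simp))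
      tendsto_one_div_add_atTop_nhds_zero_nat ℓ hℓ
    -- The kernels are `stepDensity`, of mass 1 and concentrating at `r`. The coarea bounds thus
    -- compare the flux limit `ℓ` with the candidate surface measure up to the factor `c`.
    rw [← lintegral_densityMeasure (φ := φ) (r := r) hψ hW hWΩ hφψ hd hf hsW hf0] at h1 h2
    have hset : W ∩ (Ω \ sublevel Ω φ r) = W ∩ {q | r ≤ ψ q} := by
      ext q
      simp only [sublevel, mem_inter_iff, Set.mem_sdiff, mem_ofPred_eq, not_and, not_lt]
      constructor
      · rintro ⟨h1, h2, h3⟩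
        exact ⟨h1, by rw [← hφψ q h1]; exact h3 h2⟩
      · rintro ⟨h1, h2⟩
        exact ⟨h1, hWΩ h1, fun _ => by rw [hφψ q h1]; exact h2⟩
    rw [setLIntegral_congr_inter hW.measurableSet hset (hvan hsW), hμrℓ, mul_add, mul_add]
    exact ⟨add_le_add h2 (le_mul_of_one_le_left' hc1), add_le_add h1 (le_mul_of_one_le_left' hc1)⟩
  · have hV : IsOpen (Ω ∩ φ ⁻¹' Ioi r) := hφc.isOpen_inter_preimage hΩ isOpen_Ioi
    refine ⟨Ω ∩ φ ⁻¹' Ioi r, hV, ⟨hp, hpr⟩, inter_subset_left, fun f hf hfc hs hf0 => ?_⟩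
    rw [hm0 hV hs, setLIntegral_congr_inter (t := univ) hV.measurableSet _ (hvan hs),
      setLIntegral_univ, zero_add, hμr.lintegral_eq hμ hV inter_subset_left inter_subset_left
        (fun q hq => max_eq_left (le_of_lt hq.2)) (hφc.mono inter_subset_left) hf hfc hs hf0]
    · exact ⟨le_mul_of_one_le_left' hc1, le_mul_of_one_le_left' hc1⟩
    · ext q
      simp only [sublevel, mem_inter_iff, Set.mem_sdiff, mem_ofPred_eq, not_and, not_lt, mem_preimage,
        mem_Ioi, mem_univ, and_true]
      constructor
      · exact fun h => h.1
      · exact fun h => ⟨h, h.1, fun _ => h.2.le⟩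
    · ext q
      simp only [level, mem_inter_iff, mem_ofPred_eq, mem_empty_iff_false, iff_false, mem_preimage,
        mem_Ioi]
      rintro ⟨⟨_, h1⟩, _, h2⟩
      exact h1.ne' h2

/-- This permits cancelling the restricted measure in the additive definition of the boundary
measure. -/
theorem IsMongeAmpere.sigmaFinite (hΩ : IsOpen Ω) (hμ : IsMongeAmpere Ω φ μ) : SigmaFinite μ := by
  refine ⟨⟨⟨fun N => exhaustSet Ω N ∪ Ωᶜ, fun _ => trivial, fun N => ?_, ?_⟩⟩⟩
  · refine (measure_union_le _ _).trans_lt ?_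
    rw [hμ.1, add_zero]
    exact hμ.2.1 _ (isCompact_exhaustSet Ω N) (exhaustSet_subset Ω N)
  · refine eq_univ_of_forall fun q => mem_iUnion.2 ?_
    by_cases hq : q ∈ Ω
    · obtain ⟨N, hN⟩ :=
        (subset_exhaustSet hΩ isCompact_singleton (singleton_subset_iff.2 hq)).exists
      exact ⟨N, Or.inl (hN rfl)⟩
    · exact ⟨0, Or.inr hq⟩

end Boundary

end QuatMA

theorem proposition5p1 (n : ℕ) [NeZero n] (Ω : Set (QuatMA.HSpace n))
    (hΩ : QuatMA.StrictlyPseudoconvex Ω) (φ : QuatMA.HSpace n → ℝ) (hφc : ContinuousOn φ Ω)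
    (hφ : QuatMA.PSH Ω φ) (r : ℝ)
    (hsmooth : ∃ U : Set (QuatMA.HSpace n), IsOpen U ∧ QuatMA.level Ω φ r ⊆ U ∧
      ContDiffOn ℝ ∞ φ U)
    (hdφ : ∀ q ∈ QuatMA.level Ω φ r, fderiv ℝ φ q ≠ 0) :
    (∀ q ∈ QuatMA.level Ω φ r,
      (QuatMA.boundaryDensity φ q).im = 0 ∧ 0 ≤ (QuatMA.boundaryDensity φ q).re) ∧
    ∀ m : MeasureTheory.Measure (QuatMA.HSpace n), QuatMA.IsBoundaryMeasure Ω φ r m ↔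
      m = (QuatMA.surfaceMeasure Ω φ r).withDensity
        (fun q => ENNReal.ofReal (QuatMA.boundaryDensity φ q).re) := by
  obtain ⟨U, hU, hlU, hφU⟩ := hsmooth
  have hΩo := hΩ.1
  refine ⟨fun q hq =>
    QuatMA.boundaryDensity_nonneg hΩo hφ hU hφU hq.1 (hlU hq) (hdφ q hq), fun m => ⟨?_, ?_⟩⟩
  -- Uniqueness: the jump formula holds for any pair of Monge–Ampère measures, so the common summand
  -- can be cancelled.
  · rintro ⟨μ, μr, hμ, hμr, h⟩
    have := hμ.sigmaFinite hΩo
    rw [← QuatMA.densityMeasure_add_restrict hΩo hφc hφ hU hlU hφU hdφ hμ hμr, add_comm,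
      add_comm (QuatMA.densityMeasure Ω φ r), Measure.add_right_inj] at h
    exact h
  -- Existence: both Monge–Ampère measures exist, because `φ` and `max φ r` are continuous and
  -- plurisubharmonic.
  · rintro rfl
    obtain ⟨μ, hμ⟩ := QuatMA.exists_isMongeAmpere hΩo hφc hφ
    obtain ⟨μr, hμr⟩ := QuatMA.exists_isMongeAmpere hΩo (hφc.sup continuousOn_const) (hφ.max_const r)
    exact ⟨μ, μr, hμ, hμr,
      QuatMA.densityMeasure_add_restrict hΩo hφc hφ hU hlU hφU hdφ hμ hμr⟩

end
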